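/- **Theorem 3.11.** Let $R$ be a commutative artinian ring, $J$ an injective envelope of the $R$-module $R/\operatorname{rad}R$, $D=\operatorname{Hom}_R(-,J)$, and let $\Lambda$ be an artin $R$-algebra, i.e. an $R$-algebra that is finitely generated as an $R$-module. Let $e_1,\dots,e_n$ be a complete set of primitive orthogonal idempotents of $\Lambda$ (so $e_1+\cdots+e_n=1$), and $\Delta=\{e_1,\dots,e_n\}$. For an artin $R$-algebra $\Gamma$ let $\Gamma\text{-mod}$ be the category of finitely generated left $\Gamma$-modules, and $\mathcal P(\Gamma)$, $\mathcal I(\Gamma)$ its full subcategories of projective and of injective modules. A torsion pair on $\Gamma\text{-mod}$ is a pair $(\mathcal T,\mathcal F)$ of full subcategories closed under isomorphism such that $\operatorname{Hom}(X,Y)=0$ for all $X\in\mathcal T$, $Y\in\mathcal F$, and every $X\in\Gamma\text{-mod}$ has an exact sequence $0\to A\to X\to B\to 0$ with $A\in\mathcal T$, $B\in\mathcal F$. Let $\mathbf E(\Gamma)$ be the set of torsion pairs on $\Gamma\text{-mod}$ such that $\mathcal T$ contains no nonzero projective module and $\mathcal F$ contains no nonzero injective module. Write $\operatorname{add}M$,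 $\operatorname{Gen}M$, $\operatorname{Cogen}M$ for the classes of finitely generated modules that are direct summands of, quotients of, submodules of some finite power $M^k$, respectively, up to isomorphism. Write $\langle\mathcal C_1,\mathcal C_2,\dots\rangle$ for the smallest extension-closed class containing $\mathcal C_1,\mathcal C_2,\dots$. Consider sequences $S=(\Delta_0,\dots,\Delta_m)$, $m\ge 0$, of pairwise disjoint subsets of $\Delta$ with $\Delta_1,\dots,\Delta_m\neq\emptyset$ ($\Delta_0$ may be empty), such that with $e$ each $\Delta_j$ contains every $e'\in\Delta$ with $\Lambda e'\cong\Lambda e$ (no condition if $\Lambda$ is basic). Put $e_S^j=\sum_{e\in\Delta_j}e$, let $\Lambda_S^j$ be the quotient of $\Lambda$ by the two-sided ideal generated by $e_S^0+\cdots+e_S^{j-1}$ (so $\Lambda_S^0=\Lambda$), and $$P_j=\bigoplus_{e\in\Delta_j}\Lambda_S^j e,\qquad I_j=\bigoplus_{e\in\Delta_j}D(e\Lambda_S^j).$$ View $\Lambda_S^j\text{-mod}$ as a full subcategory of $\Lambda\text{-mod}$. The sequence $S$ is a *1-type part partition* if 1. $e_S^{2i-1}\Lambda_S^{2i-1}e\neq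 0$ whenever $0<2i\le m$ and $e\in\Delta_{2i}$; 2. $e\Lambda_S^{2i}e_S^{2i}\neq 0$ whenever $1<2i+1\le m$ and $e\in\Delta_{2i+1}$. Let $\mathfrak M$ be the set of torsion pairs on $\Lambda\text{-mod}$, and $\mathfrak N$ the set of pairs $(S,(\mathcal T',\mathcal F'))$ with $S=(\Delta_0,\dots,\Delta_m)$ a 1-type part partition and $(\mathcal T',\mathcal F')\in\mathbf E(\Lambda_S^{m+1})$. Then there are mutually inverse bijections $F:\mathfrak M\to\mathfrak N$ and $G:\mathfrak N\to\mathfrak M$ such that: * $F(\mathcal T,\mathcal F)$ is the only $(S,(\mathcal T',\mathcal F'))\in\mathfrak N$ with the following property: if $\mathcal T^0=\mathcal T$, $\mathcal F^0=\mathcal F$, and $\mathcal T^{j+1}=\mathcal T^j\cap P_j^{\perp}$, $\mathcal F^{j+1}=\mathcal F^j$ for even $j$, while $\mathcal T^{j+1}=\mathcal T^j$, $\mathcal F^{j+1}=\mathcal F^j\cap{}^{\perp}I_j$ for odd $j$ (where $P^\perp$ is the class of all $X$ with $\operatorname{Hom}_\Lambda(P,X)=0$, and ${}^\perp I$ that of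 all $X$ with $\operatorname{Hom}_\Lambda(X,I)=0$), then $\mathcal T^j\cap\mathcal P(\Lambda_S^j)=\operatorname{add}P_j$ for all even $j\le m$, $\mathcal F^j\cap\mathcal I(\Lambda_S^j)=\operatorname{add}I_j$ for all odd $j\le m$, and $(\mathcal T',\mathcal F')=(\mathcal T^{m+1},\mathcal F^{m+1})$, with $\mathcal T^{m+1},\mathcal F^{m+1}$ restricted to $\Lambda_S^{m+1}\text{-mod}$. * $G(S,(\mathcal T',\mathcal F'))=\bigl(\langle\operatorname{Gen}P_0,\operatorname{Gen}P_2,\dots,\mathcal T'\rangle,\ \langle\mathcal F',\dots,\operatorname{Cogen}I_3,\operatorname{Cogen}I_1\rangle\bigr)$, where $P_j$ runs over even $j\le m$ and $I_j$ over odd $j\le m$, each $\operatorname{Gen}P_j$ and $\operatorname{Cogen}I_j$ is formed in $\Lambda_S^j\text{-mod}$, and $\langle\cdot\rangle$ is taken in $\Lambda\text{-mod}$. -/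

import Mathlib

open CategoryTheory

universe u

noncomputable section

/-! ### Finitely generated modules, torsion pairs, and the closure operators -/

section Modules

variable {Γ : Type u} [Ring Γ]

/-- `0 → A → X → B → 0` is exact. -/
def IsShortExact {A X B : ModuleCat.{u} Γ} (f : A ⟶ X) (g : X ⟶ B) : Prop :=
  Function.Injective f.hom ∧ Function.Exact f.hom g.hom ∧ Function.Surjective g.hom

variable (Γ) in
/-- Torsion pairs on `Γ-mod`, the category of finitely generated left `Γ`-modules. The two
subcategories are full and closed under isomorphism; they are given by their classes of objects. -/
@[ext]
structure TorsionPair where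
  tors : ObjectProperty (ModuleCat.{u} Γ)
  free : ObjectProperty (ModuleCat.{u} Γ)
  tors_finite : ∀ X, tors X → Module.Finite Γ X
  free_finite : ∀ X, free X → Module.Finite Γ X
  tors_iso : ∀ X Y, Nonempty (X ≅ Y) → tors X → tors Y
  free_iso : ∀ X Y, Nonempty (X ≅ Y) → free X → free Y
  hom_eq_zero : ∀ X Y, tors X → free Y → ∀ f : X ⟶ Y, f = 0
  exists_shortExact : ∀ X : ModuleCat.{u} Γ, Module.Finite Γ X →
    ∃ (A B : ModuleCat.{u} Γ) (f : A ⟶ X) (g : X ⟶ B), IsShortExact f g ∧ tors A ∧ free B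

/-- The class `𝐄(Γ)`: torsion pairs whose torsion class contains no nonzero projective module of
`Γ-mod` and whose torsion-free class contains no nonzero injective module of `Γ-mod`. -/
def TorsionPair.IsE (τ : TorsionPair Γ) : Prop :=
  (∀ X, τ.tors X → Module.Projective Γ X → Subsingleton X) ∧
  (∀ X, τ.free X → Module.Injective Γ X → Subsingleton X)

/-- `add M`: finitely generated modules isomorphic to a direct summand of some `Mⁿ`. -/
def addClosure (M : Type u) [AddCommGroup M] [Module Γ M] : ObjectProperty (ModuleCat.{u} Γ) :=
  fun X => Module.Finite Γ X ∧ ∃ (n : ℕ) (f : X →ₗ[Γ] (Fin n → M)) (g : (Fin n → M) →ₗ[Γ] X),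
    g ∘ₗ f = LinearMap.id

/-- `Gen M`: finitely generated modules that are quotients of some `Mⁿ`. -/
def Gen (M : Type u) [AddCommGroup M] [Module Γ M] : ObjectProperty (ModuleCat.{u} Γ) :=
  fun X => Module.Finite Γ X ∧ ∃ (n : ℕ) (f : (Fin n → M) →ₗ[Γ] X), Function.Surjective f

/-- `Cogen M`: finitely generated modules that embed into some `Mⁿ`. -/
def Cogen (M : Type u) [AddCommGroup M] [Module Γ M] : ObjectProperty (ModuleCat.{u} Γ) :=
  fun X => Module.Finite Γ X ∧ ∃ (n : ℕ) (f : X →ₗ[Γ] (Fin n → M)), Function.Injective f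

/-- `⟨C⟩`: the smallest extension-closed class of modules containing the class `C`. -/
inductive ExtClosure (C : ObjectProperty (ModuleCat.{u} Γ)) : ObjectProperty (ModuleCat.{u} Γ)
  | of (X : ModuleCat.{u} Γ) : C X → ExtClosure C X
  | ext (A X B : ModuleCat.{u} Γ) (f : A ⟶ X) (g : X ⟶ B) :
      IsShortExact f g → ExtClosure C A → ExtClosure C B → ExtClosure C X

/-- A primitive idempotent: nonzero, and not a sum of two nonzero orthogonal idempotents. -/
def IsPrimitiveIdempotent (e : Γ) : Prop :=
  IsIdempotentElem e ∧ e ≠ 0 ∧ ∀ f g : Γ, IsIdempotentElem f → IsIdempotentElem g →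
    f * g = 0 → g * f = 0 → e = f + g → f = 0 ∨ g = 0

end Modules

/-! ### The duality `D = Hom_R(-, J)` on right ideals `eΓ` -/

/-- `J` is an injective envelope of the `R`-module `M`: it is injective and contains `M` as an
essential submodule. -/
def IsInjectiveEnvelope (R M J : Type u) [CommRing R] [AddCommGroup M] [Module R M]
    [AddCommGroup J] [Module R J] : Prop :=
  Module.Injective R J ∧ ∃ ι : M →ₗ[R] J, Function.Injective ι ∧
    ∀ N : Submodule R J, N ⊓ LinearMap.range ι = ⊥ → N = ⊥

section Dual

variable (R : Type u) [CommRing R] {Γ : Type u} [Ring Γ] [Algebra R Γ]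

/-- The right ideal `eΓ`, as an `R`-module. -/
def rightIdeal (e : Γ) : Submodule R Γ := LinearMap.range (LinearMap.mulLeft R e)

/-- Right multiplication by `γ` on the right ideal `eΓ`. -/
def rightIdealMul (e γ : Γ) : rightIdeal R e →ₗ[R] rightIdeal R e :=
  (LinearMap.mulRight R γ).restrict (by
    rintro _ ⟨y, rfl⟩
    exact ⟨y * γ, by simp [mul_assoc]⟩)

variable (J : Type u) [AddCommGroup J] [Module R J]

/-- `D(eΓ) = Hom_R(eΓ, J)`. -/
def DualRightIdeal (e : Γ) : Type u := rightIdeal R e →ₗ[R] J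

instance (e : Γ) : AddCommGroup (DualRightIdeal R J e) :=
  inferInstanceAs (AddCommGroup (rightIdeal R e →ₗ[R] J))

/-- The left `Γ`-module structure of `D(eΓ)`: `(γ • f) x = f (x * γ)`. -/
instance (e : Γ) : Module Γ (DualRightIdeal R J e) where
  smul γ f := LinearMap.comp (show rightIdeal R e →ₗ[R] J from f) (rightIdealMul R e γ)
  one_smul f := by
    refine LinearMap.ext fun x => congrArg (show rightIdeal R e →ₗ[R] J from f) ?_
    exact Subtype.ext (mul_one (x : Γ))
  mul_smul a b f := by
    refine LinearMap.ext fun x => congrArg (show rightIdeal R e →ₗ[R] J from f) ?_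
    exact Subtype.ext (mul_assoc (x : Γ) a b).symm
  smul_zero a := LinearMap.zero_comp _
  smul_add a f g := LinearMap.add_comp _ _ _
  add_smul a b f := by
    refine LinearMap.ext fun x => Eq.trans (congrArg (show rightIdeal R e →ₗ[R] J from f) ?_)
      (map_add (show rightIdeal R e →ₗ[R] J from f) (rightIdealMul R e a x) (rightIdealMul R e b x))
    exact Subtype.ext (mul_add (x : Γ) a b)
  zero_smul f := by
    refine LinearMap.ext fun x => Eq.trans (congrArg (show rightIdeal R e →ₗ[R] J from f) ?_)
      (map_zero (show rightIdeal R e →ₗ[R] J from f))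
    exact Subtype.ext (mul_zero (x : Γ))

end Dual

/-! ### Sequences of blocks of idempotents and the quotient algebras they define -/

section Blocks

variable {Λ : Type u} [Ring Λ] {n : ℕ}

/-- A sequence `Δ_0, …, Δ_m` of pairwise disjoint subsets of `{e_1, …, e_n}`, given by their sets
of indices, with `Δ_1, …, Δ_m` nonempty (`Δ_0` may be empty). The sequence is continued by
`Δ_j = ∅` for `j > m`. Each block contains with `e_k` every `e_l` such that `Λ e_l ≅ Λ e_k`; this
is no condition if the modules `Λ e_k` are pairwise non-isomorphic. -/
structure BlockSequence (e : Fin n → Λ) where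
  m : ℕ
  block : ℕ → Finset (Fin n)
  block_nonempty : ∀ j, 1 ≤ j → j ≤ m → (block j).Nonempty
  block_empty : ∀ j, m < j → block j = ∅
  disjoint : ∀ i j, i ≠ j → Disjoint (block i) (block j)
  iso_closed : ∀ j, ∀ k ∈ block j, ∀ l : Fin n,
    Nonempty (Ideal.span {e k} ≃ₗ[Λ] Ideal.span {e l}) → l ∈ block j

namespace BlockSequence

variable {e : Fin n → Λ} (S : BlockSequence e)

/-- `e_S^j`, the sum of the idempotents in `Δ_j`. -/
def blockSum (j : ℕ) : Λ := ∑ k ∈ S.block j, e k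

/-- The two-sided ideal of `Λ` generated by `e_S^0 + ⋯ + e_S^{j-1}`. -/
def stageIdeal (j : ℕ) : TwoSidedIdeal Λ :=
  TwoSidedIdeal.span {∑ i ∈ Finset.range j, S.blockSum i}

/-- The algebra `Λ_S^j`, the quotient of `Λ` by the ideal generated by
`e_S^0 + ⋯ + e_S^{j-1}`. -/
abbrev StageAlg (j : ℕ) : Type u := Λ ⧸ (S.stageIdeal j).asIdeal

/-- The quotient map `Λ → Λ_S^j`. -/
abbrev toStage (j : ℕ) : Λ →+* S.StageAlg j := Ideal.Quotient.mk (S.stageIdeal j).asIdeal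

/-- `Λ_S^j`-modules viewed as `Λ`-modules. -/
abbrev res (j : ℕ) : ModuleCat.{u} (S.StageAlg j) ⥤ ModuleCat.{u} Λ :=
  ModuleCat.restrictScalars (S.toStage j)

/-- `P_j(Λ_S^j)`, the direct sum of the `Λ_S^j e` for `e ∈ Δ_j`. -/
abbrev ProjSum (j : ℕ) : Type u := ∀ k : S.block j, Ideal.span {S.toStage j (e k)}

/-- `I_j(Λ_S^j)`, the direct sum of the `D(e Λ_S^j)` for `e ∈ Δ_j`. -/
abbrev InjSum (R : Type u) [CommRing R] [Algebra R Λ] (J : Type u) [AddCommGroup J] [Module R J]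
    (j : ℕ) : Type u :=
  ∀ k : S.block j, DualRightIdeal R J (S.toStage j (e k))

/-- 1-type part partitions:
`e_S^{2i-1} Λ_S^{2i-1} e ≠ 0` for `0 < 2i ≤ m` and `e ∈ Δ_{2i}`, and
`e Λ_S^{2i} e_S^{2i} ≠ 0` for `1 < 2i+1 ≤ m` and `e ∈ Δ_{2i+1}`. -/
def IsOneType : Prop :=
  (∀ j, Odd j → j + 1 ≤ S.m → ∀ k ∈ S.block (j + 1), ∃ x : S.StageAlg j,
    S.toStage j (S.blockSum j) * x * S.toStage j (e k) ≠ 0) ∧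
  (∀ j, Even j → 0 < j → j + 1 ≤ S.m → ∀ k ∈ S.block (j + 1), ∃ x : S.StageAlg j,
    S.toStage j (e k) * x * S.toStage j (S.blockSum j) ≠ 0)

end BlockSequence

/-- The set `𝔑` of pairs of a 1-type part partition `S = (Δ_0, …, Δ_m)` and a torsion pair in
`𝐄(Λ_S^{m+1})`. -/
structure SplitData (e : Fin n → Λ) where
  S : BlockSequence e
  isOneType : S.IsOneType
  pair : TorsionPair (S.StageAlg (S.m + 1))
  isE : pair.IsE

end Blocks

/-! ### The two maps -/

section Maps

variable {Λ : Type u} [Ring Λ] {n : ℕ} {e : Fin n → Λ}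

/-- The classes `𝒯^0 = 𝒯`, `𝒯^{j+1} = 𝒯^j ∩ P_j(Λ_S^j)^⊥` for even `j`, `𝒯^{j+1} = 𝒯^j` for odd
`j`, as classes of `Λ`-modules. -/
def torsStage (S : BlockSequence e) (τ : TorsionPair Λ) : ℕ → ObjectProperty (ModuleCat.{u} Λ)
  | 0 => τ.tors
  | j + 1 => fun X => torsStage S τ j X ∧
      (Even j → ∀ f : (S.res j).obj (ModuleCat.of _ (S.ProjSum j)) ⟶ X, f = 0)

variable (R : Type u) [CommRing R] [Algebra R Λ] (J : Type u) [AddCommGroup J] [Module R J]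

/-- The classes `ℱ^0 = ℱ`, `ℱ^{j+1} = ℱ^j` for even `j`, `ℱ^{j+1} = ℱ^j ∩ ^⊥I_j(Λ_S^j)` for odd
`j`, as classes of `Λ`-modules. -/
def freeStage (S : BlockSequence e) (τ : TorsionPair Λ) : ℕ → ObjectProperty (ModuleCat.{u} Λ)
  | 0 => τ.free
  | j + 1 => fun X => freeStage S τ j X ∧
      (Odd j → ∀ f : X ⟶ (S.res j).obj (ModuleCat.of _ (S.InjSum R J j)), f = 0)

/-- The pair `(S, (𝒯', ℱ'))` is the outcome of splitting off alternately projectives and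
injectives from `(𝒯, ℱ)`: for even `j ≤ m` the block `Δ_j` satisfies
`𝒯^j ∩ 𝒫(Λ_S^j) = add P_j(Λ_S^j)`, for odd `j ≤ m` it satisfies
`ℱ^j ∩ ℐ(Λ_S^j) = add I_j(Λ_S^j)`, and `(𝒯', ℱ') = (𝒯^{m+1}, ℱ^{m+1})`. -/
structure IsSplitting (τ : TorsionPair Λ) (ν : SplitData e) : Prop where
  proj : ∀ j ≤ ν.S.m, Even j → ∀ Y : ModuleCat.{u} (ν.S.StageAlg j),
    (torsStage ν.S τ j ((ν.S.res j).obj Y) ∧ Module.Projective (ν.S.StageAlg j) Y) ↔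
      addClosure (ν.S.ProjSum j) Y
  inj : ∀ j ≤ ν.S.m, Odd j → ∀ Y : ModuleCat.{u} (ν.S.StageAlg j),
    (freeStage R J ν.S τ j ((ν.S.res j).obj Y) ∧ Module.Injective (ν.S.StageAlg j) Y) ↔
      addClosure (ν.S.InjSum R J j) Y
  tors_eq : ∀ Y, ν.pair.tors Y ↔ torsStage ν.S τ (ν.S.m + 1) ((ν.S.res (ν.S.m + 1)).obj Y)
  free_eq : ∀ Y, ν.pair.free Y ↔ freeStage R J ν.S τ (ν.S.m + 1) ((ν.S.res (ν.S.m + 1)).obj Y)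

/-- `⟨Gen P_0(Λ_S^0), Gen P_2(Λ_S^2), …, 𝒯'⟩`. -/
def gluedTors (ν : SplitData e) : ObjectProperty (ModuleCat.{u} Λ) :=
  ExtClosure fun X =>
    (∃ j ≤ ν.S.m, Even j ∧ (Gen (Γ := ν.S.StageAlg j) (ν.S.ProjSum j)).map (ν.S.res j) X) ∨
      ν.pair.tors.map (ν.S.res (ν.S.m + 1)) X

/-- `⟨ℱ', …, Cogen I_3(Λ_S^3), Cogen I_1(Λ_S^1)⟩`. -/
def gluedFree (ν : SplitData e) : ObjectProperty (ModuleCat.{u} Λ) :=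
  ExtClosure fun X =>
    (∃ j ≤ ν.S.m, Odd j ∧ (Cogen (Γ := ν.S.StageAlg j) (ν.S.InjSum R J j)).map (ν.S.res j) X) ∨
      ν.pair.free.map (ν.S.res (ν.S.m + 1)) X

end Maps

end

/-! Write `I_j` for the ideal with `Λ_S^j = Λ / I_j`, and identify `Λ_S^j`-modules with `Λ`-modules
killed by `I_j`. For such a module `X`, both `Hom(P_j, X) = 0` and `Hom(X, I_j(Λ_S^j)) = 0` mean
that every `e_k` with `k ∈ Δ_j` acts as zero on `X`, that is, that `X` is killed by `I_{j+1}`. The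
first holds because `Hom(Λ_S^j e, X) = eX`, the second because `D` is a duality whose `J` is a
cogenerator. Hence projective and injective steps pass to the same kind of quotient algebra.

If the `P_j` are torsion and the injectives of the odd blocks torsion-free (`Supports`), then at
each step one class is cut down by the perpendicular condition while the other satisfies that
condition already. So `𝒯^j` and `ℱ^j` are the restrictions of `𝒯` and `ℱ` to `Λ_S^j`-modules
(`Supports.torsStage_iff`, `Supports.freeStage_iff`). As primitive idempotents have local corner
rings, `𝒯^j ∩ 𝒫 = add P_j` only says which `Λ_S^j e_k` are torsion, and dually for injectives. Being
a splitting thus becomes a recursion for the blocks (`Determines`) together with the restriction of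
the pair to the last stage.

Uniqueness: the recursion fixes each block from the earlier ones, and the condition `𝐄` says when it
stops (`Exhausts`). Existence: run the recursion until it produces an empty block. The 1-type
conditions then hold, because an index violating them would already have been split off two steps
earlier (`Determines.isOneType`).

For gluing, a `Λ_S^j`-module is filtered by the trace of `P_j` at even `j` and by the reject of the
injectives at odd `j`; one layer lies in `Gen P_j` or `Cogen I_j`, the other is a
`Λ_S^{j+1}`-module. This gives the canonical sequences of the glued pair (`exists_glued_submodule`),
and the same filtration shows that every pair is glued from its splitting (`IsSplitting.eq_glued`).
Conversely, the 1-type conditions ensure that splitting the glued pair recovers exactly the blocks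
of `S` (`Supports.determines`). -/

noncomputable section

/-! ### Matlis duality over a commutative artinian ring. -/

section InjectiveEnvelope

variable {R : Type u} [CommRing R] {J : Type u} [AddCommGroup J] [Module R J]

/-- Over an artinian ring, an injective envelope of `R / rad R` is a cogenerator. -/
theorem IsInjectiveEnvelope.exists_apply_ne_zero [IsArtinianRing R]
    (hJ : IsInjectiveEnvelope R (R ⧸ Ring.jacobson R) J) {M : Type u} [AddCommGroup M] [Module R M]
    {x : M} (hx : x ≠ 0) : ∃ φ : M →ₗ[R] J, φ x ≠ 0 := by
  obtain ⟨hinj, ι, hι, -⟩ := hJ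
  have hne : Ideal.torsionOf R M x ≠ ⊤ := fun h => hx ((Ideal.torsionOf_eq_top_iff (R := R) x).1 h)
  obtain ⟨m, hm, hle⟩ := Ideal.exists_le_maximal _ hne
  have hjm : Ring.jacobson R ≤ m := by
    rw [Ring.jacobson_eq_sInf_isMaximal]
    exact sInf_le hm
  -- Semisimplicity makes the quotient `R ⧸ m` isomorphic to a submodule of `R ⧸ Ring.jacobson R`,
  -- which embeds into `J`.
  have hB : IsSemisimpleModule R (R ⧸ Ring.jacobson R) := by
    have h1 : IsSemisimpleRing (R ⧸ Ring.jacobson R) := IsSemiprimaryRing.isSemisimpleRing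
    let l : (R ⧸ Ring.jacobson R) →ₛₗ[Ideal.Quotient.mk (Ring.jacobson R)]
        (R ⧸ Ring.jacobson R) :=
      { toFun := id
        map_add' := fun _ _ => rfl
        map_smul' := fun r x => by
          obtain ⟨y, rfl⟩ := Ideal.Quotient.mk_surjective x
          rfl }
    exact (l.isSemisimpleModule_iff_of_bijective Function.bijective_id).2 h1
  let q : (R ⧸ Ring.jacobson R) →ₗ[R] (R ⧸ m) := Submodule.factor hjm
  have hq : Function.Surjective q := Submodule.factor_surjective hjm
  obtain ⟨P, ⟨E⟩⟩ := IsSemisimpleModule.exists_submodule_linearEquiv_quotient (LinearMap.ker q)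
  let s : (R ⧸ m) →ₗ[R] J := ι ∘ₗ P.subtype ∘ₗ
    ((q.quotKerEquivOfSurjective hq).symm.trans E.symm).toLinearMap
  have hs : Function.Injective s :=
    hι.comp (P.injective_subtype.comp (LinearEquiv.injective _))
  let g : (R ⧸ Ideal.torsionOf R M x) →ₗ[R] J := s ∘ₗ Submodule.factor hle
  obtain ⟨φ, hφ⟩ := hinj.out (Submodule.subtype (R ∙ x)) (Submodule.subtype_injective _)
    (g ∘ₗ (Ideal.quotTorsionOfEquivSpanSingleton R M x).symm.toLinearMap)
  refine ⟨φ, fun h0 => ?_⟩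
  have hx1 : Ideal.quotTorsionOfEquivSpanSingleton R M x (Submodule.Quotient.mk 1) =
      ⟨x, Submodule.mem_span_singleton_self x⟩ := by
    refine Subtype.ext (Eq.trans ?_ (one_smul R x))
    rfl
  have h1 := hφ ⟨x, Submodule.mem_span_singleton_self x⟩
  rw [← hx1] at h1
  simp only [LinearMap.comp_apply, LinearEquiv.coe_coe, LinearEquiv.symm_apply_apply] at h1
  rw [hx1] at h1
  change φ x = s (Submodule.Quotient.mk 1) at h1
  rw [h0] at h1
  have h2 : (Submodule.Quotient.mk 1 : R ⧸ m) = 0 := hs (by rw [← h1, map_zero])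
  rw [Submodule.Quotient.mk_eq_zero] at h2
  exact hm.ne_top ((Ideal.eq_top_iff_one m).2 h2)

/-- Let `s` generate `S` and let `m` be its annihilator. Essentiality forces `φ s` into the copy of
`R / rad R` inside `J`, so evaluation at `s` followed by reduction modulo `m` maps the dual to `R ⧸
m`. This is injective: a value represented by some `x ∈ m` is killed by `x`, so `x²`, and with it
`x`, lies in the radical. -/
theorem IsInjectiveEnvelope.length_dual_simple_le
    (hJ : IsInjectiveEnvelope R (R ⧸ Ring.jacobson R) J) {S : Type u} [AddCommGroup S] [Module R S]
    [IsSimpleModule R S] : Module.length R (S →ₗ[R] J) ≤ 1 := by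
  obtain ⟨-, ι, hι, hess⟩ := hJ
  obtain ⟨m, hm, ⟨E⟩⟩ := isSimpleModule_iff_quot_maximal.1 ‹IsSimpleModule R S›
  have hjm : Ring.jacobson R ≤ m := by
    rw [Ring.jacobson_eq_sInf_isMaximal]
    exact sInf_le hm
  let s : S := E.symm (Submodule.Quotient.mk 1)
  have hms : ∀ r ∈ m, r • s = 0 := by
    intro r hr
    rw [← map_smul, ← Submodule.Quotient.mk_smul, smul_eq_mul, mul_one,
      (Submodule.Quotient.mk_eq_zero m).2 hr, map_zero]
  have hgen : ∀ x : S, ∃ r : R, x = r • s := by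
    intro x
    obtain ⟨r, hr⟩ := Submodule.Quotient.mk_surjective _ (E x)
    refine ⟨r, ?_⟩
    rw [← map_smul, ← Submodule.Quotient.mk_smul, smul_eq_mul, mul_one, hr, E.symm_apply_apply]
  have hmem : ∀ φ : S →ₗ[R] J, φ s ∈ LinearMap.range ι := by
    intro φ
    by_cases hφ : LinearMap.range φ = ⊥
    · rw [LinearMap.range_eq_bot.1 hφ]
      exact Submodule.zero_mem _
    · have h := mt (hess _) hφ
      obtain ⟨y, ⟨⟨x, rfl⟩, hy⟩, hy0⟩ := (Submodule.ne_bot_iff _).1 h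
      have hx0 : x ≠ 0 := fun h => hy0 (by rw [h, map_zero])
      have := (IsSimpleModule.toSpanSingleton_surjective R hx0) s
      obtain ⟨r, hr⟩ := this
      rw [← hr, LinearMap.toSpanSingleton_apply, map_smul]
      exact Submodule.smul_mem _ _ hy
  let q : (R ⧸ Ring.jacobson R) →ₗ[R] (R ⧸ m) := Submodule.factor hjm
  let ev : (S →ₗ[R] J) →ₗ[R] LinearMap.range ι :=
    LinearMap.codRestrict _ (LinearMap.applyₗ s) hmem
  let b : (S →ₗ[R] J) →ₗ[R] (R ⧸ Ring.jacobson R) :=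
    (LinearEquiv.ofInjective ι hι).symm.toLinearMap ∘ₗ ev
  have hb : ∀ φ, ι (b φ) = φ s := by
    intro φ
    have h : LinearEquiv.ofInjective ι hι (b φ) = ev φ := LinearEquiv.apply_symm_apply _ _
    exact congrArg Subtype.val h
  have hinj : Function.Injective (q ∘ₗ b) := by
    rw [← LinearMap.ker_eq_bot, LinearMap.ker_eq_bot']
    intro φ h0
    obtain ⟨x, hx⟩ := Submodule.Quotient.mk_surjective _ (b φ)
    have hxm : x ∈ m := by
      rw [LinearMap.comp_apply, ← hx] at h0
      exact (Submodule.Quotient.mk_eq_zero m).1 h0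
    have hxx : x * x ∈ Ring.jacobson R := by
      rw [← smul_eq_mul, ← Submodule.Quotient.mk_eq_zero, Submodule.Quotient.mk_smul, hx]
      apply hι
      rw [map_smul, hb, ← map_smul, hms x hxm, map_zero, map_zero]
    have hx' : x ∈ Ring.jacobson R := by
      rw [Ring.jacobson_eq_sInf_isMaximal, Submodule.mem_sInf] at hxx ⊢
      intro I hI
      have hI : Ideal.IsMaximal I := hI
      exact (or_self_iff.1 (hI.isPrime.mem_or_mem (hxx I hI)))
    have hb0 : b φ = 0 := by
      rw [← hx, Submodule.Quotient.mk_eq_zero]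
      exact hx'
    have hs0 : φ s = 0 := by rw [← hb, hb0, map_zero]
    ext x
    obtain ⟨r, rfl⟩ := hgen x
    rw [map_smul, hs0, smul_zero, LinearMap.zero_apply]
  have : IsSimpleModule R (R ⧸ m) := IsSimpleModule.congr E.symm
  calc _ ≤ Module.length R (R ⧸ m) := Module.length_le_of_injective _ hinj
    _ = 1 := Module.length_eq_one _ _

/-- Matlis duality does not increase the length. -/
theorem IsInjectiveEnvelope.length_dual_le [IsArtinianRing R]
    (hJ : IsInjectiveEnvelope R (R ⧸ Ring.jacobson R) J) {M : Type u} [AddCommGroup M] [Module R M]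
    [Module.Finite R M] : Module.length R (M →ₗ[R] J) ≤ Module.length R M := by
  have hM : IsFiniteLength R M := isFiniteLength_iff_isNoetherian_isArtinian.2 ⟨inferInstance, inferInstance⟩
  induction hM with
  | of_subsingleton => rw [Module.length_eq_zero]; exact zero_le
  | @of_simple_quotient M _ _ N _ hN ih =>
    have hex := Module.length_eq_add_of_exact N.subtype N.mkQ N.injective_subtype
      N.mkQ_surjective (LinearMap.exact_subtype_mkQ N)
    let f : ((M ⧸ N) →ₗ[R] J) →ₗ[R] (M →ₗ[R] J) := LinearMap.lcomp R J N.mkQ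
    let g : (M →ₗ[R] J) →ₗ[R] (N →ₗ[R] J) := LinearMap.lcomp R J N.subtype
    have hf : Function.Injective f := by
      intro a b hab
      ext x
      exact LinearMap.congr_fun hab x
    -- Left exactness suffices for an upper bound on the length, so the third term is the range of
    -- restriction.
    have hfg : Function.Exact f g.rangeRestrict := by
      intro φ
      constructor
      · intro h
        have h' : φ ∘ₗ N.subtype = 0 := congrArg Subtype.val h
        refine ⟨N.liftQ φ fun x hx => LinearMap.congr_fun h' ⟨x, hx⟩, ?_⟩
        ext x
        rfl
      · rintro ⟨ψ, rfl⟩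
        apply Subtype.ext
        ext x
        change ψ (N.mkQ x) = 0
        rw [Submodule.mkQ_apply, (Submodule.Quotient.mk_eq_zero N).2 x.2, map_zero]
    rw [Module.length_eq_add_of_exact f g.rangeRestrict hf g.surjective_rangeRestrict hfg, hex,
      add_comm]
    refine add_le_add ?_ ?_
    · exact (Module.length_le_of_injective _ (LinearMap.range g).injective_subtype).trans ih
    · rw [Module.length_eq_one R (M ⧸ N)]
      exact hJ.length_dual_simple_le

theorem IsInjectiveEnvelope.finite_dual [IsArtinianRing R]
    (hJ : IsInjectiveEnvelope R (R ⧸ Ring.jacobson R) J) {M : Type u} [AddCommGroup M] [Module R M]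
    [Module.Finite R M] : Module.Finite R (M →ₗ[R] J) := by
  have h : IsFiniteLength R (M →ₗ[R] J) := by
    rw [← Module.length_ne_top_iff]
    exact ne_top_of_le_ne_top Module.length_ne_top hJ.length_dual_le
  have := (isFiniteLength_iff_isNoetherian_isArtinian.1 h).1
  infer_instance

/-- The double annihilator property of Matlis duality. -/
theorem IsInjectiveEnvelope.mem_of_forall_apply_eq_zero [IsArtinianRing R]
    (hJ : IsInjectiveEnvelope R (R ⧸ Ring.jacobson R) J) {M : Type u} [AddCommGroup M] [Module R M]
    [Module.Finite R M] (U : Submodule R (M →ₗ[R] J)) (φ : M →ₗ[R] J)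
    (hφ : ∀ x, (∀ f ∈ U, f x = 0) → φ x = 0) : φ ∈ U := by
  have hfin : Module.Finite R (M →ₗ[R] J) := hJ.finite_dual
  let W : Submodule R M := ⨅ f ∈ U, LinearMap.ker f
  have hW : ∀ x, x ∈ W ↔ ∀ f ∈ U, f x = 0 := by
    intro x
    simp [W, Submodule.mem_iInf]
  let d : ((M ⧸ W) →ₗ[R] J) →ₗ[R] (M →ₗ[R] J) := LinearMap.lcomp R J W.mkQ
  have hd : Function.Injective d := by
    intro a b hab
    ext x
    exact LinearMap.congr_fun hab x
  have hU : U ≤ LinearMap.range d := by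
    intro f hf
    refine ⟨W.liftQ f fun x hx => (hW x).1 hx f hf, ?_⟩
    ext x
    rfl
  have hφd : φ ∈ LinearMap.range d := by
    refine ⟨W.liftQ φ fun x hx => hφ x ((hW x).1 hx), ?_⟩
    ext x
    rfl
  let ev : (M ⧸ W) →ₗ[R] (U →ₗ[R] J) :=
    W.liftQ (LinearMap.flip U.subtype) (by
      intro x hx
      ext f
      exact (hW x).1 hx f.1 f.2)
  have hev : Function.Injective ev := by
    rw [← LinearMap.ker_eq_bot, LinearMap.ker_eq_bot']
    intro y
    obtain ⟨x, rfl⟩ := W.mkQ_surjective y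
    intro h
    exact (Submodule.Quotient.mk_eq_zero W).2 ((hW x).2 fun f hf => LinearMap.congr_fun h ⟨f, hf⟩)
  -- `range d` is the dual of `M ⧸ W`, and `M ⧸ W` embeds into the dual of `U`. Dualizing twice does
  -- not increase length, so the inclusion `U ≤ range d` cannot be strict.
  have hlen : Module.length R (LinearMap.range d) ≤ Module.length R U :=
    calc _ = Module.length R ((M ⧸ W) →ₗ[R] J) := (LinearEquiv.ofInjective d hd).length_eq.symm
      _ ≤ Module.length R (M ⧸ W) := hJ.length_dual_le
      _ ≤ Module.length R (U →ₗ[R] J) := Module.length_le_of_injective _ hev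
      _ ≤ Module.length R U := hJ.length_dual_le
  by_contra hφU
  have hlt : U < LinearMap.range d := lt_of_le_of_ne hU fun h => hφU (h ▸ hφd)
  have := Submodule.height_strictMono hlt
  rw [← Module.length_submodule, ← Module.length_submodule] at this
  exact absurd hlen (not_le.2 this)

end InjectiveEnvelope

/-! ### Primitive idempotents have local corner rings. -/

section LocalIdempotents

variable {Γ : Type u} [Ring Γ]

/-- The corner ring `eΓe` is local or zero: of `x` and `e - x`, one is invertible. -/
def IsLocalCorner (e : Γ) : Prop :=
  ∀ x, e * x * e = x →
    (∃ y, y * x = e ∧ x * y = e) ∨ (∃ y, y * (e - x) = e ∧ (e - x) * y = e)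

/-- Compressing any preimage to `e * x * e` lifts an element of the corner to the corner. -/
theorem IsLocalCorner.map {Γ' : Type u} [Ring Γ'] {f : Γ →+* Γ'} (hf : Function.Surjective f)
    {e : Γ} (he : IsIdempotentElem e) (h : IsLocalCorner e) : IsLocalCorner (f e) := by
  intro x hx
  obtain ⟨x, rfl⟩ := hf x
  have hx' : f (e * x * e) = f x := by simpa using hx
  have hc : e * (e * x * e) * e = e * x * e := by
    simp only [mul_assoc, he.eq]
    simp only [← mul_assoc, he.eq]
  rcases h _ hc with ⟨y, h1, h2⟩ | ⟨y, h1, h2⟩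
  · refine .inl ⟨f y, ?_, ?_⟩
    · rw [← hx', ← map_mul, h1]
    · rw [← hx', ← map_mul, h2]
  · refine .inr ⟨f y, ?_, ?_⟩
    · rw [← hx', ← map_sub, ← map_mul, h1]
    · rw [← hx', ← map_sub, ← map_mul, h2]

/-- The chain of powers of `x` stabilizes: `x ^ n = x ^ (n + 1) * y`. Iterating this raises the
exponent on the right at will; passing to `n + 1` makes the exponent positive. -/
theorem IsArtinianRing.exists_pow_eq_mul_pow_two_mul {A : Type u} [CommRing A] [IsArtinianRing A] (x : A) :
    ∃ n c, 0 < n ∧ x ^ n = c * x ^ (2 * n) := by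
  obtain ⟨n, y, hy⟩ := IsArtinian.exists_pow_succ_smul_dvd x (1 : A)
  simp only [smul_eq_mul, mul_one, Nat.succ_eq_add_one] at hy
  have h : ∀ k, x ^ n = x ^ (n + k) * y ^ k := by
    intro k
    induction k with
    | zero => simp
    | succ k ih =>
      calc x ^ n = x ^ (n + k) * y ^ k := ih
        _ = (x ^ n) * x ^ k * y ^ k := by rw [pow_add]
        _ = (x ^ (n + 1) * y) * x ^ k * y ^ k := by rw [hy]
        _ = _ := by ring
  refine ⟨n + 1, x * y ^ (n + 2), n.succ_pos, ?_⟩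
  calc x ^ (n + 1) = x ^ n * x := pow_succ _ _
    _ = x ^ (n + (n + 2)) * y ^ (n + 2) * x := by rw [← h]
    _ = _ := by ring

/-- Fitting's argument. The commutative algebra `R[x]` is finite over `R`, hence artinian, so `x ^ n
= c * x ^ (2 * n)` there and `c * x ^ n` is an idempotent of the corner. By primitivity it is `0`,
and `x` is nilpotent with `e - x` inverted by a geometric series, or it is `e`, and `x` is
invertible. -/
theorem IsPrimitiveIdempotent.isLocalCorner {R : Type u} [CommRing R] [IsArtinianRing R]
    [Algebra R Γ] [Module.Finite R Γ] {e : Γ} (he : IsPrimitiveIdempotent e) :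
    IsLocalCorner e := by
  obtain ⟨hid, -, hprim⟩ := he
  intro x hx
  have hex : e * x = x := by rw [← hx]; simp only [← mul_assoc, hid.eq]
  have hxe : x * e = x := by rw [← hx]; simp only [mul_assoc, hid.eq]
  have hce : Commute e x := hex.trans hxe.symm
  let A := Algebra.adjoin R {x}
  have : IsMulCommutative A := Algebra.isMulCommutative_adjoin R (by
    rintro a rfl b rfl
    rfl)
  have : Module.Finite R A := inferInstanceAs (Module.Finite R (Subalgebra.toSubmodule A))
  have : IsArtinianRing A := IsArtinianRing.of_finite R A
  obtain ⟨n, c, hn, hc⟩ := IsArtinianRing.exists_pow_eq_mul_pow_two_mul (⟨x, Algebra.self_mem_adjoin_singleton R x⟩ : A)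
  have hcomm : ∀ a : A, Commute (a : Γ) x ∧ Commute (a : Γ) e := by
    intro a
    constructor
    · exact congrArg Subtype.val (mul_comm a ⟨x, Algebra.self_mem_adjoin_singleton R x⟩)
    · refine Algebra.adjoin_induction (p := fun a _ => Commute a e) ?_ ?_ ?_ ?_ a.2
      · rintro a rfl
        exact hce.symm
      · exact fun r => Algebra.commutes r e
      · exact fun a b _ _ ha hb => ha.add_left hb
      · exact fun a b _ _ ha hb => ha.mul_left hb
  obtain ⟨hcx, hce'⟩ := hcomm c
  replace hc : x ^ n = c * x ^ (2 * n) := congrArg Subtype.val hc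
  generalize (c : Γ) = c at *
  obtain ⟨k, rfl⟩ : ∃ k, n = k + 1 := ⟨n - 1, by omega⟩
  set f := c * x ^ (k + 1) with hf
  have hfe : f * e = f := by rw [hf, pow_succ, mul_assoc, mul_assoc, hxe]
  have hef : e * f = f := by
    rw [hf, ← mul_assoc, hce'.eq.symm, mul_assoc, pow_succ', ← mul_assoc e, hex]
  have hff : f * f = f := by
    calc f * f = c * (x ^ (k + 1) * c) * x ^ (k + 1) := by rw [hf]; simp only [mul_assoc]
      _ = c * (c * x ^ (k + 1)) * x ^ (k + 1) := by rw [(hcx.pow_right _).eq]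
      _ = c * (c * x ^ (2 * (k + 1))) := by
        rw [two_mul, pow_add x (k + 1)]; simp only [mul_assoc]
      _ = f := by rw [← hc]
  rcases hprim f (e - f) hff (IsIdempotentElem.sub (a := f) hff hid hfe hef) (by rw [mul_sub, hfe, hff, sub_self])
    (by rw [sub_mul, hef, hff, sub_self]) (by abel) with h | h
  · right
    have hnil : x ^ (k + 1) = 0 := by
      calc x ^ (k + 1) = c * x ^ (2 * (k + 1)) := hc
        _ = f * x ^ (k + 1) := by rw [hf, two_mul, pow_add, mul_assoc]
        _ = 0 := by rw [h, zero_mul]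
    have h1 : (∑ i ∈ Finset.range (k + 1), x ^ i) * (1 - x) = 1 := by
      rw [geom_sum_mul_neg, hnil, sub_zero]
    have h2 : (1 - x) * (∑ i ∈ Finset.range (k + 1), x ^ i) = 1 := by
      rw [mul_neg_geom_sum, hnil, sub_zero]
    have h3 : e * (∑ i ∈ Finset.range (k + 1), x ^ i) = (∑ i ∈ Finset.range (k + 1), x ^ i) * e :=
      (Commute.sum_right _ _ _ fun i _ => hce.pow_right i).eq
    refine ⟨e * ∑ i ∈ Finset.range (k + 1), x ^ i, ?_, ?_⟩
    · have : e - x = (1 - x) * e := by rw [sub_mul, one_mul, hxe]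
      rw [this, mul_assoc, ← mul_assoc _ (1 - x), h1, one_mul, hid.eq]
    · have : e - x = e * (1 - x) := by rw [mul_sub, mul_one, hex]
      rw [this, h3, mul_assoc, ← mul_assoc (1 - x), h2, one_mul, hid.eq]
  · left
    have hfe' : f = e := (sub_eq_zero.1 h).symm
    refine ⟨c * x ^ k, ?_, ?_⟩
    · rw [mul_assoc, ← pow_succ, ← hfe']
    · rw [← mul_assoc, ← hcx.eq, mul_assoc, ← pow_succ', ← hfe']

end LocalIdempotents

/-! ### Idempotents, isomorphic left ideals and two-sided ideals. -/

section IdempotentIdeals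

variable {Λ : Type u} [Ring Λ]

/-- Factorizations of `e` through `f`, for idempotents `e` and `f`, come from isomorphisms
`Λe ≅ Λf`. -/
theorem nonempty_linearEquiv_of_mul_eq {e f u v : Λ} (hu : u * f = u) (hv : v * e = v)
    (huv : u * v = e) (hvu : v * u = f) :
    Nonempty (Ideal.span {e} ≃ₗ[Λ] Ideal.span {f}) := by
  have key : ∀ {e f u v : Λ}, u * f = u → v * e = v → u * v = e → v * u = f →
      ∀ x : Ideal.span {e}, (x : Λ) * u ∈ Ideal.span {f} := by
    intro e f u v hu hv huv hvu x
    exact Ideal.mem_span_singleton'.2 ⟨x * u, by rw [mul_assoc, hu]⟩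
  have key2 : ∀ {e f u v : Λ}, e * e = e → u * v = e → ∀ x : Ideal.span {e}, (x : Λ) * u * v = x := by
    intro e f u v he huv x
    obtain ⟨a, ha⟩ := Ideal.mem_span_singleton'.1 x.2
    rw [mul_assoc, huv, ← ha, mul_assoc, he]
  have hee : e * e = e := by
    calc e * e = u * (v * e) := by rw [← mul_assoc, huv]
      _ = e := by rw [hv, huv]
  have hff : f * f = f := by
    calc f * f = v * (u * f) := by rw [← mul_assoc, hvu]
      _ = f := by rw [hu, hvu]
  refine ⟨{ toFun := fun x => ⟨(x : Λ) * u, key hu hv huv hvu x⟩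
            invFun := fun x => ⟨(x : Λ) * v, key hv hu hvu huv x⟩
            map_add' := fun x y => Subtype.ext (add_mul _ _ _)
            map_smul' := fun a x => Subtype.ext (mul_assoc _ _ _)
            left_inv := fun x => Subtype.ext (key2 (f := f) hee huv x)
            right_inv := fun x => Subtype.ext (key2 (f := e) hff hvu x) }⟩

/-- A linear map out of `Λe` is right multiplication by the image of `e`; `u` and `v` are the images
of the generators under `E` and its inverse. -/
theorem exists_mul_eq_of_linearEquiv {e f : Λ} (he : IsIdempotentElem e) (hf : IsIdempotentElem f)
    (E : Ideal.span {e} ≃ₗ[Λ] Ideal.span {f}) :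
    ∃ u v : Λ, e * u = u ∧ u * f = u ∧ f * v = v ∧ v * e = v ∧ u * v = e ∧ v * u = f := by
  have key : ∀ {e f : Λ}, IsIdempotentElem e → IsIdempotentElem f →
      ∀ E : Ideal.span {e} ≃ₗ[Λ] Ideal.span {f},
      e * (E ⟨e, Ideal.mem_span_singleton_self e⟩ : Λ) = E ⟨e, Ideal.mem_span_singleton_self e⟩ ∧
      (E ⟨e, Ideal.mem_span_singleton_self e⟩ : Λ) * f = E ⟨e, Ideal.mem_span_singleton_self e⟩ ∧
      (E ⟨e, Ideal.mem_span_singleton_self e⟩ : Λ) *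
        (E.symm ⟨f, Ideal.mem_span_singleton_self f⟩ : Λ) = e := by
    intro e f he hf E
    have h2 : (E ⟨e, Ideal.mem_span_singleton_self e⟩ : Λ) * f =
        E ⟨e, Ideal.mem_span_singleton_self e⟩ := by
      obtain ⟨a, ha⟩ := Ideal.mem_span_singleton'.1 (E ⟨e, Ideal.mem_span_singleton_self e⟩).2
      rw [← ha, mul_assoc, hf.eq]
    refine ⟨?_, h2, ?_⟩
    · rw [← smul_eq_mul, ← Submodule.coe_smul, ← map_smul]
      congr 3
      exact Subtype.ext he.eq
    · rw [← smul_eq_mul, ← Submodule.coe_smul, ← map_smul]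
      have : (E ⟨e, Ideal.mem_span_singleton_self e⟩ : Λ) •
          (⟨f, Ideal.mem_span_singleton_self f⟩ : Ideal.span {f}) =
          E ⟨e, Ideal.mem_span_singleton_self e⟩ := Subtype.ext h2
      rw [this, E.symm_apply_apply]
  obtain ⟨h1, h2, h3⟩ := key he hf E
  obtain ⟨h4, h5, h6⟩ := key hf he E.symm
  exact ⟨_, _, h1, h2, h4, h5, h3, h6⟩

/-- An idempotent with local corner ring lying in the two-sided ideal generated by some primitive
idempotents `e i` generates a left ideal isomorphic to one of the `Λ e i`. -/
theorem exists_linearEquiv_of_mem_span {ι : Type*} {e : ι → Λ} {s : Finset ι}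
    (hs : ∀ i ∈ s, IsPrimitiveIdempotent (e i)) {f : Λ} (hf : IsPrimitiveIdempotent f)
    (hloc : IsLocalCorner f) (hmem : f ∈ TwoSidedIdeal.span {∑ i ∈ s, e i}) :
    ∃ i ∈ s, Nonempty (Ideal.span {e i} ≃ₗ[Λ] Ideal.span {f}) := by
  obtain ⟨hid, hne, -⟩ := hf
  by_contra hcon
  push Not at hcon
  -- Locality enters here: if two elements of the corner `fΛf` add up to `f`, one of them is
  -- invertible. So the elements through which `f` does not factor form a two-sided ideal `N`.
  have hadd : ∀ {a b : Λ}, (∀ x y, x * a * y * f ≠ f) → (∀ x y, x * b * y * f ≠ f) →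
      ∀ x y, x * (a + b) * y * f ≠ f := by
    intro a b ha hb x y h
    have hsum : f * x * a * y * f + f * x * b * y * f = f := by
      have := congrArg (f * ·) h
      simp only [hid.eq] at this
      refine Eq.trans ?_ this
      noncomm_ring
    have hsub : f - f * x * a * y * f = f * x * b * y * f :=
      (eq_sub_of_add_eq' hsum).symm
    have hcorner : f * (f * x * a * y * f) * f = f * x * a * y * f := by
      simp only [mul_assoc, hid.eq]
      simp only [← mul_assoc, hid.eq]
    rcases hloc _ hcorner with ⟨z, hz, -⟩ | ⟨z, hz, -⟩
    · exact ha (z * f * x) y (Eq.trans (by simp only [mul_assoc]) hz)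
    · rw [hsub] at hz
      exact hb (z * f * x) y (Eq.trans (by simp only [mul_assoc]) hz)
  let N : TwoSidedIdeal Λ := TwoSidedIdeal.mk' {a | ∀ x y, x * a * y * f ≠ f}
    (by intro x y h; simp only [mul_zero, zero_mul] at h; exact hne h.symm)
    hadd
    (by intro a ha x y h; exact ha (-x) y (Eq.trans (by noncomm_ring) h))
    (by intro a b hb x y h; exact hb (x * a) y (Eq.trans (by noncomm_ring) h))
    (by intro a b ha x y h; exact ha x (b * y) (Eq.trans (by noncomm_ring) h))
  have hN : ∀ a, a ∈ N ↔ ∀ x y, x * a * y * f ≠ f := fun a => TwoSidedIdeal.mem_mk' ..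
  have hle : TwoSidedIdeal.span {∑ i ∈ s, e i} ≤ N := by
    rw [TwoSidedIdeal.span_le, Set.singleton_subset_iff]
    refine sum_mem fun i hi => (hN _).2 fun x y h => ?_
    obtain ⟨hiid, hine, hiprim⟩ := hs i hi
    set p := f * x * e i with hp
    set q := e i * y * f with hq
    have hpq : p * q = f := by
      calc p * q = f * (x * (e i * e i) * y * f) := by rw [hp, hq]; simp only [mul_assoc]
        _ = f := by rw [hiid.eq, h, hid.eq]
    have hqf : q * f = q := by rw [hq, mul_assoc, hid.eq]
    have hpe : p * e i = p := by rw [hp, mul_assoc, hiid.eq]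
    have heq : e i * q = q := by rw [hq]; simp only [← mul_assoc, hiid.eq]
    have hqp : IsIdempotentElem (q * p) := by
      calc q * p * (q * p) = q * (p * q) * p := by simp only [mul_assoc]
        _ = q * p := by rw [hpq, hqf]
    have h1 : q * p * e i = q * p := by rw [mul_assoc, hpe]
    have h2 : e i * (q * p) = q * p := by rw [← mul_assoc, heq]
    -- `q * p` is an idempotent below `e i`, so it is `0` or `e i`. The first would make `f` vanish,
    -- the second gives the excluded isomorphism.
    rcases hiprim (q * p) (e i - q * p) hqp (hqp.sub hiid h1 h2)
      (by rw [mul_sub, h1, hqp.eq, sub_self]) (by rw [sub_mul, h2, hqp.eq, sub_self])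
      (by abel) with h0 | h0
    · apply hne
      calc f = p * q * (p * q) := by rw [hpq, hid.eq]
        _ = p * (q * p) * q := by simp only [mul_assoc]
        _ = 0 := by rw [h0, mul_zero, zero_mul]
    · exact (not_nonempty_iff.2 (hcon i hi)) (nonempty_linearEquiv_of_mul_eq hqf hpe (sub_eq_zero.1 h0).symm hpq)
  exact (hN f).1 (hle hmem) f f (by simp only [hid.eq])

end IdempotentIdeals

/-! ### The injective modules `D(eΓ)`. -/

namespace DualRightIdeal

variable {R : Type u} [CommRing R] {Γ : Type u} [Ring Γ] [Algebra R Γ]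
  {J : Type u} [AddCommGroup J] [Module R J] {e : Γ}

/-- An element of `D(eΓ)` as a linear map. -/
def toHom : DualRightIdeal R J e →+ (rightIdeal R e →ₗ[R] J) where
  toFun f := f
  map_zero' := rfl
  map_add' _ _ := rfl

theorem toHom_injective : Function.Injective (toHom : DualRightIdeal R J e → _) := fun _ _ h => h

/-- A linear map `eΓ → J` as an element of `D(eΓ)`. -/
def ofHom (f : rightIdeal R e →ₗ[R] J) : DualRightIdeal R J e := f

@[simp]
theorem toHom_ofHom (f : rightIdeal R e →ₗ[R] J) : toHom (ofHom f) = f := rfl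

theorem toHom_smul (a : Γ) (f : DualRightIdeal R J e) (x : rightIdeal R e) :
    toHom (a • f) x = toHom f (rightIdealMul R e a x) := rfl

theorem coe_rightIdealMul (a : Γ) (x : rightIdeal R e) : (rightIdealMul R e a x : Γ) = x * a := rfl

variable (R e) in
/-- The element `ea` of the right ideal `eΓ`. -/
def elem (a : Γ) : rightIdeal R e := ⟨e * a, a, rfl⟩

theorem elem_eq (he : IsIdempotentElem e) (x : rightIdeal R e) : elem R e (x : Γ) = x := by
  obtain ⟨_, y, rfl⟩ := x
  refine Subtype.ext ?_
  change e * (e * y) = e * y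
  rw [← mul_assoc, he.eq]

theorem rightIdealMul_elem (a b : Γ) : rightIdealMul R e a (elem R e b) = elem R e (b * a) :=
  Subtype.ext (mul_assoc e b a)

theorem ext_elem {f g : DualRightIdeal R J e}
    (h : ∀ a, toHom f (elem R e a) = toHom g (elem R e a)) : f = g := by
  apply toHom_injective
  ext ⟨_, a, rfl⟩
  exact h a

theorem toHom_smul_elem (a b : Γ) (f : DualRightIdeal R J e) :
    toHom (a • f) (elem R e b) = toHom f (elem R e (b * a)) := by
  rw [toHom_smul, rightIdealMul_elem]

/-- The value of `e • a • f` at `e` is `f (e * a)`, and these values determine `f`. -/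
theorem exists_smul_smul_ne_zero (he : IsIdempotentElem e) {f : DualRightIdeal R J e}
    (hf : f ≠ 0) : ∃ a : Γ, e • a • f ≠ 0 := by
  by_contra! h
  apply hf
  apply ext_elem
  intro a
  have h2 : toHom (e • a • f) (elem R e 1) = toHom f (elem R e a) := by
    rw [smul_smul, toHom_smul_elem, one_mul]
    congr 1
    exact Subtype.ext (by change e * (e * a) = e * a; rw [← mul_assoc, he.eq])
  rw [← h2, h, map_zero]
  rfl

section Lift

variable {Y : Type u} [AddCommGroup Y] [Module Γ Y] [Module R Y] [IsScalarTower R Γ Y]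

variable (e) in
/-- The linear map `Y → D(eΓ)` induced by a linear map `eY → J`, here given on all of `Y`. -/
def lift (φ : Y →ₗ[R] J) : Y →ₗ[Γ] DualRightIdeal R J e where
  toFun y := ofHom (φ ∘ₗ ((LinearMap.toSpanSingleton Γ Y y).restrictScalars R) ∘ₗ
    (rightIdeal R e).subtype)
  map_add' y z := by
    apply ext_elem
    intro a
    change φ ((e * a) • (y + z)) = φ ((e * a) • y) + φ ((e * a) • z)
    rw [smul_add, map_add]
  map_smul' b y := by
    apply ext_elem
    intro a
    rw [RingHom.id_apply, toHom_smul_elem]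
    change φ ((e * a) • b • y) = φ ((e * (a * b)) • y)
    rw [smul_smul, mul_assoc]

theorem toHom_lift_elem (φ : Y →ₗ[R] J) (y : Y) (a : Γ) :
    toHom (lift e φ y) (elem R e a) = φ ((e * a) • y) := rfl

end Lift

/-- The `R`-module structure on a `Γ`-module. -/
abbrev moduleBase (R : Type u) [CommRing R] (Γ : Type u) [Ring Γ] [Algebra R Γ]
    (Y : Type u) [AddCommGroup Y] [Module Γ Y] : Module R Y := Module.compHom Y (algebraMap R Γ)

theorem isScalarTower_moduleBase (Y : Type u) [AddCommGroup Y] [Module Γ Y] :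
    letI := moduleBase R Γ Y; IsScalarTower R Γ Y := by
  let _ := moduleBase R Γ Y
  refine ⟨fun r a y => ?_⟩
  change (r • a) • y = algebraMap R Γ r • a • y
  rw [smul_smul, Algebra.smul_def]

/-- Evaluation at `e` turns a `Γ`-linear map into `D(eΓ)` into an `R`-linear map into `J`, and
`lift` goes back. An extension problem over `Γ` thus becomes one over `R`. -/
theorem injective (hJ : Module.Injective R J) (he : IsIdempotentElem e) :
    Module.Injective Γ (DualRightIdeal R J e) := by
  refine ⟨fun X Y _ _ _ _ f hf g => ?_⟩
  let _ := moduleBase R Γ X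
  let _ := moduleBase R Γ Y
  have := isScalarTower_moduleBase (R := R) (Γ := Γ) X
  have := isScalarTower_moduleBase (R := R) (Γ := Γ) Y
  let ψ : X →ₗ[R] J :=
    { toFun := fun x => toHom (g x) (elem R e 1)
      map_add' := fun x y => by rw [map_add, map_add, LinearMap.add_apply]
      map_smul' := fun r x => by
        rw [RingHom.id_apply, ← map_smul, ← algebraMap_smul Γ r x, map_smul, toHom_smul_elem,
          one_mul]
        congr 1
        refine Subtype.ext ?_
        change e * algebraMap R Γ r = r • (e * 1)
        rw [mul_one, Algebra.smul_def, Algebra.commutes] }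
  obtain ⟨φ, hφ⟩ := hJ.out (f.restrictScalars R) hf ψ
  refine ⟨lift e φ, fun x => ext_elem fun a => ?_⟩
  have h := hφ ((e * a) • x)
  rw [LinearMap.restrictScalars_apply, map_smul] at h
  rw [toHom_lift_elem, h]
  change toHom (g ((e * a) • x)) (elem R e 1) = _
  rw [map_smul, toHom_smul_elem, one_mul]
  congr 1
  exact Subtype.ext (by change e * (e * a) = e * a; rw [← mul_assoc, he.eq])

section Matlis

variable [IsArtinianRing R] [Module.Finite R Γ] (hJ : IsInjectiveEnvelope R (R ⧸ Ring.jacobson R) J)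

include hJ

omit [Module.Finite R Γ] in
theorem exists_hom_apply_ne_zero {Y : Type u} [AddCommGroup Y]
    [Module Γ Y] {y : Y} (hy : e • y ≠ 0) :
    ∃ f : Y →ₗ[Γ] DualRightIdeal R J e, toHom (f y) (elem R e 1) ≠ 0 := by
  let _ := moduleBase R Γ Y
  have := isScalarTower_moduleBase (R := R) (Γ := Γ) Y
  obtain ⟨φ, hφ⟩ := hJ.exists_apply_ne_zero hy
  refine ⟨lift e φ, ?_⟩
  rwa [toHom_lift_elem, mul_one]

theorem finite : Module.Finite Γ (DualRightIdeal R J e) := by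
  let _ := moduleBase R Γ (DualRightIdeal R J e)
  have := isScalarTower_moduleBase (R := R) (Γ := Γ) (DualRightIdeal R J e)
  have h : Module.Finite R (rightIdeal R e →ₗ[R] J) := hJ.finite_dual
  let E : (rightIdeal R e →ₗ[R] J) →ₗ[R] DualRightIdeal R J e :=
    { toFun := ofHom
      map_add' := fun _ _ => rfl
      map_smul' := fun r f => by
        apply ext_elem
        intro a
        rw [RingHom.id_apply]
        change r • f (elem R e a) = toHom (algebraMap R Γ r • ofHom f) (elem R e a)
        rw [toHom_smul_elem, toHom_ofHom, ← map_smul]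
        congr 1
        refine Subtype.ext ?_
        change r • (e * a) = e * (a * algebraMap R Γ r)
        rw [Algebra.smul_def, Algebra.commutes, mul_assoc] }
  have hE : Function.Surjective E := fun f => ⟨toHom f, rfl⟩
  have : Module.Finite R (DualRightIdeal R J e) := Module.Finite.of_surjective E hE
  exact Module.Finite.of_restrictScalars_finite R Γ _

/-- If `eΓe` is local then `D(eΓ)` is uniform. -/
theorem inf_ne_bot (he : IsIdempotentElem e) (hloc : IsLocalCorner e)
    {U V : Submodule Γ (DualRightIdeal R J e)} (hU : U ≠ ⊥) (hV : V ≠ ⊥) : U ⊓ V ≠ ⊥ := by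
  let toR : Submodule Γ (DualRightIdeal R J e) → Submodule R (rightIdeal R e →ₗ[R] J) := fun U =>
    { carrier := {f | ofHom f ∈ U}
      add_mem' := fun ha hb => U.add_mem ha hb
      zero_mem' := U.zero_mem
      smul_mem' := fun r f hf => by
        have h : algebraMap R Γ r • ofHom f ∈ U := U.smul_mem (algebraMap R Γ r) hf
        suffices algebraMap R Γ r • ofHom f = ofHom (r • f) from Eq.mp (congrArg (· ∈ U) this) h
        apply ext_elem
        intro a
        rw [toHom_smul_elem, toHom_ofHom, toHom_ofHom, LinearMap.smul_apply, ← map_smul]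
        congr 1
        refine Subtype.ext ?_
        change e * (a * algebraMap R Γ r) = r • (e * a)
        rw [Algebra.smul_def, Algebra.commutes, mul_assoc] }
  -- the annihilator in `eΓ` of a submodule of `D(eΓ)`
  let ann : Submodule Γ (DualRightIdeal R J e) → Submodule R (rightIdeal R e) := fun U =>
    { carrier := {x | ∀ f ∈ U, toHom f x = 0}
      add_mem' := fun ha hb f hf => by rw [map_add, ha f hf, hb f hf, add_zero]
      zero_mem' := fun f _ => map_zero _
      smul_mem' := fun r x hx f hf => by rw [map_smul, hx f hf, smul_zero] }
  have hann_mul : ∀ U x a, x ∈ ann U → rightIdealMul R e a x ∈ ann U := by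
    intro U x a hx f hf
    rw [← toHom_smul]
    exact hx _ (U.smul_mem a hf)
  have hann_e : ∀ U, U ≠ ⊥ → elem R e 1 ∉ ann U := by
    intro U hU h
    apply hU
    rw [Submodule.eq_bot_iff]
    intro f hf
    apply ext_elem
    intro a
    have := hann_mul U _ a h f hf
    rw [rightIdealMul_elem, one_mul] at this
    rw [this, map_zero, LinearMap.zero_apply]
  -- If `e` were a sum of elements of the two annihilators, locality would make one summand
  -- invertible in the corner. Its annihilator would then contain `e`, and the corresponding
  -- submodule would be zero.
  have hnot : elem R e 1 ∉ ann U ⊔ ann V := by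
    intro h
    obtain ⟨x, hx, y, hy, hxy⟩ := Submodule.mem_sup.1 h
    have hxy' : (x : Γ) * e + y * e = e := by
      have : (x : Γ) + y = e * 1 := congrArg Subtype.val hxy
      rw [← add_mul, this, mul_one, he.eq]
    have hex : ∀ x : rightIdeal R e, e * (x : Γ) = x := fun x => congrArg Subtype.val (elem_eq he x)
    rcases hloc ((x : Γ) * e) (by rw [← mul_assoc, hex, mul_assoc, he.eq]) with
      ⟨z, -, hz⟩ | ⟨z, -, hz⟩
    · apply hann_e U hU
      have := hann_mul U x (e * z) hx
      convert this
      refine Subtype.ext ?_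
      rw [coe_rightIdealMul, ← mul_assoc, hz]
      exact mul_one e
    · apply hann_e V hV
      have := hann_mul V y (e * z) hy
      convert this
      refine Subtype.ext ?_
      have hy' : e - (x : Γ) * e = y * e := (eq_sub_of_add_eq' hxy').symm
      rw [hy'] at hz
      rw [coe_rightIdealMul, ← mul_assoc, hz]
      exact mul_one e
  have hne : (ann U ⊔ ann V).mkQ (elem R e 1) ≠ 0 := fun h => hnot (by simpa using h)
  obtain ⟨φ, hφ⟩ := hJ.exists_apply_ne_zero hne
  -- By the double annihilator property, a functional vanishing on both annihilators lies in both
  -- `U` and `V`.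
  have hmem : ∀ W, ann W ≤ ann U ⊔ ann V →
      ofHom (φ ∘ₗ (ann U ⊔ ann V).mkQ) ∈ W := by
    intro W hW
    refine hJ.mem_of_forall_apply_eq_zero (toR W) _ fun x hx => ?_
    have hx' : x ∈ ann W := fun f hf => hx f hf
    change φ ((ann U ⊔ ann V).mkQ x) = 0
    rw [(Submodule.mkQ_apply _ _).trans ((Submodule.Quotient.mk_eq_zero _).2 (hW hx')), map_zero]
  rw [Submodule.ne_bot_iff]
  refine ⟨_, ⟨hmem U le_sup_left, hmem V le_sup_right⟩, fun h => hφ ?_⟩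
  have := LinearMap.congr_fun (congrArg toHom h) (elem R e 1)
  exact this

end Matlis

end DualRightIdeal

/-! ### Membership in `Gen`, `Cogen` and `add` of sums of standard modules. -/

section SumsOverIdempotents

variable {Γ : Type u} [Ring Γ]

/-- The generator of the left ideal `Γe`. -/
def spanGen (e : Γ) : Ideal.span {e} := ⟨e, Ideal.mem_span_singleton_self e⟩

/-- The linear map `Γe → Y` mapping `e` to `ey`. -/
def spanLift (e : Γ) {Y : Type u} [AddCommGroup Y] [Module Γ Y] (y : Y) : Ideal.span {e} →ₗ[Γ] Y :=
  LinearMap.toSpanSingleton Γ Y y ∘ₗ (Ideal.span {e}).subtype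

theorem spanLift_apply (e : Γ) {Y : Type u} [AddCommGroup Y] [Module Γ Y] (y : Y)
    (x : Ideal.span {e}) : spanLift e y x = (x : Γ) • y := rfl

theorem exists_smul_spanGen {e : Γ} (x : Ideal.span {e}) : ∃ a : Γ, x = a • spanGen e := by
  obtain ⟨a, ha⟩ := Ideal.mem_span_singleton'.1 x.2
  exact ⟨a, Subtype.ext ha.symm⟩

theorem smul_spanGen {e : Γ} (he : IsIdempotentElem e) : e • spanGen e = spanGen e :=
  Subtype.ext he.eq

theorem projective_span {e : Γ} (he : IsIdempotentElem e) :
    Module.Projective Γ (Ideal.span {e}) := by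
  refine Module.Projective.of_split (Ideal.span {e}).subtype
    (LinearMap.codRestrict _ (LinearMap.toSpanSingleton Γ Γ e)
      fun x => Ideal.mul_mem_left _ _ (Ideal.mem_span_singleton_self e)) ?_
  ext x
  obtain ⟨a, ha⟩ := Ideal.mem_span_singleton'.1 x.2
  change (x : Γ) * e = x
  rw [← ha, mul_assoc, he.eq]

theorem Module.Projective.pi_of_finite {ι : Type} [Finite ι] {M : ι → Type u}
    [∀ i, AddCommGroup (M i)] [∀ i, Module Γ (M i)] [∀ i, Module.Projective Γ (M i)] :
    Module.Projective Γ (∀ i, M i) := by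
  classical
  have := Fintype.ofFinite ι
  exact Module.Projective.of_equiv (DirectSum.linearEquivFunOnFintype Γ ι M)

theorem Module.Injective.of_retract {M N : Type u} [AddCommGroup M] [Module Γ M] [AddCommGroup N]
    [Module Γ N] (hN : Module.Injective Γ N) (i : M →ₗ[Γ] N) (r : N →ₗ[Γ] M)
    (hri : r ∘ₗ i = LinearMap.id) : Module.Injective Γ M := by
  refine ⟨fun X Y _ _ _ _ f hf g => ?_⟩
  obtain ⟨k, hk⟩ := hN.out f hf (i ∘ₗ g)
  exact ⟨r ∘ₗ k, fun x => by
    rw [LinearMap.comp_apply, hk]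
    exact LinearMap.congr_fun hri (g x)⟩

variable {R : Type u} [CommRing R] [Algebra R Γ]

/-- Generators `x i` of `Y` are taken over `R` rather than `Γ`: as `R` acts centrally, the elements
`e k • x i` span each `e k • Y` over `R`. -/
theorem gen_of_span_eq_top [Module.Finite R Γ] {ι : Type} [Fintype ι] {e : ι → Γ}
    (Y : ModuleCat.{u} Γ) [Module.Finite Γ Y]
    (h : Submodule.span Γ {z : Y | ∃ k, ∃ y : Y, z = e k • y} = ⊤) :
    Gen (∀ k, Ideal.span {e k}) Y := by
  let _ := DualRightIdeal.moduleBase R Γ Y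
  have := DualRightIdeal.isScalarTower_moduleBase (R := R) (Γ := Γ) Y
  have : Module.Finite R Y := Module.Finite.trans Γ Y
  obtain ⟨n, x, hx⟩ := Module.Finite.exists_fin (R := R) (M := Y)
  classical
  let f : (Fin n → ∀ k, Ideal.span {e k}) →ₗ[Γ] Y :=
    ∑ i, ∑ k, spanLift (e k) (x i) ∘ₗ LinearMap.proj k ∘ₗ LinearMap.proj i
  refine ⟨inferInstance, n, f, ?_⟩
  have hmem : ∀ k i, e k • x i ∈ LinearMap.range f := by
    intro k i
    refine ⟨Pi.single i (Pi.single k (spanGen (e k))), ?_⟩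
    simp only [f, LinearMap.sum_apply, LinearMap.comp_apply, LinearMap.proj_apply]
    rw [Finset.sum_eq_single i, Finset.sum_eq_single k]
    · rw [Pi.single_eq_same, Pi.single_eq_same]
      rfl
    · intro l _ hl
      rw [Pi.single_eq_same, Pi.single_eq_of_ne hl, map_zero]
    · simp
    · intro j _ hj
      refine Finset.sum_eq_zero fun l _ => ?_
      rw [Pi.single_eq_of_ne hj, Pi.zero_apply, map_zero]
    · simp
  rw [← LinearMap.range_eq_top, eq_top_iff, ← h, Submodule.span_le]
  rintro _ ⟨k, y, rfl⟩
  have hy : y ∈ Submodule.span R (Set.range x) := hx ▸ Submodule.mem_top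
  induction hy using Submodule.span_induction with
  | mem y hy =>
    obtain ⟨i, rfl⟩ := hy
    exact hmem k i
  | zero => rw [smul_zero]; exact Submodule.zero_mem _
  | add y z _ _ hy hz => rw [smul_add]; exact Submodule.add_mem _ hy hz
  | smul r y _ hy =>
    have : e k • r • y = algebraMap R Γ r • e k • y := by
      rw [← algebraMap_smul Γ r y, smul_smul, smul_smul, Algebra.commutes]
    rw [this]
    exact Submodule.smul_mem _ _ hy

/-- The map into the power is built from `R`-generators of the dual of `Y`. An element of its kernel
has every `e k • a • y` killed by all functionals, and `J` is a cogenerator. -/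
theorem cogen_of_forall_eq_zero [IsArtinianRing R] [Module.Finite R Γ]
    {J : Type u} [AddCommGroup J] [Module R J]
    (hJ : IsInjectiveEnvelope R (R ⧸ Ring.jacobson R) J) {ι : Type} {e : ι → Γ}
    (Y : ModuleCat.{u} Γ) [Module.Finite Γ Y]
    (h : ∀ y : Y, (∀ k, ∀ a : Γ, e k • a • y = 0) → y = 0) :
    Cogen (∀ k, DualRightIdeal R J (e k)) Y := by
  let _ := DualRightIdeal.moduleBase R Γ Y
  have := DualRightIdeal.isScalarTower_moduleBase (R := R) (Γ := Γ) Y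
  have : Module.Finite R Y := Module.Finite.trans Γ Y
  have : Module.Finite R (Y →ₗ[R] J) := hJ.finite_dual
  obtain ⟨n, φ, hφ⟩ := Module.Finite.exists_fin (R := R) (M := Y →ₗ[R] J)
  let f : Y →ₗ[Γ] (Fin n → ∀ k, DualRightIdeal R J (e k)) :=
    LinearMap.pi fun i => LinearMap.pi fun k => DualRightIdeal.lift (e k) (φ i)
  refine ⟨inferInstance, n, f, ?_⟩
  rw [← LinearMap.ker_eq_bot, LinearMap.ker_eq_bot']
  intro y hy
  refine h y fun k a => ?_
  by_contra hne
  obtain ⟨ψ, hψ⟩ := hJ.exists_apply_ne_zero hne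
  apply hψ
  have hmem : ψ ∈ Submodule.span R (Set.range φ) := hφ ▸ Submodule.mem_top
  clear hψ
  induction hmem using Submodule.span_induction with
  | mem ψ hψ =>
    obtain ⟨i, rfl⟩ := hψ
    have h1 : DualRightIdeal.lift (e k) (φ i) y = 0 := congrFun (congrFun hy i) k
    have h2 := DualRightIdeal.toHom_lift_elem (e := e k) (φ i) y a
    rw [h1, map_zero, LinearMap.zero_apply] at h2
    rw [smul_smul, ← h2]
  | zero => rfl
  | add y z _ _ hy hz => rw [LinearMap.add_apply, hy, hz, add_zero]
  | smul r y _ hy => rw [LinearMap.smul_apply, hy, smul_zero]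

variable {κ : Type} [Fintype κ] {e : κ → Γ}

/-- A finitely generated projective module is a direct summand of a power of the sum of those `Γe`
which are quotients of it. -/
theorem addClosure_of_projective [Module.Finite R Γ] (hid : ∀ k, IsIdempotentElem (e k))
    (hsum : ∑ k, e k = 1) (hloc : ∀ k, IsLocalCorner (e k)) (s : Finset κ)
    (Y : ModuleCat.{u} Γ) [Module.Finite Γ Y] (hY : Module.Projective Γ Y)
    (h : ∀ k, e k ≠ 0 → (∃ f : Y →ₗ[Γ] Ideal.span {e k}, Function.Surjective f) → k ∈ s) :
    addClosure (∀ k : s, Ideal.span {e k}) Y := by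
  obtain ⟨-, n, f, hf⟩ := gen_of_span_eq_top (R := R) (e := fun k : s => e k) Y (by
    -- If the `e k • Y` with `k ∈ s` do not generate `Y`, some simple quotient of `Y` is annihilated
    -- by these `e k`. Another `e k` acts nontrivially on it, and projectivity lifts the quotient
    -- map to a map `Y → Γ (e k)`.
    by_contra hne
    obtain ⟨N, hN, hle⟩ := (eq_top_or_exists_le_coatom _).resolve_left hne
    have hsimple : IsSimpleModule Γ (Y ⧸ N) := isSimpleModule_iff_isCoatom.2 hN
    have := hsimple.nontrivial
    obtain ⟨z, hz⟩ := exists_ne (0 : Y ⧸ N)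
    obtain ⟨k, hk⟩ : ∃ k, e k • z ≠ 0 := by
      by_contra! h0
      apply hz
      rw [← one_smul Γ z, ← hsum, Finset.sum_smul]
      exact Finset.sum_eq_zero fun k _ => h0 k
    have hks : k ∉ s := by
      intro hks
      apply hk
      obtain ⟨y, rfl⟩ := N.mkQ_surjective z
      rw [← map_smul, Submodule.mkQ_apply, Submodule.Quotient.mk_eq_zero]
      exact hle (Submodule.subset_span ⟨⟨k, hks⟩, y, rfl⟩)
    apply hks
    refine h k (fun h0 => hk (by rw [h0, zero_smul])) ?_
    set w := e k • z with hw
    have hew : e k • w = w := by rw [hw, smul_smul, (hid k).eq]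
    have hsurj : Function.Surjective (spanLift (e k) w) := by
      intro y
      obtain ⟨a, ha⟩ := IsSimpleModule.toSpanSingleton_surjective Γ hk y
      refine ⟨a • spanGen (e k), ?_⟩
      rw [map_smul, spanLift_apply, ← ha, LinearMap.toSpanSingleton_apply]
      exact congrArg (a • ·) hew
    obtain ⟨g, hg⟩ := Module.projective_lifting_property (spanLift (e k) w) N.mkQ hsurj
    refine ⟨g, ?_⟩
    obtain ⟨y, hy⟩ := N.mkQ_surjective w
    have hgy : (g y : Γ) • w = w := by
      rw [← spanLift_apply, ← LinearMap.comp_apply, hg, hy]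
    have hge : (g y : Γ) * e k = g y := by
      obtain ⟨a, ha⟩ := Ideal.mem_span_singleton'.1 (g y).2
      rw [← ha, mul_assoc, (hid k).eq]
    -- Since `e k * g y` fixes `w ≠ 0`, the difference `e k - e k * g y` annihilates `w` and is not
    -- invertible in the corner. So `e k * g y` is invertible there.
    have hsp : spanGen (e k) ∈ LinearMap.range g := by
      rcases hloc k (e k * g y) (by rw [← mul_assoc, (hid k).eq, mul_assoc, hge]) with
        ⟨b, hb, -⟩ | ⟨b, hb, -⟩
      · refine ⟨b • e k • y, ?_⟩
        rw [map_smul, map_smul]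
        exact Subtype.ext hb
      · exfalso
        apply hk
        rw [← hew, ← hb, mul_smul, sub_smul, mul_smul, hgy, hew, sub_self, smul_zero]
    intro x
    obtain ⟨a, rfl⟩ := exists_smul_spanGen x
    obtain ⟨y, hy⟩ := hsp
    exact ⟨a • y, by rw [map_smul, hy]⟩)
  obtain ⟨g, hg⟩ := Module.projective_lifting_property f LinearMap.id hf
  exact ⟨inferInstance, n, g, f, hg⟩

/-- A finitely generated injective module is a direct summand of a power of the sum of those
`D(eΓ)` which embed into it. -/
theorem addClosure_of_injective [IsArtinianRing R] [Module.Finite R Γ]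
    {J : Type u} [AddCommGroup J] [Module R J]
    (hJ : IsInjectiveEnvelope R (R ⧸ Ring.jacobson R) J) (hid : ∀ k, IsIdempotentElem (e k))
    (hsum : ∑ k, e k = 1) (hloc : ∀ k, IsLocalCorner (e k)) (s : Finset κ)
    (Y : ModuleCat.{u} Γ) [Module.Finite Γ Y] (hY : Module.Injective Γ Y)
    (h : ∀ k, e k ≠ 0 → (∃ f : DualRightIdeal R J (e k) →ₗ[Γ] Y, Function.Injective f) → k ∈ s) :
    addClosure (∀ k : s, DualRightIdeal R J (e k)) Y := by
  obtain ⟨-, n, f, hf⟩ := cogen_of_forall_eq_zero hJ (e := fun k : s => e k) Y (by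
    intro y0 hy0
    by_contra hne
    have : IsArtinianRing Γ := IsArtinianRing.of_finite R Γ
    have hN0 : Submodule.span Γ {y0} ≠ ⊥ := by simpa using hne
    obtain ⟨N, hN, hle⟩ := (eq_bot_or_exists_atom_le _).resolve_left hN0
    have hsimple : IsSimpleModule Γ N := isSimpleModule_iff_isAtom.2 hN
    have := hsimple.nontrivial
    obtain ⟨z, hz⟩ := exists_ne (0 : N)
    obtain ⟨k, hk⟩ : ∃ k, e k • z ≠ 0 := by
      by_contra! h0
      apply hz
      rw [← one_smul Γ z, ← hsum, Finset.sum_smul]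
      exact Finset.sum_eq_zero fun k _ => h0 k
    have hks : k ∉ s := by
      intro hks
      apply hk
      obtain ⟨a, ha⟩ := Submodule.mem_span_singleton.1 (hle z.2)
      apply Subtype.ext
      rw [Submodule.coe_smul, ← ha]
      exact hy0 ⟨k, hks⟩ a
    apply hks
    refine h k (fun h0 => hk (by rw [h0, zero_smul])) ?_
    obtain ⟨g, hg⟩ := DualRightIdeal.exists_hom_apply_ne_zero hJ hk
    have hgz : g z ≠ 0 := fun h0 => hg (by rw [h0, map_zero, LinearMap.zero_apply])
    have hginj : Function.Injective g := by
      rw [← LinearMap.ker_eq_bot]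
      refine (eq_bot_or_eq_top (LinearMap.ker g)).resolve_right fun h0 => hgz ?_
      exact LinearMap.mem_ker.1 (h0 ▸ Submodule.mem_top)
    -- The simple submodule `N` embeds into `D(e k Γ)`, and injectivity of `Y` extends its inclusion
    -- to `f`. The kernel of `f` meets the image of `N` trivially, hence is zero because `D(e k Γ)`
    -- is uniform.
    obtain ⟨f, hf⟩ := hY.out g hginj N.subtype
    refine ⟨f, ?_⟩
    rw [← LinearMap.ker_eq_bot]
    by_contra hker
    have hrange : LinearMap.range g ≠ ⊥ := by
      rw [Submodule.ne_bot_iff]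
      exact ⟨g z, ⟨z, rfl⟩, hgz⟩
    obtain ⟨_, ⟨hx1, x, rfl⟩, hx0⟩ := (Submodule.ne_bot_iff _).1
      (DualRightIdeal.inf_ne_bot hJ (hid k) (hloc k) hker hrange)
    apply hx0
    have hx2 : (x : Y) = 0 := (hf x).symm.trans (LinearMap.mem_ker.1 hx1)
    rw [show x = 0 from Subtype.ext hx2, map_zero])
  have hn : Module.Injective Γ Y := hY
  obtain ⟨g, hg⟩ := hn.out (Y := Fin n → ∀ k : s, DualRightIdeal R J (e k)) f hf LinearMap.id
  exact ⟨inferInstance, n, f, g, LinearMap.ext hg⟩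

end SumsOverIdempotents

/-! ### Closure properties of torsion pairs. -/

namespace TorsionPair

variable {Γ : Type u} [Ring Γ] (τ : TorsionPair Γ) {A X Y B : ModuleCat.{u} Γ}

theorem linearMap_eq_zero (hX : τ.tors X) (hY : τ.free Y) (f : X →ₗ[Γ] Y) : f = 0 := by
  have := τ.hom_eq_zero X Y hX hY (ModuleCat.ofHom f)
  exact congrArg ModuleCat.Hom.hom this

theorem tors_equiv (e : X ≃ₗ[Γ] Y) (hX : τ.tors X) : τ.tors Y := τ.tors_iso X Y ⟨e.toModuleIso⟩ hX

theorem free_equiv (e : X ≃ₗ[Γ] Y) (hX : τ.free X) : τ.free Y := τ.free_iso X Y ⟨e.toModuleIso⟩ hX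

/-- The torsion-free quotient in the canonical sequence of `X` receives only the zero map, so `X` is
its own torsion part. All closure properties below come from this and its dual. -/
theorem tors_of_forall (hX : Module.Finite Γ X)
    (h : ∀ Y, τ.free Y → ∀ f : X →ₗ[Γ] Y, f = 0) : τ.tors X := by
  obtain ⟨A, B, f, g, ⟨hf, hfg, hg⟩, hA, hB⟩ := τ.exists_shortExact X hX
  have hg0 : g.hom = 0 := h B hB g.hom
  refine τ.tors_equiv (LinearEquiv.ofBijective f.hom ⟨hf, fun x => (hfg x).1 ?_⟩) hA
  rw [hg0, LinearMap.zero_apply]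

theorem free_of_forall (hX : Module.Finite Γ X)
    (h : ∀ Y, τ.tors Y → ∀ f : Y →ₗ[Γ] X, f = 0) : τ.free X := by
  obtain ⟨A, B, f, g, ⟨hf, hfg, hg⟩, hA, hB⟩ := τ.exists_shortExact X hX
  have hf0 : f.hom = 0 := h A hA f.hom
  refine τ.free_equiv (LinearEquiv.ofBijective g.hom ⟨?_, hg⟩).symm hB
  rw [← LinearMap.ker_eq_bot, LinearMap.ker_eq_bot']
  intro x hx
  obtain ⟨a, rfl⟩ := (hfg x).1 hx
  rw [hf0, LinearMap.zero_apply]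

theorem tors_of_surjective (hX : τ.tors X) (f : X →ₗ[Γ] Y) (hf : Function.Surjective f) :
    τ.tors Y := by
  have := τ.tors_finite X hX
  refine τ.tors_of_forall (Module.Finite.of_surjective f hf) fun Z hZ g => ?_
  have h := τ.linearMap_eq_zero hX hZ (g ∘ₗ f)
  ext y
  obtain ⟨x, rfl⟩ := hf y
  exact LinearMap.congr_fun h x

theorem free_of_injective [IsNoetherianRing Γ] (hY : τ.free Y) (f : X →ₗ[Γ] Y)
    (hf : Function.Injective f) : τ.free X := by
  have := τ.free_finite Y hY
  refine τ.free_of_forall (Module.Finite.of_injective f hf) fun Z hZ g => ?_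
  have h := τ.linearMap_eq_zero hZ hY (f ∘ₗ g)
  ext z
  exact hf ((LinearMap.congr_fun h z).trans (map_zero f).symm)

/-- A map to a torsion-free module vanishes on the image of `A`, hence factors through `B`;
injectivity of `f` plays no role. -/
theorem tors_of_exact {f : A →ₗ[Γ] X} {g : X →ₗ[Γ] B} (hfg : ∀ x, g x = 0 → ∃ a, f a = x)
    (hg : Function.Surjective g) (hX : Module.Finite Γ X) (hA : τ.tors A) (hB : τ.tors B) :
    τ.tors X := by
  refine τ.tors_of_forall hX fun Y hY φ => ?_
  have h1 := τ.linearMap_eq_zero hA hY (φ ∘ₗ f)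
  have hker : LinearMap.ker g ≤ LinearMap.ker φ := by
    intro x hx
    obtain ⟨a, rfl⟩ := hfg x hx
    exact LinearMap.congr_fun h1 a
  let ψ : B →ₗ[Γ] Y := (LinearMap.ker g).liftQ φ hker ∘ₗ (g.quotKerEquivOfSurjective hg).symm
  have h2 := τ.linearMap_eq_zero hB hY ψ
  ext x
  have h3 := LinearMap.congr_fun h2 (g x)
  have h4 : (g.quotKerEquivOfSurjective hg).symm (g x) = Submodule.Quotient.mk x := by
    rw [LinearEquiv.symm_apply_eq]
    rfl
  rw [LinearMap.comp_apply, LinearEquiv.coe_coe, h4] at h3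
  exact h3

theorem free_of_exact {f : A →ₗ[Γ] X} {g : X →ₗ[Γ] B} (hf : Function.Injective f)
    (hfg : ∀ x, g x = 0 → ∃ a, f a = x) (hX : Module.Finite Γ X) (hA : τ.free A) (hB : τ.free B) :
    τ.free X := by
  refine τ.free_of_forall hX fun Y hY φ => ?_
  have h1 := τ.linearMap_eq_zero hY hB (g ∘ₗ φ)
  have hmem : ∀ y, φ y ∈ LinearMap.range f := fun y => hfg _ (LinearMap.congr_fun h1 y)
  let ψ : Y →ₗ[Γ] A := (LinearEquiv.ofInjective f hf).symm.toLinearMap ∘ₗ φ.codRestrict _ hmem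
  have h2 := τ.linearMap_eq_zero hY hA ψ
  ext y
  have h3 : LinearEquiv.ofInjective f hf (ψ y) = φ.codRestrict _ hmem y :=
    LinearEquiv.apply_symm_apply _ _
  rw [h2, LinearMap.zero_apply, map_zero] at h3
  exact (congrArg Subtype.val h3).symm

theorem tors_of_subsingleton (X : ModuleCat.{u} Γ) [Subsingleton X] : τ.tors X :=
  τ.tors_of_forall inferInstance fun _ _ _ => LinearMap.ext fun x => by
    rw [Subsingleton.elim x 0, map_zero, map_zero]

theorem free_of_subsingleton (X : ModuleCat.{u} Γ) [Subsingleton X] : τ.free X :=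
  τ.free_of_forall inferInstance fun _ _ _ => LinearMap.ext fun _ => Subsingleton.elim _ _

theorem tors_pi {ι : Type} [Finite ι] {M : ι → Type u} [∀ i, AddCommGroup (M i)]
    [∀ i, Module Γ (M i)] (h : ∀ i, τ.tors (ModuleCat.of Γ (M i))) :
    τ.tors (ModuleCat.of Γ (∀ i, M i)) := by
  classical
  have : ∀ i, Module.Finite Γ (M i) := fun i => τ.tors_finite _ (h i)
  refine τ.tors_of_forall (inferInstanceAs (Module.Finite Γ (∀ i, M i))) fun Y hY f => ?_
  refine LinearMap.pi_ext' fun i => ?_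
  exact τ.linearMap_eq_zero (h i) hY (f ∘ₗ LinearMap.single Γ M i)

theorem free_pi {ι : Type} [Finite ι] {M : ι → Type u} [∀ i, AddCommGroup (M i)]
    [∀ i, Module Γ (M i)] (h : ∀ i, τ.free (ModuleCat.of Γ (M i))) :
    τ.free (ModuleCat.of Γ (∀ i, M i)) := by
  have : ∀ i, Module.Finite Γ (M i) := fun i => τ.free_finite _ (h i)
  refine τ.free_of_forall (inferInstanceAs (Module.Finite Γ (∀ i, M i))) fun Y hY f => ?_
  ext y i
  exact LinearMap.congr_fun (τ.linearMap_eq_zero hY (h i) (LinearMap.proj i ∘ₗ f)) y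

end TorsionPair

/-! ### Modules over `Λ / I` as `Λ`-modules killed by `I`. -/

section QuotientModules

variable {Λ : Type u} [Ring Λ] (I : TwoSidedIdeal Λ)

/-- Modules over `Λ / I` viewed as `Λ`-modules. -/
abbrev resQuot : ModuleCat.{u} (Λ ⧸ I.asIdeal) ⥤ ModuleCat.{u} Λ :=
  ModuleCat.restrictScalars (Ideal.Quotient.mk I.asIdeal)

/-- `I` annihilates `X`. -/
def KilledBy (X : ModuleCat.{u} Λ) : Prop := ∀ a ∈ I, ∀ x : X, a • x = 0

variable {I}

theorem resQuot_smul {Y : ModuleCat.{u} (Λ ⧸ I.asIdeal)} (a : Λ) (y : (resQuot I).obj Y) :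
    a • y = (Ideal.Quotient.mk I.asIdeal a • (y : Y) : Y) := rfl

theorem killedBy_resQuot (Y : ModuleCat.{u} (Λ ⧸ I.asIdeal)) : KilledBy I ((resQuot I).obj Y) := by
  intro a ha y
  rw [resQuot_smul, Ideal.Quotient.eq_zero_iff_mem.2 (TwoSidedIdeal.mem_asIdeal.2 ha)]
  exact zero_smul _ (y : Y)

theorem KilledBy.of_injective {X Y : ModuleCat.{u} Λ} (hY : KilledBy I Y) (f : X →ₗ[Λ] Y)
    (hf : Function.Injective f) : KilledBy I X := fun a ha x =>
  hf (by rw [map_smul, hY a ha, map_zero])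

theorem KilledBy.of_surjective {X Y : ModuleCat.{u} Λ} (hX : KilledBy I X) (f : X →ₗ[Λ] Y)
    (hf : Function.Surjective f) : KilledBy I Y := fun a ha y => by
  obtain ⟨x, rfl⟩ := hf y
  rw [← map_smul, hX a ha, map_zero]

theorem KilledBy.exists_resQuot {X : ModuleCat.{u} Λ} (hX : KilledBy I X) :
    ∃ Y, Nonempty ((resQuot I).obj Y ≃ₗ[Λ] X) := by
  have h : Module.IsTorsionBySet Λ X I.asIdeal := fun x a =>
    hX a (TwoSidedIdeal.mem_asIdeal.1 a.2) x
  let _ := h.module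
  exact ⟨ModuleCat.of (Λ ⧸ I.asIdeal) X,
    ⟨{ toFun := fun x => x
       invFun := fun x => x
       map_add' := fun _ _ => rfl
       map_smul' := fun _ _ => rfl
       left_inv := fun _ => rfl
       right_inv := fun _ => rfl }⟩⟩

variable {Y Z : ModuleCat.{u} (Λ ⧸ I.asIdeal)}

/-- A `Λ / I`-linear map as a `Λ`-linear map. -/
def resMap (f : Y →ₗ[Λ ⧸ I.asIdeal] Z) : (resQuot I).obj Y →ₗ[Λ] (resQuot I).obj Z where
  toFun := f
  map_add' := f.map_add
  map_smul' a y := f.map_smul (Ideal.Quotient.mk I.asIdeal a) y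

/-- A `Λ`-linear map between `Λ / I`-modules as a `Λ / I`-linear map. -/
def unresMap (f : (resQuot I).obj Y →ₗ[Λ] (resQuot I).obj Z) : Y →ₗ[Λ ⧸ I.asIdeal] Z where
  toFun := f
  map_add' := f.map_add
  map_smul' a y := by
    obtain ⟨a, rfl⟩ := Ideal.Quotient.mk_surjective a
    exact f.map_smul a y

theorem finite_resQuot_iff (Y : ModuleCat.{u} (Λ ⧸ I.asIdeal)) :
    Module.Finite Λ ((resQuot I).obj Y) ↔ Module.Finite (Λ ⧸ I.asIdeal) Y := by
  let f : (resQuot I).obj Y →ₛₗ[Ideal.Quotient.mk I.asIdeal] Y :=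
    { toFun := fun y => y
      map_add' := fun _ _ => rfl
      map_smul' := fun _ _ => rfl }
  have : RingHomSurjective (Ideal.Quotient.mk I.asIdeal) := ⟨Ideal.Quotient.mk_surjective⟩
  constructor
  · intro h
    exact Module.Finite.of_surjective f Function.surjective_id
  · rintro ⟨s, hs⟩
    refine ⟨s, ?_⟩
    have key : ∀ y ∈ Submodule.span (Λ ⧸ I.asIdeal) (s : Set Y),
        (show (resQuot I).obj Y from y) ∈
          Submodule.span Λ (show Set ((resQuot I).obj Y) from (s : Set Y)) := by
      intro y hy
      induction hy using Submodule.span_induction with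
      | mem y hy => exact Submodule.subset_span hy
      | zero => exact Submodule.zero_mem _
      | add y z _ _ hy hz => exact Submodule.add_mem _ hy hz
      | smul a y _ hy =>
        obtain ⟨a, rfl⟩ := Ideal.Quotient.mk_surjective a
        exact Submodule.smul_mem _ a hy
    rw [eq_top_iff]
    exact fun y _ => key y (hs ▸ Submodule.mem_top)

/-- The restriction of a torsion pair to the modules over a quotient algebra. -/
def TorsionPair.restrict (τ : TorsionPair Λ) (I : TwoSidedIdeal Λ) :
    TorsionPair (Λ ⧸ I.asIdeal) where
  tors Y := τ.tors ((resQuot I).obj Y)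
  free Y := τ.free ((resQuot I).obj Y)
  tors_finite Y hY := (finite_resQuot_iff Y).1 (τ.tors_finite _ hY)
  free_finite Y hY := (finite_resQuot_iff Y).1 (τ.free_finite _ hY)
  tors_iso _ _ h hY := τ.tors_iso _ _ (h.map (resQuot I).mapIso) hY
  free_iso _ _ h hY := τ.free_iso _ _ (h.map (resQuot I).mapIso) hY
  hom_eq_zero Y Z hY hZ f := by
    have h := τ.linearMap_eq_zero hY hZ (resMap f.hom)
    ext y
    exact LinearMap.congr_fun h y
  exists_shortExact Y hY := by
    -- The canonical sequence over `Λ` descends, since submodules and quotients of a module killed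
    -- by `I` are killed by `I`.
    obtain ⟨A, B, f, g, ⟨hf, hfg, hg⟩, hA, hB⟩ :=
      τ.exists_shortExact ((resQuot I).obj Y) ((finite_resQuot_iff Y).2 hY)
    obtain ⟨A', ⟨eA⟩⟩ := ((killedBy_resQuot Y).of_injective f.hom hf).exists_resQuot
    obtain ⟨B', ⟨eB⟩⟩ := ((killedBy_resQuot Y).of_surjective g.hom hg).exists_resQuot
    refine ⟨A', B', ModuleCat.ofHom (unresMap (f.hom ∘ₗ eA.toLinearMap)),
      ModuleCat.ofHom (unresMap (eB.symm.toLinearMap ∘ₗ g.hom)), ⟨?_, ?_, ?_⟩,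
      τ.tors_equiv eA.symm hA, τ.free_equiv eB.symm hB⟩
    · exact hf.comp eA.injective
    · intro y
      change eB.symm (g.hom y) = 0 ↔ ∃ a : (resQuot I).obj A', f.hom (eA a) = y
      rw [LinearEquiv.map_eq_zero_iff]
      refine (hfg y).trans ⟨?_, ?_⟩
      · rintro ⟨a, rfl⟩
        exact ⟨eA.symm a, by rw [eA.apply_symm_apply]⟩
      · rintro ⟨a, rfl⟩
        exact ⟨eA a, rfl⟩
    · exact eB.symm.surjective.comp hg

end QuotientModules

/-! ### The standard projectives and injectives of the quotient algebras. -/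

section StandardModules

variable {Λ : Type u} [Ring Λ]

/-- The module `Γe` over `Γ = Λ / I`, viewed as a `Λ`-module. -/
abbrev projAt (I : TwoSidedIdeal Λ) (e : Λ) : ModuleCat.{u} Λ :=
  (resQuot I).obj (ModuleCat.of _ (Ideal.span {Ideal.Quotient.mk I.asIdeal e}))

/-- The module `D(eΓ)` over `Γ = Λ / I`, viewed as a `Λ`-module. -/
abbrev injAt (R : Type u) [CommRing R] [Algebra R Λ] (J : Type u) [AddCommGroup J] [Module R J]
    (I : TwoSidedIdeal Λ) (e : Λ) : ModuleCat.{u} Λ :=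
  (resQuot I).obj (ModuleCat.of _ (DualRightIdeal R J (Ideal.Quotient.mk I.asIdeal e)))

variable {I I' : TwoSidedIdeal Λ} {e f : Λ}

theorem quotientMk_eq_zero_iff (a : Λ) : Ideal.Quotient.mk I.asIdeal a = 0 ↔ a ∈ I :=
  Ideal.Quotient.eq_zero_iff_mem.trans TwoSidedIdeal.mem_asIdeal

variable (I e) in
/-- The generator of `projAt I e`. -/
def projGen : projAt I e := spanGen (Ideal.Quotient.mk I.asIdeal e)

theorem exists_smul_projGen (x : projAt I e) : ∃ a : Λ, x = a • projGen I e := by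
  obtain ⟨a, ha⟩ := exists_smul_spanGen (e := Ideal.Quotient.mk I.asIdeal e) x
  obtain ⟨a, rfl⟩ := Ideal.Quotient.mk_surjective a
  exact ⟨a, ha⟩

theorem smul_projGen (he : IsIdempotentElem e) : e • projGen I e = projGen I e :=
  smul_spanGen (he.map (Ideal.Quotient.mk I.asIdeal))

theorem smul_projGen_eq_zero_iff {a : Λ} : a • projGen I e = 0 ↔ a * e ∈ I := by
  rw [← quotientMk_eq_zero_iff, map_mul]
  exact Subtype.ext_iff

/-- One half of `Hom((Λ/I)e, X) = eX`, which needs `X` to be a `Λ/I`-module. -/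
theorem exists_hom_projAt (e : Λ) {X : ModuleCat.{u} Λ} (hX : KilledBy I X) (x : X) :
    ∃ g : projAt I e →ₗ[Λ] X, g (projGen I e) = e • x := by
  obtain ⟨Y, ⟨E⟩⟩ := hX.exists_resQuot
  let y : Y := E.symm x
  let g : ModuleCat.of (Λ ⧸ I.asIdeal) (Ideal.span {Ideal.Quotient.mk I.asIdeal e})
    →ₗ[Λ ⧸ I.asIdeal] Y := spanLift (Ideal.Quotient.mk I.asIdeal e) y
  refine ⟨E.toLinearMap ∘ₗ resMap g, ?_⟩
  have h : resMap g (projGen I e) = e • E.symm x := rfl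
  rw [LinearMap.comp_apply, h, map_smul, LinearEquiv.coe_coe, E.apply_symm_apply]

theorem apply_eq_zero_of_projAt (he : IsIdempotentElem e) {X : ModuleCat.{u} Λ}
    (hX : ∀ x : X, e • x = 0) (g : projAt I e →ₗ[Λ] X) : g = 0 := by
  ext x
  obtain ⟨a, rfl⟩ := exists_smul_projGen x
  rw [map_smul, ← smul_projGen he, map_smul, hX, smul_zero, LinearMap.zero_apply]

theorem KilledBy.mono (h : I ≤ I') {X : ModuleCat.{u} Λ} (hX : KilledBy I' X) : KilledBy I X :=
  fun a ha x => hX a (h ha) x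

theorem exists_surjective_projAt_of_le (he : IsIdempotentElem e) (h : I ≤ I') :
    ∃ g : projAt I e →ₗ[Λ] projAt I' e, Function.Surjective g := by
  obtain ⟨g, hg⟩ := exists_hom_projAt (I := I) e ((killedBy_resQuot _).mono h) (projGen I' e)
  refine ⟨g, fun x => ?_⟩
  obtain ⟨a, rfl⟩ := exists_smul_projGen x
  exact ⟨a • projGen I e, by rw [map_smul, hg, smul_projGen he]⟩

theorem exists_surjective_projAt_of_mul_eq (hf : IsIdempotentElem f) {u v : Λ} (hu : e * u = u)
    (hvu : v * u = f) : ∃ g : projAt I e →ₗ[Λ] projAt I f, Function.Surjective g := by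
  obtain ⟨g, hg⟩ := exists_hom_projAt (I := I) e (killedBy_resQuot _) (u • projGen I f)
  refine ⟨g, fun x => ?_⟩
  obtain ⟨a, rfl⟩ := exists_smul_projGen x
  refine ⟨a • v • projGen I e, ?_⟩
  rw [map_smul, map_smul, hg, smul_smul e, hu, smul_smul v, hvu, smul_projGen hf]

instance finite_projAt : Module.Finite Λ (projAt I e) := by
  refine Module.Finite.of_surjective (LinearMap.toSpanSingleton Λ _ (projGen I e)) fun x => ?_
  obtain ⟨a, rfl⟩ := exists_smul_projGen x
  exact ⟨a, rfl⟩

section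

variable {R : Type u} [CommRing R] [Algebra R Λ] {J : Type u} [AddCommGroup J] [Module R J]

open DualRightIdeal

theorem exists_smul_smul_injAt_ne_zero (he : IsIdempotentElem e) {y : injAt R J I e} (hy : y ≠ 0) :
    ∃ a : Λ, e • a • y ≠ 0 := by
  obtain ⟨a, ha⟩ := DualRightIdeal.exists_smul_smul_ne_zero
    (he.map (Ideal.Quotient.mk I.asIdeal)) (f := y) hy
  obtain ⟨a, rfl⟩ := Ideal.Quotient.mk_surjective a
  exact ⟨a, ha⟩

/-- The counterpart of `exists_hom_projAt`: as `J` cogenerates, maps to `D(e(Λ/I))` detect `eX`. -/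
theorem exists_hom_injAt_apply_ne_zero [IsArtinianRing R]
    (hJ : IsInjectiveEnvelope R (R ⧸ Ring.jacobson R) J) {X : ModuleCat.{u} Λ} (hX : KilledBy I X)
    {x : X} (hx : e • x ≠ 0) : ∃ g : X →ₗ[Λ] injAt R J I e, g x ≠ 0 := by
  obtain ⟨Y, ⟨E⟩⟩ := hX.exists_resQuot
  have hx' : (Ideal.Quotient.mk I.asIdeal e • (show Y from E.symm x) : Y) ≠ 0 := by
    change e • E.symm x ≠ 0
    rwa [← map_smul, ne_eq, LinearEquiv.map_eq_zero_iff]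
  obtain ⟨g, hg⟩ := DualRightIdeal.exists_hom_apply_ne_zero hJ hx'
  let g' : Y →ₗ[Λ ⧸ I.asIdeal] ModuleCat.of (Λ ⧸ I.asIdeal)
    (DualRightIdeal R J (Ideal.Quotient.mk I.asIdeal e)) := g
  refine ⟨resMap g' ∘ₗ E.symm.toLinearMap, fun h => hg ?_⟩
  have h' : g (E.symm x : Y) = 0 := h
  rw [h', map_zero, LinearMap.zero_apply]

theorem apply_eq_zero_of_injAt (he : IsIdempotentElem e) {X : ModuleCat.{u} Λ}
    (hX : ∀ x : X, e • x = 0) (g : X →ₗ[Λ] injAt R J I e) : g = 0 := by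
  ext x
  by_contra hne
  obtain ⟨a, ha⟩ := exists_smul_smul_injAt_ne_zero he hne
  exact ha (by rw [← map_smul, ← map_smul, hX, map_zero])

/-- A surjection of right ideals compatible with right multiplication induces an embedding of the
dual modules. -/
theorem exists_injective_injAt
    (π : rightIdeal R (Ideal.Quotient.mk I.asIdeal e) →ₗ[R]
      rightIdeal R (Ideal.Quotient.mk I'.asIdeal f))
    (hπ : ∀ (a : Λ) x, π (rightIdealMul R _ (Ideal.Quotient.mk I.asIdeal a) x) =
      rightIdealMul R _ (Ideal.Quotient.mk I'.asIdeal a) (π x))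
    (hsurj : Function.Surjective π) :
    ∃ i : injAt R J I' f →ₗ[Λ] injAt R J I e, Function.Injective i ∧
      ∀ y : injAt R J I e, (∀ x, π x = 0 → toHom y x = 0) → ∃ z, i z = y := by
  refine ⟨{ toFun := fun g => ofHom (toHom g ∘ₗ π)
            map_add' := fun g h => rfl
            map_smul' := fun a g => ?_ }, ?_, ?_⟩
  · apply toHom_injective
    ext x
    exact (congrArg (toHom g) (hπ a x)).symm
  · intro g h hgh
    apply toHom_injective
    ext x
    obtain ⟨x, rfl⟩ := hsurj x
    exact LinearMap.congr_fun (congrArg toHom hgh) x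
  · intro y hy
    refine ⟨ofHom ((LinearMap.ker π).liftQ (toHom y) hy ∘ₗ
      (π.quotKerEquivOfSurjective hsurj).symm.toLinearMap), ?_⟩
    apply toHom_injective
    ext x
    change (LinearMap.ker π).liftQ (toHom y) hy ((π.quotKerEquivOfSurjective hsurj).symm (π x)) = _
    have h4 : (π.quotKerEquivOfSurjective hsurj).symm (π x) = Submodule.Quotient.mk x := by
      rw [LinearEquiv.symm_apply_eq]
      rfl
    rw [h4]
    rfl

/-- Dual to the projection `e(Λ/I) → e(Λ/I')`. An element `y` killed by `I'` vanishes on the kernel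
of the projection, because `y (e * b)` is the value of `(e * b) • y` at `e`. So the image contains
everything killed by `I'`. -/
theorem exists_injective_injAt_of_le (he : IsIdempotentElem e) (h : I ≤ I') :
    ∃ i : injAt R J I' e →ₗ[Λ] injAt R J I e, Function.Injective i ∧
      ∀ y : injAt R J I e, (∀ a ∈ I', a • y = 0) → ∃ z, i z = y := by
  have hle : I.asIdeal ≤ I'.asIdeal := h
  let q : (Λ ⧸ I.asIdeal) →+* (Λ ⧸ I'.asIdeal) := Ideal.Quotient.factor hle
  let π : rightIdeal R (Ideal.Quotient.mk I.asIdeal e) →ₗ[R]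
      rightIdeal R (Ideal.Quotient.mk I'.asIdeal e) :=
    { toFun := fun x => ⟨q x, by
        obtain ⟨_, y, rfl⟩ := x
        exact ⟨q y, (map_mul q (Ideal.Quotient.mk I.asIdeal e) y).symm⟩⟩
      map_add' := fun x y => Subtype.ext (map_add q _ _)
      map_smul' := fun r x => Subtype.ext (by
        obtain ⟨x, hx⟩ := x
        obtain ⟨x, rfl⟩ := Ideal.Quotient.mk_surjective x
        rfl) }
  obtain ⟨i, hi, hi'⟩ := exists_injective_injAt (J := J) π (fun a x => Subtype.ext (map_mul q _ _))
    (by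
      rintro ⟨_, y, rfl⟩
      obtain ⟨y, rfl⟩ := Ideal.Quotient.mk_surjective y
      exact ⟨elem R _ (Ideal.Quotient.mk _ y), Subtype.ext (map_mul q _ _)⟩)
  refine ⟨i, hi, fun y hy => hi' y fun x hx => ?_⟩
  obtain ⟨_, b, rfl⟩ := x
  obtain ⟨b, rfl⟩ := Ideal.Quotient.mk_surjective b
  have hb : e * b ∈ I' := by
    rw [← quotientMk_eq_zero_iff]
    exact congrArg Subtype.val hx
  have key : ∀ y : DualRightIdeal R J (Ideal.Quotient.mk I.asIdeal e),
      Ideal.Quotient.mk I.asIdeal (e * b) • y = 0 →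
      toHom y (elem R _ (Ideal.Quotient.mk I.asIdeal b)) = 0 := by
    intro y hy
    have h1 : toHom (Ideal.Quotient.mk I.asIdeal (e * b) • y) (elem R _ 1) =
        toHom y (elem R _ (Ideal.Quotient.mk I.asIdeal b)) := by
      rw [toHom_smul_elem, one_mul]
      congr 1
      refine Subtype.ext ?_
      change Ideal.Quotient.mk I.asIdeal e * _ = Ideal.Quotient.mk I.asIdeal e * _
      rw [← map_mul, ← map_mul, ← mul_assoc, he.eq]
    rw [← h1, hy, map_zero]
    rfl
  exact key y (hy _ hb)

theorem exists_injective_injAt_of_mul_eq {u v : Λ} (hu : e * u = u) (hv : f * v = v)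
    (hvu : v * u = f) : ∃ i : injAt R J I f →ₗ[Λ] injAt R J I e, Function.Injective i := by
  let m := Ideal.Quotient.mk I.asIdeal
  let π : rightIdeal R (m e) →ₗ[R] rightIdeal R (m f) :=
    LinearMap.codRestrict _ (LinearMap.mulLeft R (m v) ∘ₗ (rightIdeal R (m e)).subtype) fun x =>
      ⟨m v * x, by
        rw [LinearMap.mulLeft_apply, ← mul_assoc, ← map_mul, hv]
        rfl⟩
  obtain ⟨i, hi, -⟩ := exists_injective_injAt (J := J) (I := I) (I' := I) (e := e) (f := f) π
    (fun a x => Subtype.ext (mul_assoc (m v) (x : Λ ⧸ I.asIdeal) (m a)).symm)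
    (by
      rintro ⟨_, y, rfl⟩
      refine ⟨elem R _ (m u * y), Subtype.ext ?_⟩
      change m v * (m e * (m u * y)) = m f * y
      rw [← mul_assoc (m e), ← map_mul, hu, ← mul_assoc, ← map_mul, hvu])
  exact ⟨i, hi⟩

theorem finite_injAt [IsArtinianRing R] [Module.Finite R Λ]
    (hJ : IsInjectiveEnvelope R (R ⧸ Ring.jacobson R) J) : Module.Finite Λ (injAt R J I e) := by
  have : Module.Finite R (Λ ⧸ I.asIdeal) :=
    Module.Finite.of_surjective (Ideal.Quotient.mkₐ R I.asIdeal).toLinearMap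
      Ideal.Quotient.mk_surjective
  exact (finite_resQuot_iff _).2 (DualRightIdeal.finite hJ)

end

end StandardModules

/-! ### The trace of the standard projectives and the reject of the standard injectives. -/

section TraceReject

variable {Λ : Type u} [Ring Λ] {n : ℕ} {e : Fin n → Λ} {s : Finset (Fin n)}
  {I I' : TwoSidedIdeal Λ} {X : ModuleCat.{u} Λ}

variable (e s X) in
/-- The submodule of `X` generated by the `e k • X`, `k ∈ s`. -/
def genSub : Submodule Λ X := Submodule.span Λ {z | ∃ k ∈ s, ∃ x : X, z = e k • x}

variable (e s X) in
/-- The largest submodule of `X` annihilated by the `e k`, `k ∈ s`. -/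
def killSub : Submodule Λ X where
  carrier := {x | ∀ k ∈ s, ∀ a : Λ, e k • a • x = 0}
  add_mem' hx hy k hk a := by rw [smul_add, smul_add, hx k hk, hy k hk, add_zero]
  zero_mem' k _ a := by rw [smul_zero, smul_zero]
  smul_mem' b x hx k hk a := by rw [smul_smul a b, hx k hk]

theorem smul_quotient_genSub {k : Fin n} (hk : k ∈ s) (y : X ⧸ genSub e s X) : e k • y = 0 := by
  obtain ⟨x, rfl⟩ := (genSub e s X).mkQ_surjective y
  rw [← map_smul, Submodule.mkQ_apply, Submodule.Quotient.mk_eq_zero]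
  exact Submodule.subset_span ⟨k, hk, x, rfl⟩

theorem smul_killSub {k : Fin n} (hk : k ∈ s) (y : killSub e s X) : e k • y = 0 := by
  have := y.2 k hk 1
  rw [one_smul] at this
  exact Subtype.ext this

theorem smul_quotient_eq_zero_of_killSub {k : Fin n} (hk : k ∈ s) (he : IsIdempotentElem (e k))
    {x : X} (hx : e k • (killSub e s X).mkQ x = 0) : e k • x = 0 := by
  rw [← map_smul, Submodule.mkQ_apply, Submodule.Quotient.mk_eq_zero] at hx
  have := hx k hk 1
  rwa [one_smul, smul_smul, he.eq] at this

theorem tors_of_genSub_eq_top (τ : TorsionPair Λ) (hX : KilledBy I X) (hfin : Module.Finite Λ X)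
    (h : ∀ k ∈ s, τ.tors (projAt I (e k)))
    (htop : genSub e s X = ⊤) : τ.tors X := by
  refine τ.tors_of_forall hfin fun Y hY φ => ?_
  rw [← LinearMap.ker_eq_top, eq_top_iff, ← htop, genSub, Submodule.span_le]
  rintro _ ⟨k, hk, x, rfl⟩
  obtain ⟨g, hg⟩ := exists_hom_projAt (e k) hX x
  rw [SetLike.mem_coe, LinearMap.mem_ker, ← hg]
  exact LinearMap.congr_fun (τ.linearMap_eq_zero (h k hk) hY (φ ∘ₗ g)) _

/-- The generators `e k • x` equal `e k • (e k • x)`, so they survive when the trace is formed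
again. -/
theorem genSub_genSub (he : ∀ k, IsIdempotentElem (e k)) :
    genSub e s (ModuleCat.of Λ (genSub e s X)) = ⊤ := by
  refine eq_top_iff.2 fun z _ => ?_
  obtain ⟨z, hz⟩ := z
  change (⟨z, hz⟩ : genSub e s X) ∈ genSub e s (ModuleCat.of Λ (genSub e s X))
  have key : ∀ z, z ∈ genSub e s X → z ∈ Submodule.map (genSub e s X).subtype
      (genSub e s (ModuleCat.of Λ (genSub e s X))) := by
    intro z hz
    have : genSub e s X ≤ Submodule.map (genSub e s X).subtype
        (genSub e s (ModuleCat.of Λ (genSub e s X))) := by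
      refine Submodule.span_le.2 ?_
      rintro _ ⟨k, hk, x, rfl⟩
      have hx : e k • x ∈ genSub e s X := Submodule.subset_span ⟨k, hk, x, rfl⟩
      refine ⟨e k • (⟨e k • x, hx⟩ : genSub e s X),
        Submodule.subset_span ⟨k, hk, ⟨e k • x, hx⟩, rfl⟩, ?_⟩
      change e k • e k • x = e k • x
      rw [smul_smul, (he k).eq]
    exact this hz
  obtain ⟨w, hw, hwz⟩ := key z hz
  have : w = ⟨z, hz⟩ := Subtype.ext hwz
  rwa [← this]

/-- If `e k • a • x` lies in the reject, then `e k • a • x = e k • (e k • a • x) = 0`. -/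
theorem killSub_quotient (he : ∀ k, IsIdempotentElem (e k)) :
    killSub e s (ModuleCat.of Λ (X ⧸ killSub e s X)) = ⊥ := by
  rw [Submodule.eq_bot_iff]
  intro y hy
  obtain ⟨x, rfl⟩ := (killSub e s X).mkQ_surjective y
  rw [Submodule.mkQ_apply, Submodule.Quotient.mk_eq_zero]
  intro k hk a
  refine smul_quotient_eq_zero_of_killSub hk (he k) ?_
  rw [map_smul]
  exact hy k hk a

section

variable {R : Type u} [CommRing R] [Algebra R Λ] {J : Type u} [AddCommGroup J] [Module R J]
  [IsArtinianRing R] (hJ : IsInjectiveEnvelope R (R ⧸ Ring.jacobson R) J)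

include hJ in
theorem free_of_killSub_eq_bot (τ : TorsionPair Λ) (hX : KilledBy I X) (hfin : Module.Finite Λ X)
    (h : ∀ k ∈ s, τ.free (injAt R J I (e k))) (hbot : killSub e s X = ⊥) : τ.free X := by
  refine τ.free_of_forall hfin fun Y hY φ => ?_
  ext y
  have hmem : φ y ∈ killSub e s X := by
    intro k hk a
    by_contra hne
    obtain ⟨g, hg⟩ := exists_hom_injAt_apply_ne_zero hJ hX hne
    apply hg
    rw [← map_smul]
    exact LinearMap.congr_fun (τ.linearMap_eq_zero hY (h k hk) (g ∘ₗ φ)) (a • y)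
  rw [hbot] at hmem
  exact (Submodule.mem_bot _).1 hmem

variable [Module.Finite R Λ]

instance : Module.Finite R (Λ ⧸ I.asIdeal) :=
  Module.Finite.of_surjective (Ideal.Quotient.mkₐ R I.asIdeal).toLinearMap
    Ideal.Quotient.mk_surjective

-- Replaces the class `Gen P_j` by conditions on elements. One direction uses that a map from `(Λ/I)
-- (e k)` to the quotient by the trace is zero.
variable (R) in
include R in
omit [IsArtinianRing R] in
theorem gen_map_iff (he : ∀ k, IsIdempotentElem (e k)) :
    (Gen (∀ k : s, Ideal.span {Ideal.Quotient.mk I.asIdeal (e k)})).map (resQuot I) X ↔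
      Module.Finite Λ X ∧ KilledBy I X ∧ genSub e s X = ⊤ := by
  constructor
  · rintro ⟨Y, ⟨hfin, m, f, hf⟩, ⟨E⟩⟩
    let E := E.toLinearEquiv
    have hYfin : Module.Finite Λ ((resQuot I).obj Y) := (finite_resQuot_iff Y).2 hfin
    refine ⟨Module.Finite.equiv E, (killedBy_resQuot Y).of_surjective E.toLinearMap E.surjective, ?_⟩
    have hmem : ∀ i k x, E (f (Pi.single i (Pi.single k x))) ∈ genSub e s X := by
      intro i k x
      let c : ModuleCat.of (Λ ⧸ I.asIdeal) (Ideal.span {Ideal.Quotient.mk I.asIdeal (e k)})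
          →ₗ[Λ ⧸ I.asIdeal] Y := f ∘ₗ LinearMap.single _ _ i ∘ₗ LinearMap.single (Λ ⧸ I.asIdeal)
            (fun k : s => Ideal.span {Ideal.Quotient.mk I.asIdeal (e k)}) k
      let g : projAt I (e k) →ₗ[Λ] ModuleCat.of Λ (X ⧸ genSub e s X) :=
        (genSub e s X).mkQ ∘ₗ E.toLinearMap ∘ₗ resMap c
      have hg : g = 0 := apply_eq_zero_of_projAt (he k) (smul_quotient_genSub k.2) g
      exact (Submodule.Quotient.mk_eq_zero _).1 (LinearMap.congr_fun hg x)
    refine eq_top_iff.2 fun x _ => ?_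
    obtain ⟨y, rfl⟩ := E.surjective x
    obtain ⟨v, hv⟩ := hf y
    let F : (Fin m → ∀ k : s, Ideal.span {Ideal.Quotient.mk I.asIdeal (e k)}) →+ X :=
      (E.toLinearMap.toAddMonoidHom : Y →+ X).comp f.toAddMonoidHom
    rw [← hv]
    change F v ∈ _
    rw [← Finset.univ_sum_single v, map_sum]
    refine Submodule.sum_mem _ fun i _ => ?_
    have h2 : (Pi.single i (v i) : Fin m → ∀ k : s, Ideal.span {Ideal.Quotient.mk I.asIdeal (e k)}) =
        ∑ k, Pi.single i (Pi.single k (v i k)) := by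
      conv_lhs => rw [← Finset.univ_sum_single (v i)]
      exact map_sum (AddMonoidHom.single _ i) _ _
    rw [h2, map_sum]
    exact Submodule.sum_mem _ fun k _ => hmem i k _
  · rintro ⟨hfin, hX, htop⟩
    obtain ⟨Y, ⟨E⟩⟩ := hX.exists_resQuot
    have hY : Module.Finite (Λ ⧸ I.asIdeal) Y :=
      (finite_resQuot_iff Y).1 (Module.Finite.equiv E.symm)
    refine ⟨Y, gen_of_span_eq_top (R := R) Y ?_, ⟨E.toModuleIso⟩⟩
    have key : ∀ x ∈ genSub e s X, (show Y from E.symm x) ∈ Submodule.span (Λ ⧸ I.asIdeal)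
        {z : Y | ∃ k : s, ∃ y : Y, z = Ideal.Quotient.mk I.asIdeal (e k) • y} := by
      intro x hx
      induction hx using Submodule.span_induction with
      | mem x hx =>
        obtain ⟨k, hk, x, rfl⟩ := hx
        exact Submodule.subset_span ⟨⟨k, hk⟩, E.symm x, map_smul E.symm _ _⟩
      | zero => rw [map_zero]; exact Submodule.zero_mem _
      | add x y _ _ hx hy => rw [map_add]; exact Submodule.add_mem _ hx hy
      | smul a x _ hx => rw [map_smul]; exact Submodule.smul_mem _ (Ideal.Quotient.mk _ a) hx
    refine eq_top_iff.2 fun y _ => ?_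
    obtain ⟨x, rfl⟩ := E.symm.surjective y
    exact key x (htop ▸ Submodule.mem_top)

-- The dual description of `Cogen`: maps from the reject to `D(e k (Λ/I))` are zero.
include hJ in
theorem cogen_map_iff (he : ∀ k, IsIdempotentElem (e k)) :
    (Cogen (∀ k : s, DualRightIdeal R J (Ideal.Quotient.mk I.asIdeal (e k)))).map (resQuot I) X ↔
      Module.Finite Λ X ∧ KilledBy I X ∧ killSub e s X = ⊥ := by
  constructor
  · rintro ⟨Y, ⟨hfin, m, f, hf⟩, ⟨E⟩⟩
    let E := E.toLinearEquiv
    have hYfin : Module.Finite Λ ((resQuot I).obj Y) := (finite_resQuot_iff Y).2 hfin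
    refine ⟨Module.Finite.equiv E, (killedBy_resQuot Y).of_surjective E.toLinearMap E.surjective, ?_⟩
    rw [Submodule.eq_bot_iff]
    intro x hx
    have h0 : f (E.symm x : Y) = 0 := by
      ext i k : 2
      let c : Y →ₗ[Λ ⧸ I.asIdeal] ModuleCat.of (Λ ⧸ I.asIdeal)
          (DualRightIdeal R J (Ideal.Quotient.mk I.asIdeal (e k))) :=
        LinearMap.proj k ∘ₗ LinearMap.proj i ∘ₗ f
      let g : ModuleCat.of Λ (killSub e s X) →ₗ[Λ] injAt R J I (e k) :=
        resMap c ∘ₗ E.symm.toLinearMap ∘ₗ (killSub e s X).subtype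
      have hg : g = 0 := apply_eq_zero_of_injAt (he k) (smul_killSub k.2) g
      exact LinearMap.congr_fun hg ⟨x, hx⟩
    have h1 : E.symm x = 0 := hf (h0.trans (map_zero f).symm)
    rwa [LinearEquiv.map_eq_zero_iff] at h1
  · rintro ⟨hfin, hX, hbot⟩
    obtain ⟨Y, ⟨E⟩⟩ := hX.exists_resQuot
    have hY : Module.Finite (Λ ⧸ I.asIdeal) Y :=
      (finite_resQuot_iff Y).1 (Module.Finite.equiv E.symm)
    refine ⟨Y, cogen_of_forall_eq_zero hJ Y fun y hy => ?_, ⟨E.toModuleIso⟩⟩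
    have hmem : E y ∈ killSub e s X := by
      intro k hk a
      change e k • a • E (show (resQuot I).obj Y from y) = 0
      rw [← map_smul, ← map_smul]
      have := hy ⟨k, hk⟩ (Ideal.Quotient.mk I.asIdeal a)
      exact (congrArg E this).trans (map_zero E)
    rw [hbot, Submodule.mem_bot] at hmem
    exact (LinearEquiv.map_eq_zero_iff E).1 hmem

-- Every `(Λ/I) (e k)` that is a quotient of a torsion module is torsion, so
-- `addClosure_of_projective` applies with the set of torsion indices. The condition `e k ∉ I`
-- discards zero modules.
variable (R) in
include R in
omit [IsArtinianRing R] in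
theorem tors_projective_iff_addClosure (τ : TorsionPair Λ) (hid : ∀ k, IsIdempotentElem (e k))
    (hsum : ∑ k, e k = 1) (hloc : ∀ k, IsLocalCorner (e k))
    (h1 : ∀ k ∈ s, τ.tors (projAt I (e k)))
    (h2 : ∀ k, e k ∉ I → τ.tors (projAt I (e k)) → k ∈ s) (Y : ModuleCat.{u} (Λ ⧸ I.asIdeal)) :
    (τ.tors ((resQuot I).obj Y) ∧ Module.Projective (Λ ⧸ I.asIdeal) Y) ↔
      addClosure (∀ k : s, Ideal.span {Ideal.Quotient.mk I.asIdeal (e k)}) Y := by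
  have hid' : ∀ k, IsIdempotentElem (Ideal.Quotient.mk I.asIdeal (e k)) := fun k => (hid k).map _
  constructor
  · rintro ⟨hT, hP⟩
    have hY : Module.Finite (Λ ⧸ I.asIdeal) Y := (τ.restrict I).tors_finite Y hT
    refine addClosure_of_projective (R := R) (e := fun k => Ideal.Quotient.mk I.asIdeal (e k))
      hid' ?_ ?_ s Y hP ?_
    · rw [← map_sum, hsum, map_one]
    · exact fun k => (hloc k).map Ideal.Quotient.mk_surjective (hid k)
    · rintro k hk ⟨f, hf⟩
      refine h2 k (fun h => hk ((quotientMk_eq_zero_iff _).2 h)) ?_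
      exact (τ.restrict I).tors_of_surjective
        (Y := ModuleCat.of _ (Ideal.span {Ideal.Quotient.mk I.asIdeal (e k)})) hT f hf
  · rintro ⟨hfin, m, f, g, hgf⟩
    have hg : Function.Surjective g := fun y => ⟨f y, LinearMap.congr_fun hgf y⟩
    constructor
    · refine (τ.restrict I).tors_of_surjective (X := ModuleCat.of _ (Fin m → ∀ k : s,
        Ideal.span {Ideal.Quotient.mk I.asIdeal (e k)})) ?_ g hg
      refine (τ.restrict I).tors_pi fun _ => (τ.restrict I).tors_pi fun k => ?_
      exact h1 k k.2
    · have : ∀ k : s, Module.Projective (Λ ⧸ I.asIdeal)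
        (Ideal.span {Ideal.Quotient.mk I.asIdeal (e k)}) := fun k => projective_span (hid' k)
      have := Module.Projective.pi_of_finite (Γ := Λ ⧸ I.asIdeal)
        (M := fun k : s => Ideal.span {Ideal.Quotient.mk I.asIdeal (e k)})
      have := Module.Projective.pi_of_finite (Γ := Λ ⧸ I.asIdeal)
        (M := fun _ : Fin m => ∀ k : s, Ideal.span {Ideal.Quotient.mk I.asIdeal (e k)})
      exact Module.Projective.of_split f g hgf

include hJ in
theorem free_injective_iff_addClosure (τ : TorsionPair Λ) (hid : ∀ k, IsIdempotentElem (e k))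
    (hsum : ∑ k, e k = 1) (hloc : ∀ k, IsLocalCorner (e k))
    (h1 : ∀ k ∈ s, τ.free (injAt R J I (e k)))
    (h2 : ∀ k, e k ∉ I → τ.free (injAt R J I (e k)) → k ∈ s)
    (Y : ModuleCat.{u} (Λ ⧸ I.asIdeal)) :
    (τ.free ((resQuot I).obj Y) ∧ Module.Injective (Λ ⧸ I.asIdeal) Y) ↔
      addClosure (∀ k : s, DualRightIdeal R J (Ideal.Quotient.mk I.asIdeal (e k))) Y := by
  have hid' : ∀ k, IsIdempotentElem (Ideal.Quotient.mk I.asIdeal (e k)) := fun k => (hid k).map _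
  have : IsArtinianRing (Λ ⧸ I.asIdeal) := IsArtinianRing.of_finite R _
  constructor
  · rintro ⟨hT, hP⟩
    have hY : Module.Finite (Λ ⧸ I.asIdeal) Y := (τ.restrict I).free_finite Y hT
    refine addClosure_of_injective hJ (e := fun k => Ideal.Quotient.mk I.asIdeal (e k))
      hid' ?_ ?_ s Y hP ?_
    · rw [← map_sum, hsum, map_one]
    · exact fun k => (hloc k).map Ideal.Quotient.mk_surjective (hid k)
    · rintro k hk ⟨f, hf⟩
      refine h2 k (fun h => hk ((quotientMk_eq_zero_iff _).2 h)) ?_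
      exact (τ.restrict I).free_of_injective
        (X := ModuleCat.of _ (DualRightIdeal R J (Ideal.Quotient.mk I.asIdeal (e k)))) hT f hf
  · rintro ⟨hfin, m, f, g, hgf⟩
    have hf : Function.Injective f := Function.LeftInverse.injective (LinearMap.congr_fun hgf)
    constructor
    · refine (τ.restrict I).free_of_injective (Y := ModuleCat.of _ (Fin m → ∀ k : s,
        DualRightIdeal R J (Ideal.Quotient.mk I.asIdeal (e k)))) ?_ f hf
      refine (τ.restrict I).free_pi fun _ => (τ.restrict I).free_pi fun k => ?_
      exact h1 k k.2
    · have : ∀ k : s, Module.Injective (Λ ⧸ I.asIdeal)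
        (DualRightIdeal R J (Ideal.Quotient.mk I.asIdeal (e k))) :=
        fun k => DualRightIdeal.injective hJ.1 (hid' k)
      exact Module.Injective.of_retract inferInstance f g hgf

end

end TraceReject

/-! ### Ideals generated by idempotents, and the two perpendicular conditions. -/

section StageIdeals

variable {Λ : Type u} [Ring Λ] {n : ℕ} {e : Fin n → Λ} {X Y : ModuleCat.{u} Λ}

theorem eq_zero_of_genSub_eq_top {s : Finset (Fin n)} (htop : genSub e s X = ⊤)
    (hY : ∀ k ∈ s, ∀ y : Y, e k • y = 0) (f : X →ₗ[Λ] Y) : f = 0 := by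
  rw [← LinearMap.ker_eq_top, eq_top_iff, ← htop, genSub, Submodule.span_le]
  rintro _ ⟨k, hk, x, rfl⟩
  rw [SetLike.mem_coe, LinearMap.mem_ker, map_smul, hY k hk]

theorem eq_zero_of_killSub_eq_bot {s : Finset (Fin n)} (hbot : killSub e s Y = ⊥)
    (hX : ∀ k ∈ s, ∀ x : X, e k • x = 0) (f : X →ₗ[Λ] Y) : f = 0 := by
  ext x
  have : f x ∈ killSub e s Y := fun k hk a => by rw [← map_smul, ← map_smul, hX k hk, map_zero]
  rw [hbot] at this
  exact (Submodule.mem_bot _).1 this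

variable (e) in
/-- The two-sided ideal generated by the `e k`, `k ∈ A`. -/
def idemIdeal (A : Finset (Fin n)) : TwoSidedIdeal Λ := TwoSidedIdeal.span {∑ k ∈ A, e k}

theorem mem_idemIdeal (he : OrthogonalIdempotents e) {A : Finset (Fin n)} {k : Fin n} (hk : k ∈ A) :
    e k ∈ idemIdeal e A := by
  have h : e k * ∑ l ∈ A, e l = e k := by
    rw [Finset.mul_sum, Finset.sum_eq_single k, (he.idem k).eq]
    · exact fun l _ hl => he.ortho hl.symm
    · exact fun h => absurd hk h
  rw [← h]
  exact TwoSidedIdeal.mul_mem_left _ _ _ (TwoSidedIdeal.subset_span rfl)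

theorem idemIdeal_mono (he : OrthogonalIdempotents e) {A B : Finset (Fin n)} (h : A ⊆ B) :
    idemIdeal e A ≤ idemIdeal e B := by
  rw [idemIdeal, TwoSidedIdeal.span_le, Set.singleton_subset_iff]
  exact sum_mem fun k hk => mem_idemIdeal he (h hk)

/-- The annihilator of `X` is a two-sided ideal, so only the generator needs checking. -/
theorem killedBy_idemIdeal (he : OrthogonalIdempotents e) {A : Finset (Fin n)} :
    KilledBy (idemIdeal e A) X ↔ ∀ k ∈ A, ∀ x : X, e k • x = 0 := by
  constructor
  · exact fun h k hk x => h _ (mem_idemIdeal he hk) x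
  · intro h a ha x
    let N : TwoSidedIdeal Λ := TwoSidedIdeal.mk' {a | ∀ x : X, a • x = 0}
      (fun x => zero_smul _ x)
      (fun ha hb x => by rw [add_smul, ha, hb, add_zero])
      (fun ha x => by rw [neg_smul, ha, neg_zero])
      (fun ha x => by rw [mul_smul, ha, smul_zero])
      (fun ha x => by rw [mul_smul, ha])
    have hN : ∀ a, a ∈ N ↔ ∀ x : X, a • x = 0 := fun a => TwoSidedIdeal.mem_mk' ..
    have hle : idemIdeal e A ≤ N := by
      rw [idemIdeal, TwoSidedIdeal.span_le, Set.singleton_subset_iff]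
      refine (hN _).2 fun x => ?_
      rw [Finset.sum_smul]
      exact Finset.sum_eq_zero fun k hk => h k hk x
    exact (hN a).1 (hle ha) x

theorem killedBy_idemIdeal_union (he : OrthogonalIdempotents e) {A B : Finset (Fin n)} :
    KilledBy (idemIdeal e (A ∪ B)) X ↔
      KilledBy (idemIdeal e A) X ∧ ∀ k ∈ B, ∀ x : X, e k • x = 0 := by
  simp only [killedBy_idemIdeal he, Finset.mem_union, or_imp, forall_and]

/-- A primitive idempotent in the ideal has a left ideal isomorphic to some `Λ (e i)` with `i ∈ A`.
Closure of the blocks under isomorphism is needed for this. -/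
theorem mem_of_mem_idemIdeal {R : Type u} [CommRing R] [IsArtinianRing R] [Algebra R Λ]
    [Module.Finite R Λ] (hprim : ∀ k, IsPrimitiveIdempotent (e k)) {A : Finset (Fin n)}
    (hA : ∀ k ∈ A, ∀ l, Nonempty (Ideal.span {e k} ≃ₗ[Λ] Ideal.span {e l}) → l ∈ A) {k : Fin n}
    (hk : e k ∈ idemIdeal e A) : k ∈ A := by
  obtain ⟨i, hi, hE⟩ := exists_linearEquiv_of_mem_span (fun i _ => hprim i) (hprim k)
    ((hprim k).isLocalCorner (R := R)) hk
  exact hA i hi k hE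

variable {R : Type u} [CommRing R] [Algebra R Λ] [IsArtinianRing R] [Module.Finite R Λ]
  {J : Type u} [AddCommGroup J] [Module R J] {I : TwoSidedIdeal Λ} {s : Finset (Fin n)}

variable (R) in
include R in
omit [IsArtinianRing R] in
theorem hom_pi_projAt_eq_zero_iff (he : ∀ k, IsIdempotentElem (e k)) (hX : KilledBy I X) :
    (∀ f : (resQuot I).obj (ModuleCat.of _ (∀ k : s, Ideal.span {Ideal.Quotient.mk I.asIdeal (e k)}))
      ⟶ X, f = 0) ↔ ∀ k ∈ s, ∀ x : X, e k • x = 0 := by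
  constructor
  · intro hf k hk x
    obtain ⟨g, hg⟩ := exists_hom_projAt (e k) hX x
    let p : ModuleCat.of (Λ ⧸ I.asIdeal) (∀ k : s, Ideal.span {Ideal.Quotient.mk I.asIdeal (e k)})
      →ₗ[Λ ⧸ I.asIdeal] ModuleCat.of (Λ ⧸ I.asIdeal)
        (Ideal.span {Ideal.Quotient.mk I.asIdeal (e k)}) := LinearMap.proj (⟨k, hk⟩ : s)
    have h0 : g ∘ₗ resMap p = 0 :=
      congrArg ModuleCat.Hom.hom (hf (ModuleCat.ofHom (g ∘ₗ resMap p)))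
    have hp : Function.Surjective p := fun y =>
      ⟨Pi.single (⟨k, hk⟩ : s) y, Pi.single_eq_same
        (M := fun k : s => Ideal.span {Ideal.Quotient.mk I.asIdeal (e k)}) ⟨k, hk⟩ y⟩
    obtain ⟨y, hy⟩ := hp (spanGen (Ideal.Quotient.mk I.asIdeal (e k)))
    rw [← hg]
    exact (congrArg g hy).symm.trans (LinearMap.congr_fun h0 y)
  · intro hx f
    have h : (Gen (∀ k : s, Ideal.span {Ideal.Quotient.mk I.asIdeal (e k)})).map (resQuot I)
        ((resQuot I).obj (ModuleCat.of _
          (∀ k : s, Ideal.span {Ideal.Quotient.mk I.asIdeal (e k)}))) :=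
      ObjectProperty.prop_map_obj _ _ ⟨inferInstanceAs (Module.Finite (Λ ⧸ I.asIdeal)
        (∀ k : s, Ideal.span {Ideal.Quotient.mk I.asIdeal (e k)})), 1, LinearMap.proj 0,
          fun x => ⟨fun _ => x, rfl⟩⟩
    ext1
    exact eq_zero_of_genSub_eq_top ((gen_map_iff R he).1 h).2.2 hx f.hom

/-- The right-hand side is the same as in `hom_pi_projAt_eq_zero_iff`, so projective and injective
steps lead to the same next quotient algebra. -/
theorem hom_pi_injAt_eq_zero_iff (hJ : IsInjectiveEnvelope R (R ⧸ Ring.jacobson R) J)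
    (he : ∀ k, IsIdempotentElem (e k)) (hX : KilledBy I X) :
    (∀ f : X ⟶ (resQuot I).obj (ModuleCat.of _
      (∀ k : s, DualRightIdeal R J (Ideal.Quotient.mk I.asIdeal (e k)))), f = 0) ↔
        ∀ k ∈ s, ∀ x : X, e k • x = 0 := by
  constructor
  · intro hf k hk x
    by_contra hne
    obtain ⟨g, hg⟩ := exists_hom_injAt_apply_ne_zero hJ hX hne
    let Z : ModuleCat (Λ ⧸ I.asIdeal) := ModuleCat.of _
      (∀ k : s, DualRightIdeal R J (Ideal.Quotient.mk I.asIdeal (e k)))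
    let i : ModuleCat.of (Λ ⧸ I.asIdeal) (DualRightIdeal R J (Ideal.Quotient.mk I.asIdeal (e k)))
      →ₗ[Λ ⧸ I.asIdeal] Z :=
      LinearMap.single (Λ ⧸ I.asIdeal)
        (fun k : s => DualRightIdeal R J (Ideal.Quotient.mk I.asIdeal (e k))) ⟨k, hk⟩
    let i' : injAt R J I (e k) →ₗ[Λ] (resQuot I).obj Z := resMap i
    let φ : X ⟶ (resQuot I).obj Z := ModuleCat.ofHom (Y := (resQuot I).obj Z) (i' ∘ₗ g)
    have h0 : φ.hom = 0 := by rw [show φ = 0 from hf φ]; rfl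
    have hi : Function.Injective i' := Pi.single_injective
      (M := fun k : s => DualRightIdeal R J (Ideal.Quotient.mk I.asIdeal (e k))) ⟨k, hk⟩
    exact hg (hi ((LinearMap.congr_fun h0 x).trans (map_zero i').symm))
  · intro hx f
    have : ∀ k, Module.Finite (Λ ⧸ I.asIdeal)
      (DualRightIdeal R J (Ideal.Quotient.mk I.asIdeal (e k))) :=
        fun k => DualRightIdeal.finite hJ
    have h : (Cogen (∀ k : s, DualRightIdeal R J (Ideal.Quotient.mk I.asIdeal (e k)))).map
        (resQuot I) ((resQuot I).obj (ModuleCat.of _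
          (∀ k : s, DualRightIdeal R J (Ideal.Quotient.mk I.asIdeal (e k))))) :=
      ObjectProperty.prop_map_obj _ _ ⟨inferInstanceAs (Module.Finite (Λ ⧸ I.asIdeal)
        (∀ k : s, DualRightIdeal R J (Ideal.Quotient.mk I.asIdeal (e k)))), 1,
          LinearMap.pi fun _ => LinearMap.id, fun x y hxy => congrFun hxy 0⟩
    ext1
    exact eq_zero_of_killSub_eq_bot ((cogen_map_iff hJ he).1 h).2.2 hx f.hom

end StageIdeals

/-! ### The stage classes as restrictions of the torsion pair. -/

section Stages

variable {Λ : Type u} [Ring Λ] {n : ℕ} {e : Fin n → Λ}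

namespace BlockSequence

variable (S : BlockSequence e)

/-- The union of the blocks `Δ_0, …, Δ_{j-1}`. -/
def upto (j : ℕ) : Finset (Fin n) := (Finset.range j).biUnion S.block

theorem upto_succ (j : ℕ) : S.upto (j + 1) = S.upto j ∪ S.block j := by
  rw [upto, Finset.range_add_one, Finset.biUnion_insert, Finset.union_comm, upto]

theorem upto_mono {i j : ℕ} (h : i ≤ j) : S.upto i ⊆ S.upto j :=
  Finset.biUnion_subset_biUnion_of_subset_left _ (Finset.range_mono h)

theorem block_subset_upto {i j : ℕ} (h : i < j) : S.block i ⊆ S.upto j :=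
  Finset.subset_biUnion_of_mem S.block (Finset.mem_range.2 h)

theorem notMem_upto {j : ℕ} {k : Fin n} (hk : k ∈ S.block j) : k ∉ S.upto j := by
  intro h
  obtain ⟨i, hi, hki⟩ := Finset.mem_biUnion.1 h
  exact Finset.disjoint_left.1 (S.disjoint i j (Finset.mem_range.1 hi).ne) hki hk

theorem stageIdeal_eq (j : ℕ) : S.stageIdeal j = idemIdeal e (S.upto j) := by
  rw [stageIdeal, idemIdeal, upto, Finset.sum_biUnion fun i _ j _ hij => S.disjoint i j hij]
  rfl

variable {S} {X : ModuleCat.{u} Λ}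

theorem killedBy_stageIdeal_succ (he : OrthogonalIdempotents e) {j : ℕ} :
    KilledBy (S.stageIdeal (j + 1)) X ↔
      KilledBy (S.stageIdeal j) X ∧ ∀ k ∈ S.block j, ∀ x : X, e k • x = 0 := by
  rw [stageIdeal_eq, stageIdeal_eq, upto_succ, killedBy_idemIdeal_union he]

theorem killedBy_stageIdeal_zero : KilledBy (S.stageIdeal 0) X := by
  have : S.stageIdeal 0 ≤ ⊥ := by
    rw [stageIdeal, TwoSidedIdeal.span_le]
    simp
  intro a ha x
  rw [(TwoSidedIdeal.mem_bot _).1 (this ha), zero_smul]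

theorem stageIdeal_mono (he : OrthogonalIdempotents e) {i j : ℕ} (h : i ≤ j) :
    S.stageIdeal i ≤ S.stageIdeal j := by
  rw [stageIdeal_eq, stageIdeal_eq]
  exact idemIdeal_mono he (S.upto_mono h)

theorem mem_stageIdeal_iff {R : Type u} [CommRing R] [IsArtinianRing R] [Algebra R Λ]
    [Module.Finite R Λ] (he : OrthogonalIdempotents e)
    (hprim : ∀ k, IsPrimitiveIdempotent (e k)) {j : ℕ} {k : Fin n} :
    e k ∈ S.stageIdeal j ↔ k ∈ S.upto j := by
  rw [stageIdeal_eq]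
  refine ⟨fun h => mem_of_mem_idemIdeal (R := R) hprim (fun l hl i hi => ?_) h, mem_idemIdeal he⟩
  obtain ⟨j', hj', hl⟩ := Finset.mem_biUnion.1 hl
  exact Finset.mem_biUnion.2 ⟨j', hj', S.iso_closed j' l hl i hi⟩

end BlockSequence

variable {R : Type u} [CommRing R] [Algebra R Λ] {J : Type u} [AddCommGroup J] [Module R J]

theorem tors_of_torsStage {S : BlockSequence e} {τ : TorsionPair Λ} {X : ModuleCat.{u} Λ} :
    ∀ {j : ℕ}, torsStage S τ j X → τ.tors X
  | 0, h => h
  | _ + 1, h => tors_of_torsStage h.1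

theorem free_of_freeStage {S : BlockSequence e} {τ : TorsionPair Λ} {X : ModuleCat.{u} Λ} :
    ∀ {j : ℕ}, freeStage R J S τ j X → τ.free X
  | 0, h => h
  | _ + 1, h => free_of_freeStage h.1

variable (R J) in
/-- The standard projective modules of the even blocks are torsion, and the standard injective
modules of the odd blocks are torsion-free. -/
structure Supports (τ : TorsionPair Λ) (S : BlockSequence e) : Prop where
  proj : ∀ j ≤ S.m, Even j → ∀ k ∈ S.block j, τ.tors (projAt (S.stageIdeal j) (e k))
  inj : ∀ j ≤ S.m, Odd j → ∀ k ∈ S.block j, τ.free (injAt R J (S.stageIdeal j) (e k))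

variable (R J) in
/-- The even blocks consist of the new indices with torsion standard projective modules, the odd
blocks consist of the new indices with torsion-free standard injective modules. -/
structure Determines (τ : TorsionPair Λ) (S : BlockSequence e) : Prop where
  proj : ∀ j ≤ S.m, Even j → ∀ k,
    k ∈ S.block j ↔ k ∉ S.upto j ∧ τ.tors (projAt (S.stageIdeal j) (e k))
  inj : ∀ j ≤ S.m, Odd j → ∀ k,
    k ∈ S.block j ↔ k ∉ S.upto j ∧ τ.free (injAt R J (S.stageIdeal j) (e k))

theorem Determines.supports {τ : TorsionPair Λ} {S : BlockSequence e} (h : Determines R J τ S) :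
    Supports R J τ S :=
  ⟨fun j hj hj' k hk => ((h.proj j hj hj' k).1 hk).2,
    fun j hj hj' k hk => ((h.inj j hj hj' k).1 hk).2⟩

variable [IsArtinianRing R] [Module.Finite R Λ]
  (hJ : IsInjectiveEnvelope R (R ⧸ Ring.jacobson R) J)
  (he : OrthogonalIdempotents e) {S : BlockSequence e} {τ : TorsionPair Λ} {X : ModuleCat.{u} Λ}

include hJ in
omit [Module.Finite R Λ] in
theorem Supports.smul_eq_zero_of_tors (h : Supports R J τ S) {j : ℕ} (hj : j ≤ S.m) (hodd : Odd j)
    (hX : τ.tors X) (hkill : KilledBy (S.stageIdeal j) X) {k : Fin n} (hk : k ∈ S.block j) (x : X) :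
    e k • x = 0 := by
  by_contra hne
  obtain ⟨g, hg⟩ := exists_hom_injAt_apply_ne_zero hJ hkill hne
  exact hg (LinearMap.congr_fun (τ.linearMap_eq_zero hX (h.inj j hj hodd k hk) g) x)

omit [IsArtinianRing R] [Module.Finite R Λ] in
theorem Supports.smul_eq_zero_of_free (h : Supports R J τ S) {j : ℕ} (hj : j ≤ S.m) (heven : Even j)
    (hX : τ.free X) (hkill : KilledBy (S.stageIdeal j) X) {k : Fin n} (hk : k ∈ S.block j) (x : X) :
    e k • x = 0 := by
  obtain ⟨g, hg⟩ := exists_hom_projAt (e k) hkill x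
  rw [← hg]
  exact LinearMap.congr_fun (τ.linearMap_eq_zero (h.proj j hj heven k hk) hX g) _

-- At an even step the perpendicular condition says that `X` is killed by the next ideal. At an odd
-- step nothing is imposed, and a torsion `X` is killed anyway because it has no maps to the
-- torsion-free injectives of that block.
include hJ he in
theorem Supports.torsStage_iff (h : Supports R J τ S) {j : ℕ} (hj : j ≤ S.m + 1) :
    torsStage S τ j X ↔ τ.tors X ∧ KilledBy (S.stageIdeal j) X := by
  induction j with
  | zero => exact ⟨fun h => ⟨h, BlockSequence.killedBy_stageIdeal_zero⟩, fun h => h.1⟩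
  | succ j ih =>
    rw [BlockSequence.killedBy_stageIdeal_succ he, ← and_assoc, ← ih (by omega)]
    refine and_congr_right fun hst => ?_
    obtain ⟨hX, hkill⟩ := (ih (by omega)).1 hst
    rcases Nat.even_or_odd j with hev | hodd
    · exact (forall_prop_of_true hev).trans (hom_pi_projAt_eq_zero_iff R he.idem hkill)
    · refine iff_of_true (fun hev => absurd hev (Nat.not_even_iff_odd.2 hodd)) fun k hk x => ?_
      exact h.smul_eq_zero_of_tors hJ (by omega) hodd hX hkill hk x

include hJ he in
theorem Supports.freeStage_iff (h : Supports R J τ S) {j : ℕ} (hj : j ≤ S.m + 1) :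
    freeStage R J S τ j X ↔ τ.free X ∧ KilledBy (S.stageIdeal j) X := by
  induction j with
  | zero => exact ⟨fun h => ⟨h, BlockSequence.killedBy_stageIdeal_zero⟩, fun h => h.1⟩
  | succ j ih =>
    rw [BlockSequence.killedBy_stageIdeal_succ he, ← and_assoc, ← ih (by omega)]
    refine and_congr_right fun hst => ?_
    obtain ⟨hX, hkill⟩ := (ih (by omega)).1 hst
    rcases Nat.even_or_odd j with hev | hodd
    · refine iff_of_true (fun hodd => absurd hev (Nat.not_even_iff_odd.2 hodd)) fun k hk x => ?_
      exact h.smul_eq_zero_of_free (by omega) hev hX hkill hk x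
    · exact (forall_prop_of_true hodd).trans (hom_pi_injAt_eq_zero_iff hJ he.idem hkill)

end Stages

/-! ### Splittings in terms of indices. -/

section Splitting

theorem addClosure_pi {Γ : Type u} [Ring Γ] {ι : Type} [DecidableEq ι] {M : ι → Type u}
    [∀ i, AddCommGroup (M i)] [∀ i, Module Γ (M i)] (i : ι) [Module.Finite Γ (M i)] :
    addClosure (∀ i, M i) (ModuleCat.of Γ (M i)) :=
  ⟨‹_›, 1, LinearMap.pi fun _ => LinearMap.single Γ M i, LinearMap.proj i ∘ₗ LinearMap.proj 0,
    LinearMap.ext fun x => Pi.single_eq_same (M := M) i x⟩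

variable {Λ : Type u} [Ring Λ] {n : ℕ} {e : Fin n → Λ}
  {R : Type u} [CommRing R] [Algebra R Λ] {J : Type u} [AddCommGroup J] [Module R J]
  [IsArtinianRing R] [Module.Finite R Λ]
  (hJ : IsInjectiveEnvelope R (R ⧸ Ring.jacobson R) J)
  {S : BlockSequence e} {ν : SplitData e} {τ : TorsionPair Λ} {X : ModuleCat.{u} Λ}

include hJ in
theorem IsSplitting.supports (h : IsSplitting R J τ ν) : Supports R J τ ν.S where
  proj j hj hev k hk := by
    let Y : ModuleCat (ν.S.StageAlg j) := ModuleCat.of _ (Ideal.span {ν.S.toStage j (e k)})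
    exact tors_of_torsStage ((h.proj j hj hev Y).2 (addClosure_pi
      (M := fun k : ν.S.block j => Ideal.span {ν.S.toStage j (e k)}) ⟨k, hk⟩)).1
  inj j hj hodd k hk := by
    let Y : ModuleCat (ν.S.StageAlg j) := ModuleCat.of _ (DualRightIdeal R J (ν.S.toStage j (e k)))
    have : Module.Finite (ν.S.StageAlg j) (DualRightIdeal R J (ν.S.toStage j (e k))) :=
      DualRightIdeal.finite hJ
    exact free_of_freeStage ((h.inj j hj hodd Y).2 (addClosure_pi
      (M := fun k : ν.S.block j => DualRightIdeal R J (ν.S.toStage j (e k))) ⟨k, hk⟩)).1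

theorem gen_of_addClosure {Γ : Type u} [Ring Γ] {M : Type u} [AddCommGroup M] [Module Γ M]
    {Y : ModuleCat.{u} Γ} (h : addClosure M Y) : Gen M Y := by
  obtain ⟨hfin, m, f, g, hgf⟩ := h
  exact ⟨hfin, m, g, fun y => ⟨f y, LinearMap.congr_fun hgf y⟩⟩

theorem cogen_of_addClosure {Γ : Type u} [Ring Γ] {M : Type u} [AddCommGroup M] [Module Γ M]
    {Y : ModuleCat.{u} Γ} (h : addClosure M Y) : Cogen M Y := by
  obtain ⟨hfin, m, f, g, hgf⟩ := h
  exact ⟨hfin, m, f, Function.LeftInverse.injective (LinearMap.congr_fun hgf)⟩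

theorem projGen_ne_zero {I : TwoSidedIdeal Λ} {a : Λ} (h : a ∉ I) : projGen I a ≠ 0 := by
  intro h0
  have := (smul_projGen_eq_zero_iff (I := I) (e := a) (a := 1)).1 (by rw [h0, smul_zero])
  exact h (by rwa [one_mul] at this)

include hJ in
omit [Module.Finite R Λ] in
theorem exists_smul_injAt_ne_zero {I : TwoSidedIdeal Λ} {a f x : Λ} (hx : f * x * a ∉ I) :
    ∃ y : injAt R J I f, a • y ≠ 0 := by
  let X : ModuleCat Λ := projAt I 1
  have hx' : f • (x * a) • projGen I 1 ≠ 0 := by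
    rw [smul_smul, ne_eq, smul_projGen_eq_zero_iff, mul_one, ← mul_assoc]
    exact hx
  obtain ⟨g, hg⟩ := exists_hom_injAt_apply_ne_zero hJ (killedBy_resQuot _) hx'
  refine ⟨g (projGen I 1), fun h => hg ?_⟩
  rw [map_smul, mul_smul, h, smul_zero]

-- Suppose `Λ_S^j (e k)` is torsion for a new `k` outside the block. Being projective, it lies in
-- `add P_j`, so it has no nonzero map to a `Λ_S^{j+1}`-module. But it surjects onto `Λ_S^{j+1} (e
-- k)`, which is nonzero. The injective case is dual.
include hJ in
theorem IsSplitting.determines (he : OrthogonalIdempotents e)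
    (hprim : ∀ k, IsPrimitiveIdempotent (e k)) (h : IsSplitting R J τ ν) :
    Determines R J τ ν.S where
  proj j hj hev k := by
    have hs := h.supports hJ
    refine ⟨fun hk => ⟨ν.S.notMem_upto hk, hs.proj j hj hev k hk⟩, fun ⟨hk, hT⟩ => ?_⟩
    by_contra hkb
    have hk' : e k ∉ ν.S.stageIdeal (j + 1) := by
      rw [BlockSequence.mem_stageIdeal_iff (R := R) he hprim, BlockSequence.upto_succ,
        Finset.mem_union]
      tauto
    let Y : ModuleCat (ν.S.StageAlg j) := ModuleCat.of _ (Ideal.span {ν.S.toStage j (e k)})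
    have hY : addClosure (ν.S.ProjSum j) Y := (h.proj j hj hev Y).1
      ⟨(hs.torsStage_iff hJ he (by omega)).2 ⟨hT, killedBy_resQuot Y⟩,
        projective_span ((he.idem k).map _)⟩
    have hgen := ((gen_map_iff (s := ν.S.block j) R he.idem).1
      (ObjectProperty.prop_map_obj _ (resQuot (ν.S.stageIdeal j)) (gen_of_addClosure hY))).2.2
    obtain ⟨g, hg⟩ := exists_surjective_projAt_of_le (he.idem k)
      (ν.S.stageIdeal_mono he (Nat.le_succ j))
    have h0 := eq_zero_of_genSub_eq_top hgen
      ((BlockSequence.killedBy_stageIdeal_succ he).1 (killedBy_resQuot _)).2 g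
    obtain ⟨x, hx⟩ := hg (projGen (ν.S.stageIdeal (j + 1)) (e k))
    exact projGen_ne_zero hk' (hx.symm.trans (LinearMap.congr_fun h0 x))
  inj j hj hodd k := by
    have hs := h.supports hJ
    refine ⟨fun hk => ⟨ν.S.notMem_upto hk, hs.inj j hj hodd k hk⟩, fun ⟨hk, hF⟩ => ?_⟩
    by_contra hkb
    have hk' : e k ∉ ν.S.stageIdeal (j + 1) := by
      rw [BlockSequence.mem_stageIdeal_iff (R := R) he hprim, BlockSequence.upto_succ,
        Finset.mem_union]
      tauto
    let Y : ModuleCat (ν.S.StageAlg j) := ModuleCat.of _ (DualRightIdeal R J (ν.S.toStage j (e k)))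
    have hY : addClosure (ν.S.InjSum R J j) Y := (h.inj j hj hodd Y).1
      ⟨(hs.freeStage_iff hJ he (by omega)).2 ⟨hF, killedBy_resQuot Y⟩,
        DualRightIdeal.injective hJ.1 ((he.idem k).map _)⟩
    have hcogen := ((cogen_map_iff (s := ν.S.block j) hJ he.idem).1
      (ObjectProperty.prop_map_obj _ (resQuot (ν.S.stageIdeal j)) (cogen_of_addClosure hY))).2.2
    obtain ⟨g, hg, -⟩ := exists_injective_injAt_of_le (R := R) (J := J) (he.idem k)
      (ν.S.stageIdeal_mono he (Nat.le_succ j))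
    have h0 := eq_zero_of_killSub_eq_bot hcogen
      ((BlockSequence.killedBy_stageIdeal_succ he).1 (killedBy_resQuot _)).2 g
    obtain ⟨y, hy⟩ := exists_smul_injAt_ne_zero hJ (I := ν.S.stageIdeal (j + 1)) (f := e k)
      (a := e k) (x := 1) (by rwa [mul_one, (he.idem k).eq])
    apply hy
    rw [hg ((LinearMap.congr_fun h0 y).trans (map_zero g).symm), smul_zero]

include hJ in
theorem IsSplitting.tors_iff (he : OrthogonalIdempotents e) (h : IsSplitting R J τ ν)
    (Y : ModuleCat.{u} (ν.S.StageAlg (ν.S.m + 1))) :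
    ν.pair.tors Y ↔ τ.tors ((ν.S.res (ν.S.m + 1)).obj Y) := by
  rw [h.tors_eq, (h.supports hJ).torsStage_iff hJ he le_rfl]
  exact and_iff_left (killedBy_resQuot Y)

include hJ in
theorem IsSplitting.free_iff (he : OrthogonalIdempotents e) (h : IsSplitting R J τ ν)
    (Y : ModuleCat.{u} (ν.S.StageAlg (ν.S.m + 1))) :
    ν.pair.free Y ↔ τ.free ((ν.S.res (ν.S.m + 1)).obj Y) := by
  rw [h.free_eq, (h.supports hJ).freeStage_iff hJ he le_rfl]
  exact and_iff_left (killedBy_resQuot Y)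

include hJ in
theorem isSplitting_of_determines (he : CompleteOrthogonalIdempotents e)
    (hprim : ∀ k, IsPrimitiveIdempotent (e k)) (h : Determines R J τ ν.S)
    (ht : ∀ Y, ν.pair.tors Y ↔ τ.tors ((ν.S.res (ν.S.m + 1)).obj Y))
    (hf : ∀ Y, ν.pair.free Y ↔ τ.free ((ν.S.res (ν.S.m + 1)).obj Y)) : IsSplitting R J τ ν where
  proj j hj hev Y := by
    rw [h.supports.torsStage_iff hJ he.toOrthogonalIdempotents (by omega),
      and_iff_left (killedBy_resQuot Y)]
    refine tors_projective_iff_addClosure R τ he.idem he.complete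
      (fun k => (hprim k).isLocalCorner (R := R)) (h.supports.proj j hj hev) (fun k hk hT => ?_) Y
    rw [BlockSequence.mem_stageIdeal_iff (R := R) he.toOrthogonalIdempotents hprim] at hk
    exact (h.proj j hj hev k).2 ⟨hk, hT⟩
  inj j hj hodd Y := by
    rw [h.supports.freeStage_iff hJ he.toOrthogonalIdempotents (by omega),
      and_iff_left (killedBy_resQuot Y)]
    refine free_injective_iff_addClosure hJ τ he.idem he.complete
      (fun k => (hprim k).isLocalCorner (R := R)) (h.supports.inj j hj hodd) (fun k hk hF => ?_) Y
    rw [BlockSequence.mem_stageIdeal_iff (R := R) he.toOrthogonalIdempotents hprim] at hk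
    exact (h.inj j hj hodd k).2 ⟨hk, hF⟩
  tors_eq Y := by
    rw [ht, h.supports.torsStage_iff hJ he.toOrthogonalIdempotents le_rfl,
      and_iff_left (killedBy_resQuot Y)]
  free_eq Y := by
    rw [hf, h.supports.freeStage_iff hJ he.toOrthogonalIdempotents le_rfl,
      and_iff_left (killedBy_resQuot Y)]

end Splitting

/-! ### Extension closures. -/

section Glue

variable {Λ : Type u} [Ring Λ] {n : ℕ} {e : Fin n → Λ}
  {R : Type u} [CommRing R] [Algebra R Λ] {J : Type u} [AddCommGroup J] [Module R J]
  {ν : SplitData e} {τ : TorsionPair Λ} {A X B : ModuleCat.{u} Λ}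

theorem ExtClosure.of_exact {C : ObjectProperty (ModuleCat.{u} Λ)} (f : A →ₗ[Λ] X) (g : X →ₗ[Λ] B)
    (hf : Function.Injective f) (hfg : Function.Exact f g) (hg : Function.Surjective g)
    (hA : ExtClosure C A) (hB : ExtClosure C B) : ExtClosure C X :=
  .ext A X B (ModuleCat.ofHom f) (ModuleCat.ofHom g) ⟨hf, hfg, hg⟩ hA hB

theorem ExtClosure.of_submodule {C : ObjectProperty (ModuleCat.{u} Λ)} (N : Submodule Λ X)
    (hN : ExtClosure C (ModuleCat.of Λ N)) (hQ : ExtClosure C (ModuleCat.of Λ (X ⧸ N))) :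
    ExtClosure C X :=
  .of_exact (A := ModuleCat.of Λ N) (B := ModuleCat.of Λ (X ⧸ N)) N.subtype N.mkQ
    N.injective_subtype (LinearMap.exact_subtype_mkQ N) N.mkQ_surjective hN hQ

theorem ExtClosure.iso {C : ObjectProperty (ModuleCat.{u} Λ)}
    (hC : ∀ X Y, Nonempty (X ≅ Y) → C X → C Y) {X Y : ModuleCat.{u} Λ} (E : X ≅ Y)
    (h : ExtClosure C X) : ExtClosure C Y := by
  induction h generalizing Y with
  | of X h => exact .of Y (hC X Y ⟨E⟩ h)
  | ext A X B f g hfg hA hB _ _ =>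
    obtain ⟨hf, hex, hg⟩ := hfg
    let E' := E.toLinearEquiv
    refine .of_exact (E'.toLinearMap ∘ₗ f.hom) (g.hom ∘ₗ E'.symm.toLinearMap)
      (E'.injective.comp hf) (fun y => ?_) (hg.comp E'.symm.surjective) hA hB
    refine (hex (E'.symm y)).trans ⟨?_, ?_⟩
    · rintro ⟨a, ha⟩
      exact ⟨a, by rw [LinearMap.comp_apply, ha]; exact E'.apply_symm_apply y⟩
    · rintro ⟨a, rfl⟩
      exact ⟨a, (E'.symm_apply_apply _).symm⟩

theorem ExtClosure.finite {C : ObjectProperty (ModuleCat.{u} Λ)}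
    (hC : ∀ X, C X → Module.Finite Λ X) (h : ExtClosure C X) : Module.Finite Λ X := by
  induction h with
  | of X h => exact hC X h
  | ext A X B f g hfg _ _ hA hB => exact Module.Finite.of_exact hfg.2.1 hfg.2.2

/-- Induction on the target for a source in `C`, then on the source: a map that vanishes after
composing to one end of an extension factors through the other end. -/
theorem ExtClosure.linearMap_eq_zero {C D : ObjectProperty (ModuleCat.{u} Λ)}
    (hCD : ∀ X Y, C X → D Y → ∀ f : X →ₗ[Λ] Y, f = 0) {X Y : ModuleCat.{u} Λ}
    (hX : ExtClosure C X) (hY : ExtClosure D Y) (f : X →ₗ[Λ] Y) : f = 0 := by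
  have h1 : ∀ X, C X → ∀ Y, ExtClosure D Y → ∀ f : X →ₗ[Λ] Y, f = 0 := by
    intro X hX Y hY
    induction hY with
    | of Y hY => exact hCD X Y hX hY
    | ext A Y B i p hip _ _ hA hB =>
      intro f
      have h2 := hB (p.hom ∘ₗ f)
      have hmem : ∀ x, f x ∈ LinearMap.range i.hom := fun x =>
        (hip.2.1 _).1 (LinearMap.congr_fun h2 x)
      let ψ : X →ₗ[Λ] A := (LinearEquiv.ofInjective i.hom hip.1).symm.toLinearMap ∘ₗ
        f.codRestrict _ hmem
      have h3 := hA ψ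
      ext x
      have h4 : LinearEquiv.ofInjective i.hom hip.1 (ψ x) = f.codRestrict _ hmem x :=
        LinearEquiv.apply_symm_apply _ _
      rw [h3, LinearMap.zero_apply, map_zero] at h4
      exact (congrArg Subtype.val h4).symm
  induction hX with
  | of X hX => exact h1 X hX Y hY f
  | ext A X B i p hip _ _ hA hB =>
    have h2 := hA (f ∘ₗ i.hom)
    have hker : LinearMap.ker p.hom ≤ LinearMap.ker f := by
      intro x hx
      obtain ⟨a, rfl⟩ := (hip.2.1 x).1 hx
      exact LinearMap.congr_fun h2 a
    let ψ : B →ₗ[Λ] Y := (LinearMap.ker p.hom).liftQ f hker ∘ₗ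
      (p.hom.quotKerEquivOfSurjective hip.2.2).symm
    have h3 := hB ψ
    ext x
    have h4 := LinearMap.congr_fun h3 (p.hom x)
    have h5 : (p.hom.quotKerEquivOfSurjective hip.2.2).symm (p.hom x) =
        Submodule.Quotient.mk x := by
      rw [LinearEquiv.symm_apply_eq]
      rfl
    rw [LinearMap.comp_apply, LinearEquiv.coe_coe, h5] at h4
    exact h4

theorem TorsionPair.tors_of_extClosure {C : ObjectProperty (ModuleCat.{u} Λ)}
    (hC : ∀ X, C X → τ.tors X) (h : ExtClosure C X) : τ.tors X :=
  τ.tors_of_forall (h.finite fun X hX => τ.tors_finite X (hC X hX)) fun _ hY f =>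
    h.linearMap_eq_zero (fun X _ hX hY => τ.linearMap_eq_zero (hC X hX) hY)
      (ExtClosure.of (C := τ.free) _ hY) f

theorem TorsionPair.free_of_extClosure {C : ObjectProperty (ModuleCat.{u} Λ)}
    (hC : ∀ X, C X → τ.free X) (h : ExtClosure C X) : τ.free X :=
  τ.free_of_forall (h.finite fun X hX => τ.free_finite X (hC X hX)) fun Y hY f =>
    (ExtClosure.of (C := τ.tors) Y hY).linearMap_eq_zero
      (fun _ Y hX hY => τ.linearMap_eq_zero hX (hC Y hY)) h f

end Glue

/-! ### The glued torsion pair. -/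

section GluedPair

variable {Λ : Type u} [Ring Λ] {n : ℕ} {e : Fin n → Λ}
  {R : Type u} [CommRing R] [Algebra R Λ] {J : Type u} [AddCommGroup J] [Module R J]
  {ν : SplitData e} {τ : TorsionPair Λ} {X Y : ModuleCat.{u} Λ}

theorem BlockSequence.smul_eq_zero_of_killedBy {S : BlockSequence e} (he : OrthogonalIdempotents e)
    {i j : ℕ} (hij : i < j) (hX : KilledBy (S.stageIdeal j) X) {k : Fin n} (hk : k ∈ S.block i)
    (x : X) : e k • x = 0 := by
  rw [S.stageIdeal_eq] at hX
  exact hX _ (mem_idemIdeal he (S.block_subset_upto hij hk)) x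

theorem gluedTors_iso (E : X ≃ₗ[Λ] Y) (h : gluedTors ν X) : gluedTors ν Y := by
  refine ExtClosure.iso (fun X Y hXY h => ?_) E.toModuleIso h
  rcases h with ⟨j, hj, hev, Z, hZ, hZX⟩ | ⟨Z, hZ, hZX⟩
  · exact .inl ⟨j, hj, hev, Z, hZ, hZX.map2 Iso.trans hXY⟩
  · exact .inr ⟨Z, hZ, hZX.map2 Iso.trans hXY⟩

theorem gluedFree_iso (E : X ≃ₗ[Λ] Y) (h : gluedFree R J ν X) : gluedFree R J ν Y := by
  refine ExtClosure.iso (fun X Y hXY h => ?_) E.toModuleIso h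
  rcases h with ⟨j, hj, hev, Z, hZ, hZX⟩ | ⟨Z, hZ, hZX⟩
  · exact .inl ⟨j, hj, hev, Z, hZ, hZX.map2 Iso.trans hXY⟩
  · exact .inr ⟨Z, hZ, hZX.map2 Iso.trans hXY⟩

theorem gluedTors_of_pair {Y : ModuleCat.{u} (ν.S.StageAlg (ν.S.m + 1))} (hY : ν.pair.tors Y)
    (E : (ν.S.res (ν.S.m + 1)).obj Y ≃ₗ[Λ] X) : gluedTors ν X :=
  .of _ (.inr ⟨Y, hY, ⟨E.toModuleIso⟩⟩)

theorem gluedFree_of_pair {Y : ModuleCat.{u} (ν.S.StageAlg (ν.S.m + 1))} (hY : ν.pair.free Y)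
    (E : (ν.S.res (ν.S.m + 1)).obj Y ≃ₗ[Λ] X) : gluedFree R J ν X :=
  .of _ (.inr ⟨Y, hY, ⟨E.toModuleIso⟩⟩)

variable [IsArtinianRing R] [Module.Finite R Λ]
  (hJ : IsInjectiveEnvelope R (R ⧸ Ring.jacobson R) J) (he : OrthogonalIdempotents e)

variable (R) in
include R in
omit [IsArtinianRing R] in
theorem gluedTors_of_genSub_eq_top (hid : ∀ k, IsIdempotentElem (e k)) {j : ℕ} (hj : j ≤ ν.S.m)
    (hev : Even j) (hfin : Module.Finite Λ X) (hX : KilledBy (ν.S.stageIdeal j) X)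
    (htop : genSub e (ν.S.block j) X = ⊤) : gluedTors ν X :=
  .of _ (.inl ⟨j, hj, hev, (gen_map_iff R hid).2 ⟨hfin, hX, htop⟩⟩)

include hJ in
theorem gluedFree_of_killSub_eq_bot (hid : ∀ k, IsIdempotentElem (e k)) {j : ℕ} (hj : j ≤ ν.S.m)
    (hodd : Odd j) (hfin : Module.Finite Λ X) (hX : KilledBy (ν.S.stageIdeal j) X)
    (hbot : killSub e (ν.S.block j) X = ⊥) : gluedFree R J ν X :=
  .of _ (.inl ⟨j, hj, hodd, (cogen_map_iff hJ hid).2 ⟨hfin, hX, hbot⟩⟩)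

-- Induction on the number `d` of remaining stages. At even `j` the trace lies in `Gen P_j`, and the
-- quotient by it is torsion and moves on to stage `j + 1`; at odd `j` the module itself is already
-- a module over stage `j + 1`.
include hJ he in
theorem Supports.gluedTors_of_tors (hs : Supports R J τ ν.S)
    (ht : ∀ Y, ν.pair.tors Y ↔ τ.tors ((ν.S.res (ν.S.m + 1)).obj Y)) (d j : ℕ)
    (hd : j + d = ν.S.m + 1) (hX : τ.tors X) (hkill : KilledBy (ν.S.stageIdeal j) X) :
    gluedTors ν X := by
  induction d generalizing j X with
  | zero =>
    obtain rfl : j = ν.S.m + 1 := hd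
    obtain ⟨Y, ⟨E⟩⟩ := hkill.exists_resQuot
    exact gluedTors_of_pair ((ht Y).2 (τ.tors_equiv E.symm hX)) E
  | succ d ih =>
    rcases Nat.even_or_odd j with hev | hodd
    · have : IsNoetherianRing Λ := IsNoetherianRing.of_finite R Λ
      have := τ.tors_finite X hX
      have hN := hkill.of_injective (X := ModuleCat.of Λ (genSub e (ν.S.block j) X))
        (genSub e (ν.S.block j) X).subtype (Submodule.injective_subtype _)
      have hQ := hkill.of_surjective (Y := ModuleCat.of Λ (X ⧸ genSub e (ν.S.block j) X))
        (genSub e (ν.S.block j) X).mkQ (Submodule.mkQ_surjective _)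
      refine ExtClosure.of_submodule (genSub e (ν.S.block j) X) ?_ ?_
      · exact gluedTors_of_genSub_eq_top R he.idem (by omega) hev
          (inferInstanceAs (Module.Finite Λ (genSub e (ν.S.block j) X))) hN (genSub_genSub he.idem)
      · refine ih (j + 1) (by omega) (τ.tors_of_surjective hX _ (Submodule.mkQ_surjective _)) ?_
        exact (BlockSequence.killedBy_stageIdeal_succ he).2
          ⟨hQ, fun k hk => smul_quotient_genSub hk⟩
    · refine ih (j + 1) (by omega) hX ((BlockSequence.killedBy_stageIdeal_succ he).2 ⟨hkill, ?_⟩)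
      exact fun k hk => hs.smul_eq_zero_of_tors hJ (by omega) hodd hX hkill hk

include hJ he in
theorem Supports.gluedFree_of_free (hs : Supports R J τ ν.S)
    (hf : ∀ Y, ν.pair.free Y ↔ τ.free ((ν.S.res (ν.S.m + 1)).obj Y)) (d j : ℕ)
    (hd : j + d = ν.S.m + 1) (hX : τ.free X) (hkill : KilledBy (ν.S.stageIdeal j) X) :
    gluedFree R J ν X := by
  induction d generalizing j X with
  | zero =>
    obtain rfl : j = ν.S.m + 1 := hd
    obtain ⟨Y, ⟨E⟩⟩ := hkill.exists_resQuot
    exact gluedFree_of_pair ((hf Y).2 (τ.free_equiv E.symm hX)) E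
  | succ d ih =>
    rcases Nat.even_or_odd j with hev | hodd
    · refine ih (j + 1) (by omega) hX ((BlockSequence.killedBy_stageIdeal_succ he).2 ⟨hkill, ?_⟩)
      exact fun k hk => hs.smul_eq_zero_of_free (by omega) hev hX hkill hk
    · have : IsNoetherianRing Λ := IsNoetherianRing.of_finite R Λ
      have := τ.free_finite X hX
      have hN := hkill.of_injective (X := ModuleCat.of Λ (killSub e (ν.S.block j) X))
        (killSub e (ν.S.block j) X).subtype (Submodule.injective_subtype _)
      have hQ := hkill.of_surjective (Y := ModuleCat.of Λ (X ⧸ killSub e (ν.S.block j) X))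
        (killSub e (ν.S.block j) X).mkQ (Submodule.mkQ_surjective _)
      refine ExtClosure.of_submodule (killSub e (ν.S.block j) X) ?_ ?_
      · refine ih (j + 1) (by omega)
          (τ.free_of_injective hX (Submodule.subtype _) (Submodule.injective_subtype _)) ?_
        exact (BlockSequence.killedBy_stageIdeal_succ he).2 ⟨hN, fun k hk => smul_killSub hk⟩
      · exact gluedFree_of_killSub_eq_bot hJ he.idem (by omega) hodd
          (inferInstanceAs (Module.Finite Λ (X ⧸ killSub e (ν.S.block j) X))) hQ
          (killSub_quotient he.idem)

include he in
omit [IsArtinianRing R] in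
theorem Supports.tors_of_gluedTors (hs : Supports R J τ ν.S)
    (ht : ∀ Y, ν.pair.tors Y ↔ τ.tors ((ν.S.res (ν.S.m + 1)).obj Y)) (hX : gluedTors ν X) :
    τ.tors X := by
  refine TorsionPair.tors_of_extClosure (fun X hX => ?_) hX
  rcases hX with ⟨j, hj, hev, hX⟩ | ⟨Y, hY, ⟨E⟩⟩
  · obtain ⟨hfin, hkill, htop⟩ := (gen_map_iff R he.idem).1 hX
    exact tors_of_genSub_eq_top τ hkill hfin (hs.proj j hj hev) htop
  · exact τ.tors_iso _ _ ⟨E⟩ ((ht Y).1 hY)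

include hJ he in
theorem Supports.free_of_gluedFree (hs : Supports R J τ ν.S)
    (hf : ∀ Y, ν.pair.free Y ↔ τ.free ((ν.S.res (ν.S.m + 1)).obj Y)) (hX : gluedFree R J ν X) :
    τ.free X := by
  refine TorsionPair.free_of_extClosure (fun X hX => ?_) hX
  rcases hX with ⟨j, hj, hodd, hX⟩ | ⟨Y, hY, ⟨E⟩⟩
  · obtain ⟨hfin, hkill, hbot⟩ := (cogen_map_iff hJ he.idem).1 hX
    exact free_of_killSub_eq_bot hJ τ hkill hfin (hs.inj j hj hodd) hbot
  · exact τ.free_iso _ _ ⟨E⟩ ((hf Y).1 hY)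

include hJ he in
theorem IsSplitting.eq_glued (h : IsSplitting R J τ ν) :
    τ.tors = gluedTors ν ∧ τ.free = gluedFree R J ν := by
  have hs := h.supports hJ
  constructor
  · funext X
    exact propext ⟨fun hX => hs.gluedTors_of_tors hJ he (h.tors_iff hJ he) (ν.S.m + 1) 0
      (zero_add _) hX BlockSequence.killedBy_stageIdeal_zero,
        hs.tors_of_gluedTors he (h.tors_iff hJ he)⟩
  · funext X
    exact propext ⟨fun hX => hs.gluedFree_of_free hJ he (h.free_iff hJ he) (ν.S.m + 1) 0
      (zero_add _) hX BlockSequence.killedBy_stageIdeal_zero,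
        hs.free_of_gluedFree hJ he (h.free_iff hJ he)⟩

-- Of two layers from different stages, the one of larger index is annihilated by the idempotents of
-- the earlier block, while the other is generated or detected by them. Two layers from the last
-- stage are orthogonal by the given pair.
include hJ he in
theorem glued_linearMap_eq_zero (hX : gluedTors ν X) (hY : gluedFree R J ν Y) (f : X →ₗ[Λ] Y) :
    f = 0 := by
  refine ExtClosure.linearMap_eq_zero (fun X Y hX hY f => ?_) hX hY f
  rcases hX with ⟨j, hj, hev, hX⟩ | ⟨X', hX', ⟨EX⟩⟩
  · obtain ⟨-, hXk, htop⟩ := (gen_map_iff R he.idem).1 hX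
    rcases hY with ⟨i, hi, hodd, hY⟩ | ⟨Y', hY', ⟨EY⟩⟩
    · obtain ⟨-, hYk, hbot⟩ := (cogen_map_iff hJ he.idem).1 hY
      rcases lt_trichotomy i j with hij | rfl | hij
      · exact eq_zero_of_killSub_eq_bot hbot
          (fun k hk => BlockSequence.smul_eq_zero_of_killedBy he hij hXk hk) f
      · exact absurd hev (Nat.not_even_iff_odd.2 hodd)
      · exact eq_zero_of_genSub_eq_top htop
          (fun k hk => BlockSequence.smul_eq_zero_of_killedBy he hij hYk hk) f
    · have hYk := (killedBy_resQuot Y').of_surjective EY.toLinearEquiv.toLinearMap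
        EY.toLinearEquiv.surjective
      exact eq_zero_of_genSub_eq_top htop
        (fun k hk => BlockSequence.smul_eq_zero_of_killedBy he (Nat.lt_succ_of_le hj) hYk hk) f
  · rcases hY with ⟨i, hi, hodd, hY⟩ | ⟨Y', hY', ⟨EY⟩⟩
    · obtain ⟨-, hYk, hbot⟩ := (cogen_map_iff hJ he.idem).1 hY
      have hXk := (killedBy_resQuot X').of_surjective EX.toLinearEquiv.toLinearMap
        EX.toLinearEquiv.surjective
      exact eq_zero_of_killSub_eq_bot hbot
        (fun k hk => BlockSequence.smul_eq_zero_of_killedBy he (Nat.lt_succ_of_le hi) hXk hk) f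
    · have h := ν.pair.linearMap_eq_zero hX' hY' (unresMap
        (EY.toLinearEquiv.symm.toLinearMap ∘ₗ f ∘ₗ EX.toLinearEquiv.toLinearMap))
      ext x
      obtain ⟨x, rfl⟩ := EX.toLinearEquiv.surjective x
      exact (LinearEquiv.map_eq_zero_iff EY.toLinearEquiv.symm).1 (LinearMap.congr_fun h x)

-- Constructs canonical sequences by descending through the stages; only the last stage uses the
-- given pair.
include hJ he in
theorem exists_glued_submodule (d j : ℕ) (hd : j + d = ν.S.m + 1) (hfin : Module.Finite Λ X)
    (hkill : KilledBy (ν.S.stageIdeal j) X) :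
    ∃ N : Submodule Λ X, gluedTors ν (ModuleCat.of Λ N) ∧
      gluedFree R J ν (ModuleCat.of Λ (X ⧸ N)) := by
  have hnoeth : IsNoetherianRing Λ := IsNoetherianRing.of_finite R Λ
  induction d generalizing j X with
  | zero =>
    obtain rfl : j = ν.S.m + 1 := hd
    obtain ⟨Y, ⟨E⟩⟩ := hkill.exists_resQuot
    have hY : Module.Finite _ Y := (finite_resQuot_iff Y).1 (Module.Finite.equiv E.symm)
    obtain ⟨A, B, f, g, ⟨hf, hfg, hg⟩, hA, hB⟩ := ν.pair.exists_shortExact Y hY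
    let p : X →ₗ[Λ] (resQuot _).obj B := resMap g.hom ∘ₗ E.symm.toLinearMap
    let i : (resQuot _).obj A →ₗ[Λ] X := E.toLinearMap ∘ₗ resMap f.hom
    have hi : Function.Injective i := E.injective.comp hf
    have hp : Function.Surjective p := hg.comp E.symm.surjective
    have hker : LinearMap.range i = LinearMap.ker p := by
      ext x
      refine Iff.trans ?_ (hfg (E.symm x)).symm
      constructor
      · rintro ⟨a, rfl⟩
        exact ⟨a, (E.symm_apply_apply _).symm⟩
      · rintro ⟨a, ha⟩
        exact ⟨a, (congrArg E ha).trans (E.apply_symm_apply x)⟩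
    refine ⟨LinearMap.ker p, ?_, ?_⟩
    · rw [← hker]
      exact gluedTors_of_pair hA (LinearEquiv.ofInjective i hi)
    · exact gluedFree_of_pair hB (p.quotKerEquivOfSurjective hp).symm
  | succ d ih =>
    rcases Nat.even_or_odd j with hev | hodd
    -- The torsion part is the preimage of the torsion part `K` of `X ⧸ N`, an extension of `K` by
    -- the trace.
    · let N := genSub e (ν.S.block j) X
      have hN := hkill.of_injective (X := ModuleCat.of Λ N) N.subtype N.injective_subtype
      have hQ := hkill.of_surjective (Y := ModuleCat.of Λ (X ⧸ N)) N.mkQ N.mkQ_surjective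
      have hNg : gluedTors ν (ModuleCat.of Λ N) := gluedTors_of_genSub_eq_top R he.idem (by omega)
        hev (inferInstanceAs (Module.Finite Λ N)) hN (genSub_genSub he.idem)
      obtain ⟨K, hK, hKQ⟩ := ih (X := ModuleCat.of Λ (X ⧸ N)) (j + 1) (by omega)
        (inferInstanceAs (Module.Finite Λ (X ⧸ N)))
        ((BlockSequence.killedBy_stageIdeal_succ he).2
          ⟨hQ, fun k hk => smul_quotient_genSub hk⟩)
      let p : X →ₗ[Λ] (X ⧸ N) ⧸ K := K.mkQ ∘ₗ N.mkQ
      have hp : Function.Surjective p := K.mkQ_surjective.comp N.mkQ_surjective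
      have hmem : ∀ x, x ∈ LinearMap.ker p ↔ N.mkQ x ∈ K := fun x =>
        Submodule.Quotient.mk_eq_zero K
      have hle : N ≤ LinearMap.ker p := fun x hx => (hmem x).2 (by
        rw [Submodule.mkQ_apply, (Submodule.Quotient.mk_eq_zero N).2 hx]
        exact K.zero_mem)
      refine ⟨LinearMap.ker p, ?_, ?_⟩
      · refine ExtClosure.of_exact (A := ModuleCat.of Λ N) (X := ModuleCat.of Λ (LinearMap.ker p))
          (B := ModuleCat.of Λ K) (Submodule.inclusion hle)
          (N.mkQ.restrict fun x hx => (hmem x).1 hx) (Submodule.inclusion_injective hle)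
          ?_ ?_ hNg hK
        · intro x
          constructor
          · intro hx
            exact ⟨⟨x.1, (Submodule.Quotient.mk_eq_zero N).1 (congrArg Subtype.val hx)⟩, rfl⟩
          · rintro ⟨a, rfl⟩
            exact Subtype.ext ((Submodule.Quotient.mk_eq_zero N).2 a.2)
        · rintro ⟨y, hy⟩
          obtain ⟨x, rfl⟩ := N.mkQ_surjective y
          exact ⟨⟨x, (hmem x).2 hy⟩, rfl⟩
      · exact gluedFree_iso (p.quotKerEquivOfSurjective hp).symm hKQ
    -- The torsion part is that of the reject `N`; the remaining quotient is an extension of `X ⧸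
    -- N`, which lies in `Cogen`, by a glued torsion-free module.
    · let N := killSub e (ν.S.block j) X
      have hN := hkill.of_injective (X := ModuleCat.of Λ N) N.subtype N.injective_subtype
      have hQ := hkill.of_surjective (Y := ModuleCat.of Λ (X ⧸ N)) N.mkQ N.mkQ_surjective
      have hQg : gluedFree R J ν (ModuleCat.of Λ (X ⧸ N)) := gluedFree_of_killSub_eq_bot hJ he.idem
        (by omega) hodd (inferInstanceAs (Module.Finite Λ (X ⧸ N))) hQ (killSub_quotient he.idem)
      obtain ⟨K, hK, hKQ⟩ := ih (X := ModuleCat.of Λ N) (j + 1) (by omega)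
        (inferInstanceAs (Module.Finite Λ N))
        ((BlockSequence.killedBy_stageIdeal_succ he).2 ⟨hN, fun k hk => smul_killSub hk⟩)
      let K' : Submodule Λ N := K
      let M : Submodule Λ X := K'.map N.subtype
      have hM : M ≤ N := Submodule.map_subtype_le N K'
      have hmem : ∀ x : N, (x : X) ∈ M ↔ x ∈ K' := by
        intro x
        constructor
        · rintro ⟨y, hy, hyx⟩
          rwa [← show y = x from Subtype.ext hyx]
        · exact fun hx => ⟨x, hx, rfl⟩
      refine ⟨M, ?_, ?_⟩
      · exact gluedTors_iso (Y := ModuleCat.of Λ M)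
          (Submodule.equivMapOfInjective N.subtype N.injective_subtype K') hK
      · refine ExtClosure.of_exact (A := ModuleCat.of Λ (N ⧸ K')) (X := ModuleCat.of Λ (X ⧸ M))
          (B := ModuleCat.of Λ (X ⧸ N)) (K'.mapQ M N.subtype fun x hx => (hmem x).2 hx)
          (Submodule.factor hM) ?_ ?_ (Submodule.factor_surjective hM) hKQ hQg
        · rw [← LinearMap.ker_eq_bot, LinearMap.ker_eq_bot']
          intro x hx
          obtain ⟨x, rfl⟩ := K'.mkQ_surjective x
          rw [Submodule.mkQ_apply, Submodule.Quotient.mk_eq_zero, ← hmem]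
          exact (Submodule.Quotient.mk_eq_zero M).1 hx
        · intro x
          obtain ⟨x, rfl⟩ := M.mkQ_surjective x
          constructor
          · intro hx
            have hx' : x ∈ N := (Submodule.Quotient.mk_eq_zero N).1 hx
            exact ⟨Submodule.Quotient.mk ⟨x, hx'⟩, rfl⟩
          · rintro ⟨a, ha⟩
            obtain ⟨a, rfl⟩ := K'.mkQ_surjective a
            rw [← ha]
            exact (Submodule.Quotient.mk_eq_zero N).2 a.2

/-- The torsion pair glued from a 1-type part partition and a torsion pair on the last stage. -/
def gluedPair (hJ : IsInjectiveEnvelope R (R ⧸ Ring.jacobson R) J) (he : OrthogonalIdempotents e)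
    (ν : SplitData e) : TorsionPair Λ where
  tors := gluedTors ν
  free := gluedFree R J ν
  tors_finite X hX := by
    refine ExtClosure.finite (fun X hX => ?_) hX
    rcases hX with ⟨j, hj, hev, hX⟩ | ⟨Y, hY, ⟨E⟩⟩
    · exact ((gen_map_iff R he.idem).1 hX).1
    · have := (finite_resQuot_iff Y).2 (ν.pair.tors_finite Y hY)
      exact Module.Finite.equiv E.toLinearEquiv
  free_finite X hX := by
    refine ExtClosure.finite (fun X hX => ?_) hX
    rcases hX with ⟨j, hj, hodd, hX⟩ | ⟨Y, hY, ⟨E⟩⟩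
    · exact ((cogen_map_iff hJ he.idem).1 hX).1
    · have := (finite_resQuot_iff Y).2 (ν.pair.free_finite Y hY)
      exact Module.Finite.equiv E.toLinearEquiv
  tors_iso X Y := fun ⟨E⟩ hX => gluedTors_iso E.toLinearEquiv hX
  free_iso X Y := fun ⟨E⟩ hX => gluedFree_iso E.toLinearEquiv hX
  hom_eq_zero X Y hX hY f := by
    ext1
    exact glued_linearMap_eq_zero hJ he hX hY f.hom
  exists_shortExact X hX := by
    obtain ⟨N, hN, hQ⟩ := exists_glued_submodule (ν := ν) hJ he (ν.S.m + 1) 0 (zero_add _) hX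
      BlockSequence.killedBy_stageIdeal_zero
    exact ⟨ModuleCat.of Λ N, ModuleCat.of Λ (X ⧸ N), ModuleCat.ofHom N.subtype,
      ModuleCat.ofHom N.mkQ, ⟨N.injective_subtype, LinearMap.exact_subtype_mkQ N,
        N.mkQ_surjective⟩, hN, hQ⟩

end GluedPair

/-! ### Moving standard modules between consecutive stages. -/

section StandardModuleSteps

variable {Λ : Type u} [Ring Λ] {n : ℕ} {e : Fin n → Λ} {s : Finset (Fin n)} {k l : Fin n}
  {I I' : TwoSidedIdeal Λ} {τ : TorsionPair Λ}

theorem tors_projAt_of_le (hid : IsIdempotentElem (e k)) (h : I ≤ I')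
    (hk : τ.tors (projAt I (e k))) : τ.tors (projAt I' (e k)) := by
  obtain ⟨g, hg⟩ := exists_surjective_projAt_of_le hid h
  exact τ.tors_of_surjective hk g hg

/-- By `hI` the quotient of `(Λ/I) (e k)` by the trace is a `Λ/I'`-module, hence a quotient of
`(Λ/I') (e k)`. So torsion lifts from `I'` back to `I` as soon as the trace is torsion. -/
theorem tors_projAt_of_genSub (hid : IsIdempotentElem (e k))
    (hI : ∀ X : ModuleCat.{u} Λ, KilledBy I X → (∀ l ∈ s, ∀ x : X, e l • x = 0) → KilledBy I' X)
    (hN : τ.tors (ModuleCat.of Λ (genSub e s (projAt I (e k)))))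
    (hk : τ.tors (projAt I' (e k))) : τ.tors (projAt I (e k)) := by
  let X := projAt I (e k)
  let N := genSub e s X
  have hQ : KilledBy I' (ModuleCat.of Λ (X ⧸ N)) :=
    hI _ ((killedBy_resQuot _).of_surjective (X := X) N.mkQ N.mkQ_surjective)
      fun l hl => smul_quotient_genSub hl
  obtain ⟨g, hg⟩ := exists_hom_projAt (e k) hQ (N.mkQ (projGen I (e k)))
  have hgs : Function.Surjective g := by
    intro y
    obtain ⟨x, rfl⟩ := N.mkQ_surjective y
    obtain ⟨a, rfl⟩ := exists_smul_projGen x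
    refine ⟨a • projGen I' (e k), ?_⟩
    rw [map_smul, hg, map_smul]
    congr 1
    exact (map_smul N.mkQ _ _).symm.trans (congrArg _ (smul_projGen hid))
  have hfin : Module.Finite Λ X := inferInstance
  exact τ.tors_of_exact (A := ModuleCat.of Λ N) (B := ModuleCat.of Λ (X ⧸ N)) (f := N.subtype)
    (g := N.mkQ) (fun x hx => ⟨⟨x, (Submodule.Quotient.mk_eq_zero N).1 hx⟩, rfl⟩)
    N.mkQ_surjective hfin hN (τ.tors_of_surjective hk g hgs)

theorem tors_projAt_of_step [IsNoetherianRing Λ] (hid : ∀ k, IsIdempotentElem (e k))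
    (hI : ∀ X : ModuleCat.{u} Λ, KilledBy I X → (∀ l ∈ s, ∀ x : X, e l • x = 0) → KilledBy I' X)
    (hs : ∀ l ∈ s, τ.tors (projAt I (e l)))
    (hk : τ.tors (projAt I' (e k))) : τ.tors (projAt I (e k)) := by
  refine tors_projAt_of_genSub (hid k) hI ?_ hk
  have hkill := (killedBy_resQuot _).of_injective
    (X := ModuleCat.of Λ (genSub e s (projAt I (e k)))) (Y := projAt I (e k))
    (genSub e s (projAt I (e k))).subtype (Submodule.injective_subtype _)
  exact tors_of_genSub_eq_top τ hkill
    (inferInstanceAs (Module.Finite Λ (genSub e s (projAt I (e k))))) hs (genSub_genSub hid)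

theorem tors_projAt_of_forall_mul_mem (hid : IsIdempotentElem (e k))
    (hI : ∀ X : ModuleCat.{u} Λ, KilledBy I X → (∀ l ∈ s, ∀ x : X, e l • x = 0) → KilledBy I' X)
    (hs : ∀ l ∈ s, ∀ a, e l * a * e k ∈ I)
    (hk : τ.tors (projAt I' (e k))) : τ.tors (projAt I (e k)) := by
  refine tors_projAt_of_genSub hid hI ?_ hk
  have hbot : genSub e s (projAt I (e k)) = ⊥ := by
    rw [eq_bot_iff, genSub, Submodule.span_le]
    rintro _ ⟨l, hl, x, rfl⟩
    obtain ⟨a, rfl⟩ := exists_smul_projGen x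
    rw [smul_smul]
    exact smul_projGen_eq_zero_iff.2 (hs l hl a)
  rw [hbot]
  exact τ.tors_of_subsingleton (ModuleCat.of Λ (⊥ : Submodule Λ (projAt I (e k))))

variable {R : Type u} [CommRing R] [Algebra R Λ] {J : Type u} [AddCommGroup J] [Module R J]

theorem free_injAt_of_le [IsNoetherianRing Λ] (hid : IsIdempotentElem (e k)) (h : I ≤ I')
    (hk : τ.free (injAt R J I (e k))) : τ.free (injAt R J I' (e k)) := by
  obtain ⟨i, hi, -⟩ := exists_injective_injAt_of_le (R := R) (J := J) hid h
  exact τ.free_of_injective hk i hi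

variable [IsArtinianRing R] (hJ : IsInjectiveEnvelope R (R ⧸ Ring.jacobson R) J)

-- A nonzero `e l * a * e k` modulo `I` would give a nonzero map from `(Λ/I) (e k)` to `D(e l
-- (Λ/I))`.
include hJ in
theorem mul_mem_of_tors_of_free (hk : τ.tors (projAt I (e k))) (hl : τ.free (injAt R J I (e l)))
    (a : Λ) : e l * a * e k ∈ I := by
  by_contra h
  have h' : e l • a • projGen I (e k) ≠ 0 := by
    rwa [smul_smul, ne_eq, smul_projGen_eq_zero_iff]
  obtain ⟨g, hg⟩ := exists_hom_injAt_apply_ne_zero hJ (killedBy_resQuot _) h'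
  exact hg (LinearMap.congr_fun (τ.linearMap_eq_zero hk hl g) _)

include hJ in
theorem mem_of_tors_of_free (hid : IsIdempotentElem (e k)) (hk : τ.tors (projAt I (e k)))
    (hk' : τ.free (injAt R J I (e k))) : e k ∈ I := by
  have := mul_mem_of_tors_of_free hJ hk hk' 1
  rwa [mul_one, hid.eq] at this

variable [Module.Finite R Λ]

-- The reject is killed by `I'`, so it lies in the copy of `D(e k (Λ/I'))` inside `D(e k (Λ/I))`.
include hJ in
theorem free_injAt_of_killSub (hid : IsIdempotentElem (e k)) (h : I ≤ I')
    (hI : ∀ X : ModuleCat.{u} Λ, KilledBy I X → (∀ l ∈ s, ∀ x : X, e l • x = 0) → KilledBy I' X)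
    (hQ : τ.free (ModuleCat.of Λ (injAt R J I (e k) ⧸ killSub e s (injAt R J I (e k)))))
    (hk : τ.free (injAt R J I' (e k))) : τ.free (injAt R J I (e k)) := by
  have : IsNoetherianRing Λ := IsNoetherianRing.of_finite R Λ
  let X := injAt R J I (e k)
  let N := killSub e s X
  have hN : KilledBy I' (ModuleCat.of Λ N) :=
    hI _ ((killedBy_resQuot _).of_injective (Y := X) N.subtype N.injective_subtype)
      fun l hl => smul_killSub hl
  obtain ⟨i, hi, hir⟩ := exists_injective_injAt_of_le (R := R) (J := J) hid h
  have hmem : ∀ y : N, N.subtype y ∈ LinearMap.range i := fun y =>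
    hir _ fun a ha => congrArg Subtype.val (hN a ha y)
  let g : N →ₗ[Λ] injAt R J I' (e k) := (LinearEquiv.ofInjective i hi).symm.toLinearMap ∘ₗ
    N.subtype.codRestrict _ hmem
  have hg : Function.Injective g :=
    (LinearEquiv.ofInjective i hi).symm.injective.comp
      (f := N.subtype.codRestrict (LinearMap.range i) hmem) fun x y hxy =>
        Subtype.ext (congrArg (fun z : LinearMap.range i => z.1) hxy)
  have hfin : Module.Finite Λ X := finite_injAt hJ
  exact τ.free_of_exact (A := ModuleCat.of Λ N) (B := ModuleCat.of Λ (X ⧸ N)) (f := N.subtype)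
    (g := N.mkQ) N.injective_subtype
    (fun x hx => ⟨⟨x, (Submodule.Quotient.mk_eq_zero N).1 hx⟩, rfl⟩) hfin
    (τ.free_of_injective (X := ModuleCat.of Λ N) hk g hg) hQ

include hJ in
theorem free_injAt_of_step (hid : ∀ k, IsIdempotentElem (e k)) (h : I ≤ I')
    (hI : ∀ X : ModuleCat.{u} Λ, KilledBy I X → (∀ l ∈ s, ∀ x : X, e l • x = 0) → KilledBy I' X)
    (hs : ∀ l ∈ s, τ.free (injAt R J I (e l)))
    (hk : τ.free (injAt R J I' (e k))) : τ.free (injAt R J I (e k)) := by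
  refine free_injAt_of_killSub hJ (hid k) h hI ?_ hk
  have : Module.Finite Λ (injAt R J I (e k)) := finite_injAt hJ
  have hkill := (killedBy_resQuot _).of_surjective
    (X := injAt R J I (e k)) (Y := ModuleCat.of Λ (injAt R J I (e k) ⧸ killSub e s (injAt R J I (e k))))
    (killSub e s (injAt R J I (e k))).mkQ (Submodule.mkQ_surjective _)
  exact free_of_killSub_eq_bot hJ τ hkill
    (inferInstanceAs (Module.Finite Λ (injAt R J I (e k) ⧸ killSub e s (injAt R J I (e k))))) hs
    (killSub_quotient hid)

include hJ in
theorem free_injAt_of_forall_mul_mem (hid : IsIdempotentElem (e k)) (h : I ≤ I')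
    (hI : ∀ X : ModuleCat.{u} Λ, KilledBy I X → (∀ l ∈ s, ∀ x : X, e l • x = 0) → KilledBy I' X)
    (hs : ∀ l ∈ s, ∀ a, e k * a * e l ∈ I)
    (hk : τ.free (injAt R J I' (e k))) : τ.free (injAt R J I (e k)) := by
  refine free_injAt_of_killSub hJ hid h hI ?_ hk
  have htop : killSub e s (injAt R J I (e k)) = ⊤ := by
    refine eq_top_iff.2 fun y _ l hl a => ?_
    by_contra hne
    obtain ⟨b, hb⟩ := exists_smul_smul_injAt_ne_zero hid hne
    apply hb
    rw [smul_smul b, smul_smul, ← mul_assoc]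
    exact killedBy_resQuot _ _ (hs l hl b) _
  rw [htop]
  exact τ.free_of_subsingleton
    (ModuleCat.of Λ (injAt R J I (e k) ⧸ (⊤ : Submodule Λ (injAt R J I (e k)))))

end StandardModuleSteps

/-! ### Splitting the glued pair recovers the given data. -/

section GluedSplitting

variable {Λ : Type u} [Ring Λ] {n : ℕ} {e : Fin n → Λ}
  {R : Type u} [CommRing R] [Algebra R Λ] {J : Type u} [AddCommGroup J] [Module R J]
  {ν : SplitData e} {τ : TorsionPair Λ} {X Y : ModuleCat.{u} Λ}
  [IsArtinianRing R] [Module.Finite R Λ]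
  (hJ : IsInjectiveEnvelope R (R ⧸ Ring.jacobson R) J)

variable (R) in
include R in
theorem SplitData.notMem_projAt (he : OrthogonalIdempotents e)
    (hprim : ∀ k, IsPrimitiveIdempotent (e k))
    (ht : ∀ Y, ν.pair.tors Y ↔ τ.tors ((ν.S.res (ν.S.m + 1)).obj Y)) {k : Fin n}
    (hk : k ∉ ν.S.upto (ν.S.m + 1)) : ¬ τ.tors (projAt (ν.S.stageIdeal (ν.S.m + 1)) (e k)) := by
  intro hT
  let Y : ModuleCat (ν.S.StageAlg (ν.S.m + 1)) :=
    ModuleCat.of _ (Ideal.span {ν.S.toStage (ν.S.m + 1) (e k)})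
  have hY : Subsingleton Y :=
    ν.isE.1 Y ((ht Y).2 hT) (projective_span ((he.idem k).map _))
  rw [← BlockSequence.mem_stageIdeal_iff (R := R) he hprim] at hk
  exact projGen_ne_zero hk (hY.elim _ _)

include hJ in
theorem SplitData.notMem_injAt (he : OrthogonalIdempotents e)
    (hprim : ∀ k, IsPrimitiveIdempotent (e k))
    (hf : ∀ Y, ν.pair.free Y ↔ τ.free ((ν.S.res (ν.S.m + 1)).obj Y)) {k : Fin n}
    (hk : k ∉ ν.S.upto (ν.S.m + 1)) :
    ¬ τ.free (injAt R J (ν.S.stageIdeal (ν.S.m + 1)) (e k)) := by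
  intro hF
  let Y : ModuleCat (ν.S.StageAlg (ν.S.m + 1)) :=
    ModuleCat.of _ (DualRightIdeal R J (ν.S.toStage (ν.S.m + 1) (e k)))
  have hY : Subsingleton Y :=
    ν.isE.2 Y ((hf Y).2 hF) (DualRightIdeal.injective hJ.1 ((he.idem k).map _))
  rw [← BlockSequence.mem_stageIdeal_iff (R := R) he hprim] at hk
  obtain ⟨y, hy⟩ := exists_smul_injAt_ne_zero hJ (I := ν.S.stageIdeal (ν.S.m + 1)) (f := e k)
    (a := e k) (x := 1) (by rwa [mul_one, (he.idem k).eq])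
  exact hy (hY.elim _ _)

theorem BlockSequence.exists_block {S : BlockSequence e} {j : ℕ} {k : Fin n} (hk : k ∉ S.upto j)
    (hkb : k ∉ S.block j) (h : k ∈ S.upto (S.m + 1)) : ∃ i, j < i ∧ i ≤ S.m ∧ k ∈ S.block i := by
  obtain ⟨i, hi, hki⟩ := Finset.mem_biUnion.1 h
  have hi := Finset.mem_range.1 hi
  refine ⟨i, ?_, by omega, hki⟩
  rcases lt_trichotomy j i with hij | rfl | hij
  · exact hij
  · exact absurd hki hkb
  · exact absurd (S.block_subset_upto hij hki) hk

theorem BlockSequence.exists_mul_notMem_left {S : BlockSequence e} {j : ℕ} {k : Fin n}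
    (h : ∃ x : S.StageAlg j, S.toStage j (S.blockSum j) * x * S.toStage j (e k) ≠ 0) :
    ∃ l ∈ S.block j, ∃ a, e l * a * e k ∉ S.stageIdeal j := by
  obtain ⟨x, hx⟩ := h
  obtain ⟨a, rfl⟩ := Ideal.Quotient.mk_surjective x
  by_contra! hall
  apply hx
  rw [← map_mul, ← map_mul, quotientMk_eq_zero_iff, blockSum, Finset.sum_mul, Finset.sum_mul]
  exact sum_mem fun l hl => hall l hl a

theorem BlockSequence.exists_mul_notMem_right {S : BlockSequence e} {j : ℕ} {k : Fin n}
    (h : ∃ x : S.StageAlg j, S.toStage j (e k) * x * S.toStage j (S.blockSum j) ≠ 0) :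
    ∃ l ∈ S.block j, ∃ a, e k * a * e l ∉ S.stageIdeal j := by
  obtain ⟨x, hx⟩ := h
  obtain ⟨a, rfl⟩ := Ideal.Quotient.mk_surjective x
  by_contra! hall
  apply hx
  rw [← map_mul, ← map_mul, quotientMk_eq_zero_iff, blockSum, Finset.mul_sum]
  exact sum_mem fun l hl => hall l hl a

-- The 1-type conditions are used here. Let `j` be even and let `k` be new with `Λ_S^j (e k)`
-- torsion but outside the block; it stays torsion at later stages. If `k` never occurs, this
-- contradicts `𝐄`. If `k` occurs in an odd block, its injective is torsion-free at that stage, so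
-- `e k` would vanish there. If it occurs in an even block `i`, the 1-type condition gives a nonzero
-- map from `Λ_S^{i-1} (e k)` to an injective of the block `i - 1`. Odd `j` is dual.
include hJ in
theorem Supports.determines (he : OrthogonalIdempotents e)
    (hprim : ∀ k, IsPrimitiveIdempotent (e k)) (hs : Supports R J τ ν.S)
    (ht : ∀ Y, ν.pair.tors Y ↔ τ.tors ((ν.S.res (ν.S.m + 1)).obj Y))
    (hf : ∀ Y, ν.pair.free Y ↔ τ.free ((ν.S.res (ν.S.m + 1)).obj Y)) :
    Determines R J τ ν.S where
  proj j hj hev k := by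
    refine ⟨fun hk => ⟨ν.S.notMem_upto hk, hs.proj j hj hev k hk⟩, fun ⟨hk, hT⟩ => ?_⟩
    by_contra hkb
    have hT' : ∀ i, j ≤ i → τ.tors (projAt (ν.S.stageIdeal i) (e k)) := fun i hi =>
      tors_projAt_of_le (he.idem k) (ν.S.stageIdeal_mono he hi) hT
    by_cases hmem : k ∈ ν.S.upto (ν.S.m + 1)
    · obtain ⟨i, hji, him, hki⟩ := BlockSequence.exists_block hk hkb hmem
      rcases Nat.even_or_odd i with hi | hi
      · obtain ⟨i, rfl⟩ : ∃ i', i = i' + 1 := ⟨i - 1, by omega⟩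
        have hi' : Odd i := by rcases Nat.even_or_odd i with h | h <;> grind
        obtain ⟨l, hl, a, ha⟩ := BlockSequence.exists_mul_notMem_left
          (ν.isOneType.1 i hi' him k hki)
        exact ha (mul_mem_of_tors_of_free hJ (hT' i (by omega)) (hs.inj i (by omega) hi' l hl) a)
      · refine ν.S.notMem_upto hki ((BlockSequence.mem_stageIdeal_iff (R := R) he hprim).1 ?_)
        exact mem_of_tors_of_free hJ (he.idem k) (hT' i hji.le) (hs.inj i him hi k hki)
    · exact SplitData.notMem_projAt R he hprim ht hmem (hT' _ (by omega))
  inj j hj hodd k := by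
    refine ⟨fun hk => ⟨ν.S.notMem_upto hk, hs.inj j hj hodd k hk⟩, fun ⟨hk, hF⟩ => ?_⟩
    by_contra hkb
    have : IsNoetherianRing Λ := IsNoetherianRing.of_finite R Λ
    have hF' : ∀ i, j ≤ i → τ.free (injAt R J (ν.S.stageIdeal i) (e k)) := fun i hi =>
      free_injAt_of_le (he.idem k) (ν.S.stageIdeal_mono he hi) hF
    by_cases hmem : k ∈ ν.S.upto (ν.S.m + 1)
    · obtain ⟨i, hji, him, hki⟩ := BlockSequence.exists_block hk hkb hmem
      rcases Nat.even_or_odd i with hi | hi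
      · refine ν.S.notMem_upto hki ((BlockSequence.mem_stageIdeal_iff (R := R) he hprim).1 ?_)
        exact mem_of_tors_of_free hJ (he.idem k) (hs.proj i him hi k hki) (hF' i hji.le)
      · obtain ⟨i, rfl⟩ : ∃ i', i = i' + 1 := ⟨i - 1, by omega⟩
        have hi' : Even i := by rcases Nat.even_or_odd i with h | h <;> grind
        -- The second 1-type condition says nothing about stage `0`; here the stage before `k`
        -- occurs is at least `j > 0`.
        have hj0 : 0 < j := hodd.pos
        obtain ⟨l, hl, a, ha⟩ := BlockSequence.exists_mul_notMem_right
          (ν.isOneType.2 i hi' (by omega) him k hki)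
        exact ha (mul_mem_of_tors_of_free hJ (hs.proj i (by omega) hi' l hl) (hF' i (by omega)) a)
    · exact SplitData.notMem_injAt hJ he hprim hf hmem (hF' _ (by omega))

theorem gluedPair_supports (he : OrthogonalIdempotents e) :
    Supports R J (gluedPair hJ he ν) ν.S where
  proj j hj hev k hk := by
    refine gluedTors_of_genSub_eq_top R he.idem hj hev inferInstance (killedBy_resQuot _) ?_
    refine eq_top_iff.2 fun x _ => ?_
    obtain ⟨a, rfl⟩ := exists_smul_projGen x
    rw [← smul_projGen (he.idem k)]
    exact Submodule.smul_mem _ _ (Submodule.subset_span ⟨k, hk, _, rfl⟩)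
  inj j hj hodd k hk := by
    refine gluedFree_of_killSub_eq_bot hJ he.idem hj hodd (finite_injAt hJ) (killedBy_resQuot _) ?_
    rw [Submodule.eq_bot_iff]
    intro y hy
    by_contra hne
    obtain ⟨a, ha⟩ := exists_smul_smul_injAt_ne_zero (he.idem k) hne
    exact ha (hy k hk a)

/-- The glued torsion-free class contains `ℱ'`, so a last-stage module in the glued torsion class
has no maps to `ℱ'`. -/
theorem gluedPair_tors_iff (he : OrthogonalIdempotents e)
    (Y : ModuleCat.{u} (ν.S.StageAlg (ν.S.m + 1))) :
    ν.pair.tors Y ↔ (gluedPair hJ he ν).tors ((ν.S.res (ν.S.m + 1)).obj Y) := by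
  refine ⟨fun hY => gluedTors_of_pair hY (LinearEquiv.refl _ _), fun hY => ?_⟩
  have hfin := (finite_resQuot_iff Y).1 ((gluedPair hJ he ν).tors_finite _ hY)
  refine ν.pair.tors_of_forall hfin fun Z hZ f => ?_
  have h := (gluedPair hJ he ν).linearMap_eq_zero hY
    (Y := (ν.S.res (ν.S.m + 1)).obj Z) (gluedFree_of_pair hZ (LinearEquiv.refl _ _)) (resMap f)
  ext x
  exact LinearMap.congr_fun h x

theorem gluedPair_free_iff (he : OrthogonalIdempotents e)
    (Y : ModuleCat.{u} (ν.S.StageAlg (ν.S.m + 1))) :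
    ν.pair.free Y ↔ (gluedPair hJ he ν).free ((ν.S.res (ν.S.m + 1)).obj Y) := by
  refine ⟨fun hY => gluedFree_of_pair hY (LinearEquiv.refl _ _), fun hY => ?_⟩
  have hfin := (finite_resQuot_iff Y).1 ((gluedPair hJ he ν).free_finite _ hY)
  refine ν.pair.free_of_forall hfin fun Z hZ f => ?_
  have h := (gluedPair hJ he ν).linearMap_eq_zero
    (X := (ν.S.res (ν.S.m + 1)).obj Z) (gluedTors_of_pair hZ (LinearEquiv.refl _ _)) hY (resMap f)
  ext x
  exact LinearMap.congr_fun h x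

theorem isSplitting_gluedPair (he : CompleteOrthogonalIdempotents e)
    (hprim : ∀ k, IsPrimitiveIdempotent (e k)) :
    IsSplitting R J (gluedPair hJ he.toOrthogonalIdempotents ν) ν :=
  isSplitting_of_determines hJ he hprim
    ((gluedPair_supports hJ he.toOrthogonalIdempotents).determines hJ he.toOrthogonalIdempotents
      hprim (gluedPair_tors_iff hJ _) (gluedPair_free_iff hJ _))
    (gluedPair_tors_iff hJ _) (gluedPair_free_iff hJ _)

end GluedSplitting

/-! ### Uniqueness of the splitting. -/

section Uniqueness

variable {Λ : Type u} [Ring Λ] {n : ℕ} {e : Fin n → Λ}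
  {R : Type u} [CommRing R] [Algebra R Λ] {J : Type u} [AddCommGroup J] [Module R J]
  {S S' : BlockSequence e} {ν ν' : SplitData e} {τ : TorsionPair Λ}

variable (R J) in
/-- No standard projective module over the last stage is torsion, and no standard injective module
over the last stage is torsion-free. -/
structure Exhausts (τ : TorsionPair Λ) (S : BlockSequence e) : Prop where
  proj : ∀ k, k ∉ S.upto (S.m + 1) → ¬ τ.tors (projAt (S.stageIdeal (S.m + 1)) (e k))
  inj : ∀ k, k ∉ S.upto (S.m + 1) → ¬ τ.free (injAt R J (S.stageIdeal (S.m + 1)) (e k))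

theorem BlockSequence.upto_congr {j : ℕ} (h : ∀ i < j, S.block i = S'.block i) :
    S.upto j = S'.upto j :=
  Finset.biUnion_congr rfl fun i hi => h i (Finset.mem_range.1 hi)

theorem Determines.block_eq (h : Determines R J τ S) (h' : Determines R J τ S') {j : ℕ}
    (hj : j ≤ S.m) (hj' : j ≤ S'.m) : S.block j = S'.block j := by
  induction j using Nat.strong_induction_on with
  | _ j ih =>
    have hu : S.upto j = S'.upto j :=
      BlockSequence.upto_congr fun i hi => ih i hi (by omega) (by omega)
    ext k
    rcases Nat.even_or_odd j with hev | hodd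
    · rw [h.proj j hj hev, h'.proj j hj' hev, S.stageIdeal_eq, S'.stageIdeal_eq, hu]
    · rw [h.inj j hj hodd, h'.inj j hj' hodd, S.stageIdeal_eq, S'.stageIdeal_eq, hu]

/-- A longer `S'` would agree with `S` up to its end, and any index in its next block, which is
nonempty, contradicts exhaustion. -/
theorem Determines.le_m (h : Determines R J τ S) (h' : Determines R J τ S')
    (hmax : Exhausts R J τ S) : S'.m ≤ S.m := by
  by_contra! hlt
  have hu : S'.upto (S.m + 1) = S.upto (S.m + 1) :=
    BlockSequence.upto_congr fun i hi => h'.block_eq h (by omega) (by omega)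
  obtain ⟨k, hk⟩ := S'.block_nonempty (S.m + 1) (by omega) hlt
  rcases Nat.even_or_odd (S.m + 1) with hev | hodd
  · obtain ⟨h1, h2⟩ := (h'.proj (S.m + 1) hlt hev k).1 hk
    rw [S'.stageIdeal_eq, hu, ← S.stageIdeal_eq] at h2
    exact hmax.proj k (hu ▸ h1) h2
  · obtain ⟨h1, h2⟩ := (h'.inj (S.m + 1) hlt hodd k).1 hk
    rw [S'.stageIdeal_eq, hu, ← S.stageIdeal_eq] at h2
    exact hmax.inj k (hu ▸ h1) h2

theorem Determines.eq (h : Determines R J τ S) (h' : Determines R J τ S')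
    (hmax : Exhausts R J τ S) (hmax' : Exhausts R J τ S') : S = S' := by
  have hm : S.m = S'.m := le_antisymm (h'.le_m h hmax') (h.le_m h' hmax)
  have hb : S.block = S'.block := by
    funext j
    by_cases hj : j ≤ S.m
    · exact h.block_eq h' hj (hm ▸ hj)
    · rw [S.block_empty j (by omega), S'.block_empty j (by omega)]
  cases S
  cases S'
  simp only at hm hb
  subst hm hb
  rfl

variable [IsArtinianRing R] [Module.Finite R Λ]
  (hJ : IsInjectiveEnvelope R (R ⧸ Ring.jacobson R) J)

include hJ in
theorem IsSplitting.exhausts (he : OrthogonalIdempotents e)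
    (hprim : ∀ k, IsPrimitiveIdempotent (e k)) (h : IsSplitting R J τ ν) :
    Exhausts R J τ ν.S where
  proj _ hk := SplitData.notMem_projAt R he hprim (h.tors_iff hJ he) hk
  inj _ hk := SplitData.notMem_injAt hJ he hprim (h.free_iff hJ he) hk

include hJ in
theorem IsSplitting.unique (he : OrthogonalIdempotents e)
    (hprim : ∀ k, IsPrimitiveIdempotent (e k)) (h : IsSplitting R J τ ν)
    (h' : IsSplitting R J τ ν') : ν = ν' := by
  have hS := (h.determines hJ he hprim).eq (h'.determines hJ he hprim)
    (h.exhausts hJ he hprim) (h'.exhausts hJ he hprim)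
  have ht := h.tors_iff hJ he
  have ht' := h'.tors_iff hJ he
  have hf := h.free_iff hJ he
  have hf' := h'.free_iff hJ he
  obtain ⟨S, h1, σ, h2⟩ := ν
  obtain ⟨S', h1', σ', h2'⟩ := ν'
  obtain rfl : S = S' := hS
  obtain rfl : σ = σ' := TorsionPair.ext
    (funext fun Y => propext ((ht Y).trans (ht' Y).symm))
    (funext fun Y => propext ((hf Y).trans (hf' Y).symm))
  rfl

end Uniqueness

/-! ### Existence of the splitting. -/

section Existence

variable {Λ : Type u} [Ring Λ] {n : ℕ} {e : Fin n → Λ}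
  {R : Type u} [CommRing R] [Algebra R Λ] {J : Type u} [AddCommGroup J] [Module R J]
  {S : BlockSequence e} {τ : TorsionPair Λ}

theorem mul_blockSum (he : OrthogonalIdempotents e) {j : ℕ} {l : Fin n} (hl : l ∈ S.block j) :
    e l * S.blockSum j = e l := by
  rw [BlockSequence.blockSum, Finset.mul_sum, Finset.sum_eq_single l, (he.idem l).eq]
  · exact fun i _ hi => he.ortho hi.symm
  · exact fun h => absurd hl h

theorem blockSum_mul (he : OrthogonalIdempotents e) {j : ℕ} {l : Fin n} (hl : l ∈ S.block j) :
    S.blockSum j * e l = e l := by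
  rw [BlockSequence.blockSum, Finset.sum_mul, Finset.sum_eq_single l, (he.idem l).eq]
  · exact fun i _ hi => he.ortho hi
  · exact fun h => absurd hl h

theorem subsingleton_of_addClosure {Γ : Type u} [Ring Γ] {M : Type u} [AddCommGroup M] [Module Γ M]
    [Subsingleton M] {Y : ModuleCat.{u} Γ} (h : addClosure M Y) : Subsingleton Y := by
  obtain ⟨-, m, f, g, hgf⟩ := h
  have hf : Function.Injective f := Function.LeftInverse.injective (LinearMap.congr_fun hgf)
  exact hf.subsingleton

variable [IsArtinianRing R] [Module.Finite R Λ]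
  (hJ : IsInjectiveEnvelope R (R ⧸ Ring.jacobson R) J)

-- If the condition fails for `k` in the block `j + 1` with `j` odd, the trace of block `j` in
-- `Λ_S^j (e k)` is zero, so `Λ_S^j (e k)` is torsion. Its predecessor at stage `j - 1` is then
-- torsion as well, because the trace there is generated by the torsion module `P_{j-1}`. So `k`
-- would already lie in the block `j - 1` or an earlier one. Even `j > 0` is dual.
include hJ in
theorem Determines.isOneType (he : OrthogonalIdempotents e) (h : Determines R J τ S) :
    S.IsOneType := by
  have : IsNoetherianRing Λ := IsNoetherianRing.of_finite R Λ
  have hstep : ∀ j (X : ModuleCat.{u} Λ), KilledBy (S.stageIdeal j) X →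
      (∀ l ∈ S.block j, ∀ x : X, e l • x = 0) → KilledBy (S.stageIdeal (j + 1)) X :=
    fun j X h1 h2 => (BlockSequence.killedBy_stageIdeal_succ he).2 ⟨h1, h2⟩
  constructor
  · intro j hj hjm k hk
    by_contra! hx
    have hmul : ∀ l ∈ S.block j, ∀ a, e l * a * e k ∈ S.stageIdeal j := by
      intro l hl a
      have := hx (S.toStage j a)
      rw [← map_mul, ← map_mul, quotientMk_eq_zero_iff] at this
      have := TwoSidedIdeal.mul_mem_left _ (e l) _ this
      rwa [← mul_assoc, ← mul_assoc, mul_blockSum he hl] at this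
    obtain ⟨hku, hT⟩ := (h.proj (j + 1) hjm hj.add_one k).1 hk
    have hT := tors_projAt_of_forall_mul_mem (he.idem k) (hstep j) hmul hT
    obtain ⟨j, rfl⟩ : ∃ i, j = i + 1 := ⟨j - 1, by have := hj.pos; omega⟩
    have hev : Even j := by rcases Nat.even_or_odd j with h | h <;> grind
    have hT := tors_projAt_of_step he.idem (hstep j) (h.supports.proj j (by omega) hev) hT
    refine hku (S.block_subset_upto (i := j) (by omega) ((h.proj j (by omega) hev k).2 ⟨?_, hT⟩))
    exact fun hk' => hku (S.upto_mono (by omega) hk')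
  · intro j hj hj0 hjm k hk
    by_contra! hx
    have hmul : ∀ l ∈ S.block j, ∀ a, e k * a * e l ∈ S.stageIdeal j := by
      intro l hl a
      have := hx (S.toStage j a)
      rw [← map_mul, ← map_mul, quotientMk_eq_zero_iff] at this
      have := TwoSidedIdeal.mul_mem_right _ _ (e l) this
      rwa [mul_assoc _ _ (e l), blockSum_mul he hl] at this
    obtain ⟨hku, hF⟩ := (h.inj (j + 1) hjm hj.add_one k).1 hk
    have hF := free_injAt_of_forall_mul_mem hJ (he.idem k) (S.stageIdeal_mono he (Nat.le_succ j))
      (hstep j) hmul hF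
    obtain ⟨j, rfl⟩ : ∃ i, j = i + 1 := ⟨j - 1, by omega⟩
    have hodd : Odd j := by rcases Nat.even_or_odd j with h | h <;> grind
    have hF := free_injAt_of_step hJ he.idem (S.stageIdeal_mono he (Nat.le_succ j)) (hstep j)
      (h.supports.inj j (by omega) hodd) hF
    refine hku (S.block_subset_upto (i := j) (by omega) ((h.inj j (by omega) hodd k).2 ⟨?_, hF⟩))
    exact fun hk' => hku (S.upto_mono (by omega) hk')

-- Only the parity of `m + 1` has to be tested: for the other parity, the property lifts back to
-- stage `m`, whose block already contains all such indices.
include hJ in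
theorem Determines.exhausts (he : OrthogonalIdempotents e) (h : Determines R J τ S)
    (hproj : Even (S.m + 1) → ∀ k, k ∉ S.upto (S.m + 1) →
      ¬ τ.tors (projAt (S.stageIdeal (S.m + 1)) (e k)))
    (hinj : Odd (S.m + 1) → ∀ k, k ∉ S.upto (S.m + 1) →
      ¬ τ.free (injAt R J (S.stageIdeal (S.m + 1)) (e k))) : Exhausts R J τ S := by
  have : IsNoetherianRing Λ := IsNoetherianRing.of_finite R Λ
  have hstep : ∀ X : ModuleCat.{u} Λ, KilledBy (S.stageIdeal S.m) X →
      (∀ l ∈ S.block S.m, ∀ x : X, e l • x = 0) → KilledBy (S.stageIdeal (S.m + 1)) X :=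
    fun X h1 h2 => (BlockSequence.killedBy_stageIdeal_succ he).2 ⟨h1, h2⟩
  constructor
  · intro k hk hT
    rcases Nat.even_or_odd S.m with hm | hm
    · rw [S.upto_succ, Finset.mem_union, not_or] at hk
      refine hk.2 ((h.proj S.m le_rfl hm k).2 ⟨hk.1, ?_⟩)
      exact tors_projAt_of_step he.idem hstep (h.supports.proj S.m le_rfl hm) hT
    · exact hproj hm.add_one k hk hT
  · intro k hk hF
    rcases Nat.even_or_odd S.m with hm | hm
    · exact hinj hm.add_one k hk hF
    · rw [S.upto_succ, Finset.mem_union, not_or] at hk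
      refine hk.2 ((h.inj S.m le_rfl hm k).2 ⟨hk.1, ?_⟩)
      exact free_injAt_of_step hJ he.idem (S.stageIdeal_mono he (Nat.le_succ _)) hstep
        (h.supports.inj S.m le_rfl hm) hF

-- With `s = ∅`, the projectives in the torsion class form `add` of an empty product, so they
-- vanish; injectives likewise.
include hJ in
theorem Exhausts.isE (he : CompleteOrthogonalIdempotents e)
    (hprim : ∀ k, IsPrimitiveIdempotent (e k)) (h : Exhausts R J τ S) :
    (τ.restrict (S.stageIdeal (S.m + 1))).IsE := by
  have hmem := fun k => (BlockSequence.mem_stageIdeal_iff (R := R) (S := S) (j := S.m + 1) (k := k)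
    he.toOrthogonalIdempotents hprim).not
  constructor
  · intro Y hT hP
    refine subsingleton_of_addClosure ((tors_projective_iff_addClosure (s := ∅) R τ he.idem
      he.complete (fun k => (hprim k).isLocalCorner (R := R)) (by simp) (fun k hk hT => ?_) Y).1
        ⟨hT, hP⟩)
    exact absurd hT (h.proj k ((hmem k).1 hk))
  · intro Y hF hI
    refine subsingleton_of_addClosure ((free_injective_iff_addClosure (s := ∅) hJ τ he.idem
      he.complete (fun k => (hprim k).isLocalCorner (R := R)) (by simp) (fun k hk hF => ?_) Y).1
        ⟨hF, hI⟩)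
    exact absurd hF (h.inj k ((hmem k).1 hk))

variable (R J e) in
open Classical in
/-- The indices outside `A` whose standard projective module (for even `j`) over the quotient by the
`e k`, `k ∈ A`, is torsion, or whose standard injective module (for odd `j`) is torsion-free. -/
def nextBlock (τ : TorsionPair Λ) (j : ℕ) (A : Finset (Fin n)) : Finset (Fin n) :=
  Finset.univ.filter fun k => k ∉ A ∧ (Even j → τ.tors (projAt (idemIdeal e A) (e k))) ∧
    (Odd j → τ.free (injAt R J (idemIdeal e A) (e k)))

variable (R J e) in
/-- The indices that are split off in the first `j` steps. -/
def usedIndices (τ : TorsionPair Λ) : ℕ → Finset (Fin n)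
  | 0 => ∅
  | j + 1 => usedIndices τ j ∪ nextBlock e R J τ j (usedIndices τ j)

variable {j : ℕ} {A : Finset (Fin n)} {k : Fin n}

omit [IsArtinianRing R] [Module.Finite R Λ] in
theorem mem_nextBlock : k ∈ nextBlock e R J τ j A ↔ k ∉ A ∧
    (Even j → τ.tors (projAt (idemIdeal e A) (e k))) ∧
      (Odd j → τ.free (injAt R J (idemIdeal e A) (e k))) := by
  classical
  rw [nextBlock, Finset.mem_filter, and_iff_right (Finset.mem_univ k)]

omit [IsArtinianRing R] [Module.Finite R Λ] in
theorem mem_nextBlock_of_even (hj : Even j) :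
    k ∈ nextBlock e R J τ j A ↔ k ∉ A ∧ τ.tors (projAt (idemIdeal e A) (e k)) := by
  simp [mem_nextBlock, hj, Nat.not_odd_iff_even.2 hj]

omit [IsArtinianRing R] [Module.Finite R Λ] in
theorem mem_nextBlock_of_odd (hj : Odd j) :
    k ∈ nextBlock e R J τ j A ↔ k ∉ A ∧ τ.free (injAt R J (idemIdeal e A) (e k)) := by
  simp [mem_nextBlock, hj, Nat.not_even_iff_odd.2 hj]

omit [IsArtinianRing R] [Module.Finite R Λ] in
theorem disjoint_nextBlock : Disjoint A (nextBlock e R J τ j A) :=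
  Finset.disjoint_left.2 fun _ hk hk' => (mem_nextBlock.1 hk').1 hk

theorem nextBlock_iso_closed (hid : ∀ k, IsIdempotentElem (e k))
    (hA : ∀ k ∈ A, ∀ l, Nonempty (Ideal.span {e k} ≃ₗ[Λ] Ideal.span {e l}) → l ∈ A)
    (hk : k ∈ nextBlock e R J τ j A) {l : Fin n}
    (E : Ideal.span {e k} ≃ₗ[Λ] Ideal.span {e l}) : l ∈ nextBlock e R J τ j A := by
  have : IsNoetherianRing Λ := IsNoetherianRing.of_finite R Λ
  obtain ⟨u, v, h1, h2, h3, h4, h5, h6⟩ := exists_mul_eq_of_linearEquiv (hid k) (hid l) E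
  rw [mem_nextBlock] at hk ⊢
  obtain ⟨hkA, hT, hF⟩ := hk
  refine ⟨fun hl => hkA (hA l hl k ⟨E.symm⟩), fun hj => ?_, fun hj => ?_⟩
  · obtain ⟨g, hg⟩ := exists_surjective_projAt_of_mul_eq (I := idemIdeal e A) (hid l) h1 h6
    exact τ.tors_of_surjective (hT hj) g hg
  · obtain ⟨g, hg⟩ := exists_injective_injAt_of_mul_eq (R := R) (J := J) (I := idemIdeal e A)
      h1 h3 h6
    exact τ.free_of_injective (hF hj) g hg

theorem usedIndices_iso_closed (hid : ∀ k, IsIdempotentElem (e k)) (j : ℕ) :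
    ∀ k ∈ usedIndices e R J τ j, ∀ l, Nonempty (Ideal.span {e k} ≃ₗ[Λ] Ideal.span {e l}) →
      l ∈ usedIndices e R J τ j := by
  induction j with
  | zero => exact fun k hk => absurd hk (Finset.notMem_empty k)
  | succ j ih =>
    intro k hk l E
    rcases Finset.mem_union.1 hk with hk | hk
    · exact Finset.mem_union_left _ (ih k hk l E)
    · exact Finset.mem_union_right _ (nextBlock_iso_closed hid ih hk E.some)

omit [IsArtinianRing R] [Module.Finite R Λ] in
theorem usedIndices_mono {i j : ℕ} (h : i ≤ j) :
    usedIndices e R J τ i ⊆ usedIndices e R J τ j := by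
  induction j, h using Nat.le_induction with
  | base => exact subset_rfl
  | succ j _ ih => exact ih.trans Finset.subset_union_left

-- Each nonempty block uses up at least one of the `n` indices. The search starts at block `1`,
-- since `Δ_0` may be empty without ending the process.
omit [IsArtinianRing R] [Module.Finite R Λ] in
variable (R J e τ) in
theorem exists_nextBlock_eq_empty :
    ∃ m, nextBlock e R J τ (m + 1) (usedIndices e R J τ (m + 1)) = ∅ := by
  by_contra! h
  have hcard : ∀ m, m ≤ (usedIndices e R J τ (m + 1)).card := by
    intro m
    induction m with
    | zero => exact Nat.zero_le _
    | succ m ih =>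
      rw [usedIndices, Finset.card_union_of_disjoint disjoint_nextBlock]
      have := (h m).card_pos
      omega
  have := (hcard (n + 1)).trans (Finset.card_le_univ _)
  rw [Fintype.card_fin] at this
  omega

open Classical in
variable (R J τ) in
/-- The blocks obtained by splitting off alternately projectives and injectives until no index is
left to split off. -/
def splitBlocks (hid : ∀ k, IsIdempotentElem (e k)) : BlockSequence e where
  m := Nat.find (exists_nextBlock_eq_empty e R J τ)
  block j := if j ≤ Nat.find (exists_nextBlock_eq_empty e R J τ) then
    nextBlock e R J τ j (usedIndices e R J τ j) else ∅
  block_nonempty j h1 hj := by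
    rw [if_pos hj, Finset.nonempty_iff_ne_empty]
    obtain ⟨j, rfl⟩ : ∃ i, j = i + 1 := ⟨j - 1, by omega⟩
    -- Minimality of `m` makes the blocks `1, …, m` nonempty.
    exact Nat.find_min (exists_nextBlock_eq_empty e R J τ) hj
  block_empty j hj := if_neg (by omega)
  disjoint := by
    have key : ∀ i j, i < j → Disjoint (nextBlock e R J τ i (usedIndices e R J τ i))
        (nextBlock e R J τ j (usedIndices e R J τ j)) := fun i j hij =>
      disjoint_nextBlock.mono_left
        (Finset.subset_union_right.trans (usedIndices_mono (Nat.succ_le_of_lt hij)))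
    intro i j hij
    split_ifs
    · rcases lt_or_gt_of_ne hij with h | h
      · exact key i j h
      · exact (key j i h).symm
    all_goals simp
  iso_closed j k hk l E := by
    split_ifs at hk ⊢
    · exact nextBlock_iso_closed hid (usedIndices_iso_closed hid j) hk E.some
    · exact absurd hk (Finset.notMem_empty k)

theorem splitBlocks_upto (hid : ∀ k, IsIdempotentElem (e k)) (hj : j ≤ (splitBlocks R J τ hid).m + 1) :
    (splitBlocks R J τ hid).upto j = usedIndices e R J τ j := by
  induction j with
  | zero => rfl
  | succ j ih =>
    rw [BlockSequence.upto_succ, ih (by omega), usedIndices]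
    exact congrArg _ (if_pos (Nat.le_of_succ_le_succ hj))

theorem splitBlocks_block (hid : ∀ k, IsIdempotentElem (e k)) (hj : j ≤ (splitBlocks R J τ hid).m) :
    (splitBlocks R J τ hid).block j =
      nextBlock e R J τ j ((splitBlocks R J τ hid).upto j) := by
  rw [splitBlocks_upto hid (by omega)]
  exact if_pos hj

theorem splitBlocks_nextBlock (hid : ∀ k, IsIdempotentElem (e k)) :
    nextBlock e R J τ ((splitBlocks R J τ hid).m + 1)
      ((splitBlocks R J τ hid).upto ((splitBlocks R J τ hid).m + 1)) = ∅ := by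
  classical
  rw [splitBlocks_upto hid le_rfl]
  exact Nat.find_spec (exists_nextBlock_eq_empty e R J τ)

theorem splitBlocks_determines (hid : ∀ k, IsIdempotentElem (e k)) :
    Determines R J τ (splitBlocks R J τ hid) where
  proj j hj hev k := by
    rw [splitBlocks_block hid hj, mem_nextBlock_of_even hev, BlockSequence.stageIdeal_eq]
  inj j hj hodd k := by
    rw [splitBlocks_block hid hj, mem_nextBlock_of_odd hodd, BlockSequence.stageIdeal_eq]

include hJ in
theorem splitBlocks_exhausts (he : OrthogonalIdempotents e) :
    Exhausts R J τ (splitBlocks R J τ he.idem) := by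
  have h := Finset.eq_empty_iff_forall_notMem.1 (splitBlocks_nextBlock (R := R) (J := J) (τ := τ)
    he.idem)
  refine (splitBlocks_determines he.idem).exhausts hJ he (fun hev k hk hT => ?_)
    fun hodd k hk hF => ?_
  · rw [BlockSequence.stageIdeal_eq] at hT
    exact h k ((mem_nextBlock_of_even hev).2 ⟨hk, hT⟩)
  · rw [BlockSequence.stageIdeal_eq] at hF
    exact h k ((mem_nextBlock_of_odd hodd).2 ⟨hk, hF⟩)

/-- The outcome of splitting off alternately projectives and injectives from a torsion pair. -/
def splitting (hJ : IsInjectiveEnvelope R (R ⧸ Ring.jacobson R) J)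
    (he : CompleteOrthogonalIdempotents e) (hprim : ∀ k, IsPrimitiveIdempotent (e k))
    (τ : TorsionPair Λ) : SplitData e where
  S := splitBlocks R J τ he.idem
  isOneType := (splitBlocks_determines he.idem).isOneType hJ he.toOrthogonalIdempotents
  pair := τ.restrict _
  isE := (splitBlocks_exhausts hJ he.toOrthogonalIdempotents).isE hJ he hprim

theorem isSplitting_splitting (he : CompleteOrthogonalIdempotents e)
    (hprim : ∀ k, IsPrimitiveIdempotent (e k)) :
    IsSplitting R J τ (splitting hJ he hprim τ) :=
  isSplitting_of_determines hJ he hprim (splitBlocks_determines he.idem) (fun _ => Iff.rfl)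
    fun _ => Iff.rfl

end Existence

end

theorem theorem3p11 (R : Type u) [CommRing R] [IsArtinianRing R]
    (J : Type u) [AddCommGroup J] [Module R J]
    (hJ : IsInjectiveEnvelope R (R ⧸ Ring.jacobson R) J)
    (Λ : Type u) [Ring Λ] [Algebra R Λ] [Module.Finite R Λ]
    (n : ℕ) (e : Fin n → Λ) (he : CompleteOrthogonalIdempotents e)
    (hprim : ∀ k, IsPrimitiveIdempotent (e k)) :
    ∃ F : TorsionPair Λ ≃ SplitData e,
      (∀ (τ : TorsionPair Λ) (ν : SplitData e), F τ = ν ↔ IsSplitting R J τ ν) ∧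
      (∀ ν : SplitData e,
        (F.symm ν).tors = gluedTors ν ∧ (F.symm ν).free = gluedFree R J ν) := by
  have ho := he.toOrthogonalIdempotents
  have hF : ∀ τ : TorsionPair Λ, IsSplitting R J τ (splitting hJ he hprim τ) := fun τ =>
    isSplitting_splitting hJ he hprim
  refine ⟨⟨splitting hJ he hprim, gluedPair hJ ho, fun τ => ?_, fun ν => ?_⟩, fun τ ν => ?_,
    fun ν => ⟨rfl, rfl⟩⟩
  -- Every pair is glued from its splitting.
  · obtain ⟨h1, h2⟩ := (hF τ).eq_glued hJ ho
    exact TorsionPair.ext h1.symm h2.symm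
  -- Both `ν` and the constructed splitting split the pair glued from `ν`.
  · exact (hF _).unique hJ ho hprim (isSplitting_gluedPair hJ he hprim)
  · exact ⟨fun h => h ▸ hF τ, fun h => (hF τ).unique hJ ho hprim h⟩
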